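/- **Setting.** Let $D_1,D_2,\dots$ be i.i.d. with law $P$ on a measurable space $\mathcal D$. Let $\Theta\subseteq\mathbb R^d$, let $V$ be a (semi)normed real vector space, and let $g:\mathcal D\times\mathbb R^d\times V\to\mathbb R^L$. Nuisance parameters are functions $\xi=\xi(\theta)$ with values in $V$; they form a convex set $\Xi$, and $\xi_0\in\Xi$ is the true one. We write $g(D,\theta,\xi)$ for $g(D,\theta,\xi(\theta))$, $\|x\|_+=\|\max(x,0)\|$ (coordinatewise maximum), and $d_H$ for the Hausdorff distance ($\infty$ if exactly one of the sets is empty). The identified set $\Theta_I=\{\theta\in\Theta:\mathbb E g(D,\theta,\xi_0)\le 0\}$ is nonempty. For $\varepsilon\ge0$ let $\Theta_I^{-\varepsilon}=\{\theta\in\Theta_I: d(\theta,\Theta\setminus\Theta_I)\ge\varepsilon\}$, with $d(\theta,\emptyset)=\infty$. **Estimator (cross-fitting).** For each $N$, $\{1,\dots,N\}$ is randomly partitioned, independently of the data, into a fixed number $\mathcal K\ge2$ of folds $J_1,\dots,J_{\mathcal K}$ of equal size (up to rounding). For $i\in J_k$, $\hat\xi_i=\hat\xi^{(k)}$ is an estimate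 of $\xi_0$ computed from $(D_j)_{j\notin J_k}$ only. Put $$Q_N(\theta,\hat\xi)=\Big\|\tfrac1N\sum_{i=1}^N g(D_i,\theta,\hat\xi_i)\Big\|_+^2,\qquad \hat\Theta_I=\{\theta\in\Theta: N Q_N(\theta,\hat\xi)\le\hat c\},$$ where $\hat c$ is a possibly data-dependent level; $Q_N(\theta,\xi)$ denotes the same criterion with all $\hat\xi_i$ replaced by a fixed $\xi$. **Conditions.** (A) *Partial identification.* There are $C,\delta>0$ with $\|\mathbb E g(D,\theta,\xi_0)\|_+\ge (C\,d(\theta,\Theta_I))\wedge\delta$ for all $\theta\in\Theta$. (B) *Orthogonality.* There are sets $\Xi_N\subseteq\Xi$ with $\xi_0\in\Xi_N$ such that: for some $\phi_N=o(1)$, $\Pr(\hat\xi^{(k)}\in\Xi_N)\ge1-\phi_N$ for each $k$; for some $g_N=o(N^{-1/4})$, $\|\xi(\theta)-\xi_0(\theta)\|\le g_N$ for all $\xi\in\Xi_N$, $\theta\in\Theta$; for all $\xi\in\Xi_N$, $\theta\in\Theta$ the expectation $f(r)=\mathbb E g(D,\theta,r(\xi-\xi_0)+\xi_0)$ exists for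 $r\in[0,1]$ and is continuous on $[0,1]$, twice differentiable on $[0,1)$, with $f'(0)=0$ and $\|f''(r)\|\le s_N$ on $[0,1)$, where $s_N=o(N^{-1/2})$ does not depend on $\xi,\theta,r$. (C) *Regularity.* There are constants $c>2$, $c_1$, $a>0$, $v$ such that for every $N$ and $\xi\in\Xi_N$ the class $\mathcal F_\xi=\{g(\cdot,\theta,\xi(\theta)):\theta\in\Theta\}$ has a measurable envelope $F_\xi$ ($\sup_{\theta\in\Theta}|g_l(D,\theta,\xi)|\le F_\xi(D)$ a.s. for each $l$) with $\|F_\xi\|_{P,c}\le c_1$ and $\log N(\epsilon\|F_\xi\|_{\tilde Q,2},\mathcal F_\xi,\|\cdot\|_{\tilde Q,2})\le v\log(a/\epsilon)$ for all $0<\epsilon\le1$ and all finitely discrete probability measures $\tilde Q$ with $\|F_\xi\|_{\tilde Q,2}>0$. Moreover, for some $r_N'\to0$ with $r_N'\log(1/r_N')=o(1)$, $(\mathbb E\|g(D,\theta,\xi)-g(D,\theta,\xi_0)\|^2)^{1/2}\le r_N'$ for all $\theta\in\Theta$, $\xi\in\Xi_N$. The classes are suitably (pointwise) measurable: each $\mathcal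 F_\xi$, $\xi\in\Xi_N$, consists of measurable functions and contains a countable subclass of which every member of $\mathcal F_\xi$ is a pointwise sequential limit; for the classes estimated at sample size $N$, such a countable index set in $\Theta$ can be chosen independently of the data as long as the estimate lies in $\Xi_N$; and $g(\cdot,\theta,\hat\xi(\theta))$ is jointly measurable in the observation and the data used to compute $\hat\xi$. (D) *Donsker property.* For some open $\Theta'\supseteq\Theta$, $\sqrt N\big(\frac1N\sum_{i\le N} g(D_i,\theta,\xi_0)-\mathbb E g(D,\theta,\xi_0)\big)$ converges weakly in $\ell^\infty(\Theta')$ to a Borel measurable mean zero Gaussian process $\Delta(\theta)$ with a.s. continuous paths whose components have positive variance at every $\theta\in\Theta'$. (E) There are $C,M,\delta>0$ with $\max_l\mathbb E g_l(D,\theta,\xi_0)\le -C(\varepsilon\wedge\delta)$ for all $\varepsilon\ge0$ and $\theta\in\Theta_I^{-\varepsilon}$, and $d_H(\Theta_I^{-\varepsilon},\Theta_I)\le M\varepsilon$ for all $\varepsilon\in[0,\delta]$. **Conclusion.** (1) The sample criterion is degenerate: there are data-dependent subsets $\Theta_N\subseteq\Theta$, not depending on $\xi$, and data-dependent $\epsilon_N=O_P(N^{-1/2})$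 with $d_H(\Theta_N,\Theta_I)\le\epsilon_N$, such that for every $p>0$ there is $N_p$ with $$\inf_{\xi\in\Xi_N}\Pr\Big(Q_N(\theta,\xi)-\inf_{\theta'\in\Theta}Q_N(\theta',\xi)=0\ \ \forall\,\theta\in\Theta_N\Big)\ge1-p\qquad\text{for all }N\ge N_p.$$ (2) For every contour level $\hat c=O_P(1)$ with $\hat c\ \ge\ \inf_{\theta\in\Theta}Q_N(\theta,\hat\xi)\vee\frac{\log N}{\sqrt N}$ with probability approaching one, $d_H(\hat\Theta_I,\Theta_I)=O_P(N^{-1/2})$. -/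

import Mathlib

open MeasureTheory ProbabilityTheory Filter Topology Asymptotics
open scoped ENNReal

noncomputable section

namespace MomentInequality

/-! ### Stochastic orders

Probabilities of sets that need not be measurable are outer probabilities (the value of a Mathlib
measure at an arbitrary set); "with probability at least `1 - p`" bounds the outer probability of
the complement by `p`. -/

/-- `A N` holds with probability approaching one. -/
def WithProbToOne {Ω : Type*} [MeasurableSpace Ω] (μ : Measure Ω) (A : ℕ → Ω → Prop) : Prop :=
  Tendsto (fun N => μ {ω | ¬ A N ω}) atTop (𝓝 0)

/-- `Y N = O_P (r N)` for a sequence of `[0, ∞]`-valued functions `Y N`. -/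
def IsBigOP {Ω : Type*} [MeasurableSpace Ω] (μ : Measure Ω) (Y : ℕ → Ω → ℝ≥0∞) (r : ℕ → ℝ) :
    Prop :=
  ∀ p : ℝ, 0 < p → ∃ (R : ℝ) (N₀ : ℕ), 0 < R ∧ ∀ N ≥ N₀,
    μ {ω | ENNReal.ofReal (R * r N) < Y N ω} ≤ ENNReal.ofReal p

/-- Outer expectation of a bounded real function. -/
def outerExpectation {Ω : Type*} [MeasurableSpace Ω] (μ : Measure Ω) (f : Ω → ℝ) : ℝ :=
  sInf {r : ℝ | ∃ u : Ω → ℝ, Integrable u μ ∧ (∀ ω, f ω ≤ u ω) ∧ r = ∫ ω, u ω ∂μ}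

/-! ### The model -/

/-- `‖x‖₊ = ‖max (x, 0)‖`, the maximum being taken coordinatewise. -/
def posNorm {L : ℕ} (x : EuclideanSpace ℝ (Fin L)) : ℝ :=
  ‖(WithLp.toLp 2 (fun l => max (x l) 0) : EuclideanSpace ℝ (Fin L))‖

/-- The primitives of a moment inequality model: the law `P` of one observation, the parameter
space `Θ ⊆ ℝ^d`, the moment function `g`, the true value `ξ₀ = ξ₀(·)` of the nuisance parameter,
the set `Ξ` of possible nuisance parameters `ξ = ξ(·)`, and the sequence `ΞN` of nuisance
realization sets. Products `∏_θ Ξ^θ` are the special case `Set.pi`. -/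
structure Model (𝒟 V : Type*) [MeasurableSpace 𝒟] (d L : ℕ) where
  P : Measure 𝒟
  Θ : Set (EuclideanSpace ℝ (Fin d))
  g : 𝒟 → EuclideanSpace ℝ (Fin d) → V → EuclideanSpace ℝ (Fin L)
  ξ₀ : EuclideanSpace ℝ (Fin d) → V
  Ξ : Set (EuclideanSpace ℝ (Fin d) → V)
  ΞN : ℕ → Set (EuclideanSpace ℝ (Fin d) → V)

namespace Model

section Basic

variable {𝒟 V : Type*} [MeasurableSpace 𝒟] {d L : ℕ} (M : Model 𝒟 V d L)

/-- The expected moment `𝔼 g(D, θ, v)`. -/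
def mean (θ : EuclideanSpace ℝ (Fin d)) (v : V) : EuclideanSpace ℝ (Fin L) :=
  ∫ D, M.g D θ v ∂M.P

/-- The identified set `Θ_I = {θ ∈ Θ : 𝔼 g(D, θ, ξ₀(θ)) ≤ 0}`. -/
def identifiedSet : Set (EuclideanSpace ℝ (Fin d)) :=
  {θ | θ ∈ M.Θ ∧ ∀ l, M.mean θ (M.ξ₀ θ) l ≤ 0}

/-- The `ε`-contraction `{θ ∈ Θ_I : d(θ, Θ \ Θ_I) ≥ ε}` of `Θ_I`, where `d(θ, ∅) = ∞`. -/
def contraction (ε : ℝ) : Set (EuclideanSpace ℝ (Fin d)) :=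
  {θ | θ ∈ M.identifiedSet ∧ ENNReal.ofReal ε ≤ Metric.infEDist θ (M.Θ \ M.identifiedSet)}

/-- The sample criterion `Q_N(θ, ξ) = ‖(1/N) ∑ᵢ g(xᵢ, θ, ξᵢ(θ))‖₊²`, where the nuisance parameter
`ξᵢ` may depend on the observation (as it does under cross-fitting). -/
def Q {N : ℕ} (x : Fin N → 𝒟) (ξ : Fin N → EuclideanSpace ℝ (Fin d) → V)
    (θ : EuclideanSpace ℝ (Fin d)) : ℝ :=
  posNorm ((N : ℝ)⁻¹ • ∑ i, M.g (x i) θ (ξ i θ)) ^ 2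

/-- The contour set `{θ ∈ Θ : N Q_N(θ, ξ) ≤ c}`. -/
def contourSet {N : ℕ} (x : Fin N → 𝒟) (ξ : Fin N → EuclideanSpace ℝ (Fin d) → V) (c : ℝ) :
    Set (EuclideanSpace ℝ (Fin d)) :=
  {θ | θ ∈ M.Θ ∧ (N : ℝ) * M.Q x ξ θ ≤ c}

/-- Partial identification condition. -/
def PartialIdentification : Prop :=
  ∃ C δ : ℝ, 0 < C ∧ 0 < δ ∧ ∀ θ ∈ M.Θ,
    min (C * Metric.infDist θ M.identifiedSet) δ ≤ posNorm (M.mean θ (M.ξ₀ θ))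

/-- The moments are strictly negative, linearly in `ε`, on the `ε`-contractions of `Θ_I`, and these
contractions approximate `Θ_I` linearly in Hausdorff distance. -/
def ContractionCondition : Prop :=
  ∃ C K δ : ℝ, 0 < C ∧ 0 < K ∧ 0 < δ ∧
    (∀ ε : ℝ, 0 ≤ ε → ∀ θ ∈ M.contraction ε, ∀ l, M.mean θ (M.ξ₀ θ) l ≤ -C * min ε δ) ∧
    (∀ ε : ℝ, 0 ≤ ε → ε ≤ δ →
      Metric.hausdorffEDist (M.contraction ε) M.identifiedSet ≤ ENNReal.ofReal (K * ε))

/-- The norm of `f` in `L²(Q)`, `Q` being the discrete measure with weights `w j` at `x j`. -/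
def discreteL2Norm {W : Type*} [Norm W] {m : ℕ} (w : Fin m → ℝ) (x : Fin m → 𝒟) (f : 𝒟 → W) : ℝ :=
  Real.sqrt (∑ j, w j * ‖f (x j)‖ ^ 2)

/-- For every finitely discrete probability measure `Q` with `‖F‖_{Q,2} > 0` and all `0 < ε ≤ 1`,
the class `{g(·, θ, ξ(θ)) : θ ∈ Θ}` has an `L²(Q)`-covering number at radius `ε ‖F‖_{Q,2}` whose
logarithm is at most `v log (a / ε)`. -/
def UniformEntropyBound (ξ : EuclideanSpace ℝ (Fin d) → V) (F : 𝒟 → ℝ) (a v : ℝ) : Prop :=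
  ∀ (m : ℕ) (w : Fin m → ℝ) (x : Fin m → 𝒟), (∀ j, 0 ≤ w j) → ∑ j, w j = 1 →
    0 < discreteL2Norm w x F → ∀ ε : ℝ, 0 < ε → ε ≤ 1 →
    ∃ T : Finset (𝒟 → EuclideanSpace ℝ (Fin L)), Real.log T.card ≤ v * Real.log (a / ε) ∧
      ∀ θ ∈ M.Θ, ∃ f ∈ T,
        discreteL2Norm w x (fun D => M.g D θ (ξ θ) - f D) ≤ ε * discreteL2Norm w x F

/-- Every member of `{g(·, θ, ξ(θ)) : θ ∈ Θ}` is a pointwise limit of a sequence of members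
with indices in `T`. -/
def PointwiseSeparable (T : Set (EuclideanSpace ℝ (Fin d)))
    (ξ : EuclideanSpace ℝ (Fin d) → V) : Prop :=
  ∀ θ ∈ M.Θ, ∃ t : ℕ → EuclideanSpace ℝ (Fin d), (∀ m, t m ∈ T) ∧
    ∀ D, Tendsto (fun m => M.g D (t m) (ξ (t m))) atTop (𝓝 (M.g D θ (ξ θ)))

/-- Regularity of the moment function. The first two fields say that, for each nuisance
realization, `{g(·, θ, ξ(θ)) : θ ∈ Θ}` is a pointwise measurable class. -/
structure Regularity : Prop where
  measurable : ∀ N, ∀ ξ ∈ M.ΞN N, ∀ θ ∈ M.Θ, Measurable fun D => M.g D θ (ξ θ)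
  separable : ∀ N, ∀ ξ ∈ M.ΞN N, ∃ T : Set (EuclideanSpace ℝ (Fin d)),
    T.Countable ∧ T ⊆ M.Θ ∧ M.PointwiseSeparable T ξ
  envelope_entropy : ∃ c c₁ a v : ℝ, 2 < c ∧ 0 < a ∧ ∀ N, ∀ ξ ∈ M.ΞN N, ∃ F : 𝒟 → ℝ,
    Measurable F ∧ (∀ᵐ D ∂M.P, ∀ θ ∈ M.Θ, ∀ l, |M.g D θ (ξ θ) l| ≤ F D) ∧
    eLpNorm F (ENNReal.ofReal c) M.P ≤ ENNReal.ofReal c₁ ∧ M.UniformEntropyBound ξ F a v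
  mean_square_rate : ∃ r : ℕ → ℝ, Tendsto r atTop (𝓝 0) ∧
    Tendsto (fun N => r N * Real.log (1 / r N)) atTop (𝓝 0) ∧
    ∀ N, ∀ ξ ∈ M.ΞN N, ∀ θ ∈ M.Θ,
      eLpNorm (fun D => M.g D θ (ξ θ) - M.g D θ (M.ξ₀ θ)) 2 M.P ≤ ENNReal.ofReal (r N)

/-- Degeneracy of the sample criterion: there are data-dependent subsets `Θ_N` of `Θ`, not depending
on `ξ`, on which `Q_N(·, ξ)` attains its infimum over `Θ` with probability approaching one,
uniformly in `ξ`, and which approximate `Θ_I` at rate `N^{-1/2}` in Hausdorff distance. -/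
def Degenerate {Ω : Type*} [MeasurableSpace Ω] (μ : Measure Ω) (X : ℕ → Ω → 𝒟) : Prop :=
  ∃ (ΘN : (N : ℕ) → (Fin N → 𝒟) → Set (EuclideanSpace ℝ (Fin d)))
    (ε : (N : ℕ) → (Fin N → 𝒟) → ℝ),
    (∀ N x, ΘN N x ⊆ M.Θ) ∧
    (∀ p : ℝ, 0 < p → ∃ Np : ℕ, ∀ N ≥ Np, ∀ ξ ∈ M.ΞN N,
      μ {ω | ¬ ∀ θ ∈ ΘN N (fun i => X i ω),
        M.Q (fun i : Fin N => X i ω) (fun _ => ξ) θ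
          - ⨅ θ' : M.Θ, M.Q (fun i : Fin N => X i ω) (fun _ => ξ) θ' = 0} ≤ ENNReal.ofReal p) ∧
    (∀ N x, Metric.hausdorffEDist (ΘN N x) M.identifiedSet ≤ ENNReal.ofReal (ε N x)) ∧
    IsBigOP μ (fun N ω => ENNReal.ofReal (ε N (fun i => X i ω))) (fun N => (Real.sqrt N)⁻¹)

/-- Donsker property of `g(·, θ, ξ₀(θ))` on an open neighbourhood `Θ'` of `Θ`: the empirical
processes converge weakly in `ℓ^∞(Θ')`, in the sense of outer expectations, to a Borel measurable
mean zero Gaussian process `Δ` with almost surely continuous paths and positive variances. -/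
def Donsker {Ω : Type*} [MeasurableSpace Ω] (μ : Measure Ω) (X : ℕ → Ω → 𝒟)
    {Ω' : Type*} [MeasurableSpace Ω'] (μ' : Measure Ω')
    (Θ' : Set (EuclideanSpace ℝ (Fin d)))
    (Δ : Ω' → lp (fun _ : Θ' => EuclideanSpace ℝ (Fin L)) ∞) : Prop :=
  IsOpen Θ' ∧ M.Θ ⊆ Θ' ∧
  (∀ θ ∈ Θ', Integrable (fun D => M.g D θ (M.ξ₀ θ)) M.P) ∧
  @Measurable _ _ _ (borel _) Δ ∧
  IsGaussianProcess (fun (θ : Θ') ω => Δ ω θ) μ' ∧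
  (∀ θ : Θ', ∫ ω, Δ ω θ ∂μ' = 0) ∧
  (∀ (θ : Θ') (l : Fin L), 0 < variance (fun ω => Δ ω θ l) μ') ∧
  (∀ᵐ ω ∂μ', Continuous fun θ : Θ' => Δ ω θ) ∧
  ∃ G : ℕ → Ω → lp (fun _ : Θ' => EuclideanSpace ℝ (Fin L)) ∞,
    (∀ N ≥ 1, ∀ᵐ ω ∂μ, ∀ θ : Θ', G N ω θ =
      (Real.sqrt N)⁻¹ • ∑ i : Fin N, (M.g (X i ω) θ (M.ξ₀ θ) - M.mean θ (M.ξ₀ θ))) ∧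
    ∀ h : BoundedContinuousFunction (lp (fun _ : Θ' => EuclideanSpace ℝ (Fin L)) ∞) ℝ,
      Tendsto (fun N => outerExpectation μ fun ω => h (G N ω)) atTop (𝓝 (∫ ω, h (Δ ω) ∂μ'))

end Basic

section Orthogonal

variable {𝒟 V : Type*} [MeasurableSpace 𝒟] [SeminormedAddCommGroup V] [NormedSpace ℝ V] {d L : ℕ}
  (M : Model 𝒟 V d L)

/-- `r ↦ 𝔼 g(D, θ, r (ξ(θ) - ξ₀(θ)) + ξ₀(θ))`. -/
def pathMean (θ : EuclideanSpace ℝ (Fin d)) (ξ : EuclideanSpace ℝ (Fin d) → V) (r : ℝ) :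
    EuclideanSpace ℝ (Fin L) :=
  M.mean θ (r • (ξ θ - M.ξ₀ θ) + M.ξ₀ θ)

/-- Orthogonality condition, with `ξhat N k ω` the first-stage estimate for fold `k` at sample
size `N`. -/
structure Orthogonality {Ω : Type*} [MeasurableSpace Ω] (μ : Measure Ω) {K : ℕ}
    (ξhat : (N : ℕ) → Fin K → Ω → EuclideanSpace ℝ (Fin d) → V) : Prop where
  convex : Convex ℝ M.Ξ
  subset : ∀ N, M.ΞN N ⊆ M.Ξ
  true_mem : ∀ N, M.ξ₀ ∈ M.ΞN N
  estimate_mem : ∃ φ : ℕ → ℝ, Tendsto φ atTop (𝓝 0) ∧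
    ∀ N k, μ {ω | ξhat N k ω ∉ M.ΞN N} ≤ ENNReal.ofReal (φ N)
  rate : ∃ gN : ℕ → ℝ, gN =o[atTop] (fun N : ℕ => (N : ℝ) ^ (-(1 / 4) : ℝ)) ∧
    ∀ N, ∀ ξ ∈ M.ΞN N, ∀ θ ∈ M.Θ, ‖ξ θ - M.ξ₀ θ‖ ≤ gN N
  integrable : ∀ N, ∀ ξ ∈ M.ΞN N, ∀ θ ∈ M.Θ, ∀ r ∈ Set.Icc (0 : ℝ) 1,
    Integrable (fun D => M.g D θ (r • (ξ θ - M.ξ₀ θ) + M.ξ₀ θ)) M.P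
  continuous : ∀ N, ∀ ξ ∈ M.ΞN N, ∀ θ ∈ M.Θ, ContinuousOn (M.pathMean θ ξ) (Set.Icc 0 1)
  neyman : ∀ N, ∀ ξ ∈ M.ΞN N, ∀ θ ∈ M.Θ,
    DifferentiableOn ℝ (M.pathMean θ ξ) (Set.Ico 0 1) ∧
    derivWithin (M.pathMean θ ξ) (Set.Ico 0 1) 0 = 0
  second_order : ∃ s : ℕ → ℝ, s =o[atTop] (fun N : ℕ => (N : ℝ) ^ (-(1 / 2) : ℝ)) ∧
    ∀ N, ∀ ξ ∈ M.ΞN N, ∀ θ ∈ M.Θ,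
      DifferentiableOn ℝ (derivWithin (M.pathMean θ ξ) (Set.Ico 0 1)) (Set.Ico 0 1) ∧
      ∀ r ∈ Set.Ico (0 : ℝ) 1,
        ‖derivWithin (derivWithin (M.pathMean θ ξ) (Set.Ico 0 1)) (Set.Ico 0 1) r‖ ≤ s N

end Orthogonal

end Model

/-! ### Cross-fitting -/

section CrossFitting

variable {𝒟 V : Type*} [MeasurableSpace 𝒟] {d : ℕ}

/-- The indices outside fold `k`, for the partition that puts `i` into fold `J i`. -/
def outOfFold {N K : ℕ} (J : Fin N → Fin K) (k : Fin K) : Finset (Fin N) :=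
  Finset.univ.filter fun i => J i ≠ k

/-- The estimate for fold `k`: the estimator `est` applied to the data outside fold `k` only. -/
def foldEstimate
    (est : (N : ℕ) → (S : Finset (Fin N)) → (S → 𝒟) → EuclideanSpace ℝ (Fin d) → V)
    {N K : ℕ} (J : Fin N → Fin K) (x : Fin N → 𝒟) (k : Fin K) : EuclideanSpace ℝ (Fin d) → V :=
  est N (outOfFold J k) (fun i => x i)

/-- A random partition of `{1, …, N}` into `K ≥ 2` folds of equal size (up to rounding), for every
sample size `N`, drawn independently of the observations. -/
structure RandomFolds {Ω : Type*} [MeasurableSpace Ω] (μ : Measure Ω) (X : ℕ → Ω → 𝒟) {K : ℕ}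
    (J : (N : ℕ) → Ω → Fin N → Fin K) : Prop where
  two_le : 2 ≤ K
  measurable : ∀ N, Measurable (J N)
  indep : ∀ N, IndepFun (J N) (fun ω (i : Fin N) => X i ω) μ
  le_card : ∀ N ω k, N / K ≤ (Finset.univ.filter fun i => J N ω i = k).card
  card_le : ∀ N ω k, (Finset.univ.filter fun i => J N ω i = k).card ≤ (N + K - 1) / K

/-- The estimator is suitably measurable: the estimated moment functions are jointly measurable in
the auxiliary data and the observation, and the estimated classes have a common countable
separating index set. -/
structure MeasurableEstimator {L : ℕ} (M : Model 𝒟 V d L)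
    (est : (N : ℕ) → (S : Finset (Fin N)) → (S → 𝒟) → EuclideanSpace ℝ (Fin d) → V) : Prop where
  measurable : ∀ N (S : Finset (Fin N)), ∀ θ ∈ M.Θ,
    Measurable fun p : (S → 𝒟) × 𝒟 => M.g p.2 θ (est N S p.1 θ)
  separable : ∀ N, ∃ T : Set (EuclideanSpace ℝ (Fin d)), T.Countable ∧ T ⊆ M.Θ ∧
    ∀ (S : Finset (Fin N)) (x : S → 𝒟), est N S x ∈ M.ΞN N → M.PointwiseSeparable T (est N S x)

end CrossFitting

end MomentInequality

end

/-! Both conclusions follow from one expansion. With probability close to one, and uniformly over θ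
∈ Θ, the sample moment differs from 𝔼 g(D, θ, ξ₀) by at most (W + 1)/√N, where W is the supremum
over Θ of the empirical process at ξ₀ (`norm_sampleMoment_sub_mean_le`). The error has three
sources.

The empirical process at ξ₀ is O_P(1), because it converges weakly to a Borel random element of ℓ^∞
(`exists_measure_empiricalDeviation_le`). The bias 𝔼 g(D, θ, ξ) - 𝔼 g(D, θ, ξ₀) is o(N^{-1/2}): the
first derivative along the path vanishes at ξ₀ and the second is o(N^{-1/2}) (`exists_bias_le`). The
centred difference of the moment sums at ξ and at ξ₀ is o_P(√N), since the differences g(·, θ, ξ) -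
g(·, θ, ξ₀) have vanishing L² norm and polynomial uniform entropy.

The last point rests on the maximal inequality `exists_lintegral_iSup_le`: symmetrize, then chain
the Rademacher process over dyadic nets (`RadBound.of_polyCover`). Chaining sees the empirical L²
diameter, which a uniform law of large numbers for the squares compares with the L²(P) diameter
(`exists_lintegral_iSup_sq_le`). The thresholds depend on a class only through the bounds on its
envelope and entropy, so they are uniform over the nuisance realization sets. This uniformity also
handles cross-fitting: given the partition and the training sample, the estimated class is a fixed
class evaluated on an independent test sample (`measure_foldBadSet_le`).

The rest is deterministic. On the ε-contraction of Θ_I with ε of order N^{-1/2} the population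
moments are at most -Cε, which outweighs the sampling error. There the criterion is zero, and the
contraction is O(ε)-close to Θ_I; this is the degeneracy. Since ĉ ≥ 0, the contraction also lies in
the contour set, so Θ_I is close to the contour set. Conversely, on the contour set the positive
part of the sample moment is at most √(ĉ/N), so that of the population moment is O(N^{-1/2}), and
partial identification bounds the distance to Θ_I. -/

namespace MomentInequality

/-! ### Rademacher averages -/

section Rademacher

variable {I : Type*} [Fintype I]

/-- The sign `±1` encoded by a Boolean. -/
def radSign (b : Bool) : ℝ := if b then 1 else -1

/-- The Rademacher sum `∑ⱼ εⱼ uⱼ`. -/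
def radSum (ε : I → Bool) (u : I → ℝ) : ℝ := ∑ j, radSign (ε j) * u j

lemma radSum_add (ε : I → Bool) (u w : I → ℝ) :
    radSum ε (fun j => u j + w j) = radSum ε u + radSum ε w := by
  simp [radSum, mul_add, Finset.sum_add_distrib]

lemma radSum_sub (ε : I → Bool) (u w : I → ℝ) :
    radSum ε (fun j => u j - w j) = radSum ε u - radSum ε w := by
  simp [radSum, mul_sub, Finset.sum_sub_distrib]

lemma abs_radSign (b : Bool) : |radSign b| = 1 := by
  cases b <;> simp [radSign]

lemma abs_radSum_le (ε : I → Bool) (u : I → ℝ) : |radSum ε u| ≤ ∑ j, |u j| := by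
  refine (Finset.abs_sum_le_sum_abs _ _).trans (le_of_eq ?_)
  simp [abs_mul, abs_radSign]

lemma sum_abs_le_sqrt_card_mul {u : I → ℝ} {s : ℝ} (hs : 0 ≤ s) (h : ∑ j, u j ^ 2 ≤ s ^ 2) :
    ∑ j, |u j| ≤ √(Fintype.card I) * s := by
  refine abs_le_of_sq_le_sq' ?_ (by positivity) |>.2
  have := sq_sum_le_card_mul_sum_sq (s := Finset.univ) (f := fun j => |u j|)
  simp only [sq_abs, Finset.card_univ] at this
  rw [mul_pow, Real.sq_sqrt (by positivity)]
  exact this.trans (by gcongr)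

lemma sum_add_sq_le {u w : I → ℝ} {s t : ℝ} (hs : 0 ≤ s) (ht : 0 ≤ t)
    (hu : ∑ j, u j ^ 2 ≤ s ^ 2) (hw : ∑ j, w j ^ 2 ≤ t ^ 2) :
    ∑ j, (u j + w j) ^ 2 ≤ (s + t) ^ 2 := by
  have h1 : (∑ j, u j * w j) ^ 2 ≤ (s * t) ^ 2 := by
    refine (Finset.sum_mul_sq_le_sq_mul_sq _ _ _).trans ?_
    rw [mul_pow]
    gcongr
  have h2 := abs_le_of_sq_le_sq' h1 (by positivity) |>.2
  have : ∑ j, (u j + w j) ^ 2 = ∑ j, u j ^ 2 + 2 * ∑ j, u j * w j + ∑ j, w j ^ 2 := by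
    rw [Finset.mul_sum, ← Finset.sum_add_distrib, ← Finset.sum_add_distrib]
    exact Finset.sum_congr rfl fun j _ => by ring
  rw [this]; nlinarith

variable [DecidableEq I]

/-- The mean of a function over all sign vectors. -/
noncomputable def signMean (φ : (I → Bool) → ℝ) : ℝ :=
  ((2 : ℝ) ^ Fintype.card I)⁻¹ * ∑ ε, φ ε

lemma signMean_add (φ ψ : (I → Bool) → ℝ) :
    signMean (fun ε => φ ε + ψ ε) = signMean φ + signMean ψ := by
  simp [signMean, Finset.sum_add_distrib, mul_add]

lemma signMean_const_mul (c : ℝ) (φ : (I → Bool) → ℝ) :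
    signMean (fun ε => c * φ ε) = c * signMean φ := by
  simp only [signMean, ← Finset.mul_sum]; ring

lemma sum_signs_one : ∑ _ε : I → Bool, (1 : ℝ) = 2 ^ Fintype.card I := by
  simp

lemma signMean_const (c : ℝ) : signMean (fun _ : I → Bool => c) = c := by
  have h : signMean (fun _ : I → Bool => c) = c * signMean (fun _ : I → Bool => (1 : ℝ)) := by
    rw [← signMean_const_mul]; simp
  rw [h, signMean, sum_signs_one, inv_mul_cancel₀ (by positivity), mul_one]

/-- Independence of the signs factors the sum into hyperbolic cosines, and cosh t ≤ exp(t²/2):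
Rademacher sums are sub-Gaussian. -/
lemma sum_exp_radSum_le (u : I → ℝ) :
    ∑ ε, Real.exp (radSum ε u) ≤ 2 ^ Fintype.card I * Real.exp ((∑ j, u j ^ 2) / 2) := by
  classical
  have h1 : ∑ ε, Real.exp (radSum ε u) = ∏ j, (2 * Real.cosh (u j)) := by
    have : ∀ j, 2 * Real.cosh (u j) = ∑ b : Bool, Real.exp (radSign b * u j) := by
      intro j
      simp [radSign, Real.cosh_eq]; ring
    simp_rw [this]
    rw [Finset.prod_univ_sum, Fintype.piFinset_univ]
    simp only [radSum, Real.exp_sum]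
  rw [h1, Finset.prod_mul_distrib, Finset.prod_const, Finset.card_univ, Finset.sum_div,
    Real.exp_sum]
  gcongr with j
  exact Real.cosh_le_exp_half_sq _

/-- The Rademacher process indexed by the vectors `u i` is dominated by a random variable of
mean at most `b`. -/
def RadBound {ι : Type*} (u : ι → I → ℝ) (b : ℝ) : Prop :=
  ∃ M : (I → Bool) → ℝ, (∀ i ε, |radSum ε (u i)| ≤ M ε) ∧ signMean M ≤ b

lemma RadBound.mono {ι : Type*} {u : ι → I → ℝ} {b b' : ℝ} (h : RadBound u b) (hb : b ≤ b') :
    RadBound u b' := by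
  obtain ⟨M, h1, h2⟩ := h
  exact ⟨M, h1, h2.trans hb⟩

lemma RadBound.add {ι : Type*} {u w : ι → I → ℝ} {b c : ℝ} (hu : RadBound u b)
    (hw : RadBound w c) : RadBound (fun i j => u i j + w i j) (b + c) := by
  obtain ⟨M, h1, h2⟩ := hu
  obtain ⟨M', h1', h2'⟩ := hw
  refine ⟨fun ε => M ε + M' ε, fun i ε => ?_, ?_⟩
  · rw [radSum_add]
    exact (abs_add_le _ _).trans (add_le_add (h1 i ε) (h1' i ε))
  · rw [signMean_add]; exact add_le_add h2 h2'

lemma RadBound.of_sum_abs {ι : Type*} {u : ι → I → ℝ} {b : ℝ} (h : ∀ i, ∑ j, |u i j| ≤ b) :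
    RadBound u b :=
  ⟨fun _ => b, fun i ε => (abs_radSum_le ε _).trans (h i), (signMean_const b).le⟩

/-- Jensen's inequality for the concave logarithm and the uniform law on the signs. -/
lemma log_signMean_le {φ : (I → Bool) → ℝ} (hφ : ∀ ε, 0 < φ ε) :
    signMean (fun ε => Real.log (φ ε)) ≤ Real.log (signMean φ) := by
  have := strictConcaveOn_log_Ioi.concaveOn.le_map_sum (t := Finset.univ)
    (w := fun _ : I → Bool => ((2 : ℝ) ^ Fintype.card I)⁻¹) (p := φ)
    (fun _ _ => by positivity)
    (by rw [← mul_one (2 ^ Fintype.card I)⁻¹, ← Finset.mul_sum, sum_signs_one]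
        simp)
    (fun ε _ => hφ ε)
  simpa [signMean, ← Finset.mul_sum, smul_eq_mul] using this

/-- Maximal inequality for finitely many Rademacher sums. -/
lemma RadBound.of_finset {ι : Type*} [Nonempty ι] {u : ι → I → ℝ} (T : Finset (I → ℝ))
    (hT : ∀ i, u i ∈ T)
    {s : ℝ} (hs : 0 < s) (h : ∀ w ∈ T, ∑ j, w j ^ 2 ≤ s ^ 2) :
    RadBound u (s * (Real.log T.card + 2)) := by
  -- After rescaling by s, the exponential of every |radSum| is below φ, so s log φ dominates the
  -- process. Its mean is at most s log(2e |T|), and log 2 + 1 ≤ 2. Linear dependence on log |T|,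
  -- instead of a square root, is good enough: the chaining series ∑ k 2⁻ᵏ still converges.
  set φ : (I → Bool) → ℝ := fun ε =>
    ∑ w ∈ T, (Real.exp (radSum ε (fun j => w j / s)) + Real.exp (radSum ε (fun j => -(w j / s))))
    with hφ
  have hTne : T.Nonempty := ⟨_, hT (Classical.arbitrary ι)⟩
  have hpos : ∀ ε, 0 < φ ε := fun ε => Finset.sum_pos (fun w _ => by positivity) hTne
  refine ⟨fun ε => s * Real.log (φ ε), fun i ε => ?_, ?_⟩
  · have h1 : |radSum ε (u i)| = s * |radSum ε (fun j => u i j / s)| := by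
      have : radSum ε (u i) = s * radSum ε (fun j => u i j / s) := by
        simp only [radSum, Finset.mul_sum]
        refine Finset.sum_congr rfl fun j _ => ?_
        field_simp
      rw [this, abs_mul, abs_of_pos hs]
    rw [h1]
    refine mul_le_mul_of_nonneg_left ?_ hs.le
    rw [Real.le_log_iff_exp_le (hpos ε)]
    have h2 : radSum ε (fun j => -(u i j / s)) = -radSum ε (fun j => u i j / s) := by
      simp [radSum, Finset.sum_neg_distrib]
    have h3 : Real.exp (radSum ε (fun j => u i j / s))
        + Real.exp (radSum ε (fun j => -(u i j / s))) ≤ φ ε := by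
      rw [hφ]
      exact Finset.single_le_sum (f := fun w : I → ℝ => Real.exp (radSum ε (fun j => w j / s))
        + Real.exp (radSum ε (fun j => -(w j / s)))) (fun w _ => by positivity) (hT i)
    refine le_trans ?_ h3
    rw [h2]
    rcases abs_cases (radSum ε (fun j => u i j / s)) with h | h <;> rw [h.1]
    · linarith [Real.exp_pos (-radSum ε (fun j => u i j / s))]
    · linarith [Real.exp_pos (radSum ε (fun j => u i j / s))]
  · rw [signMean_const_mul]
    gcongr
    refine (log_signMean_le hpos).trans ?_
    have h4 : signMean φ ≤ T.card * Real.exp 1 * 2 := by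
      have h5 : ∀ w ∈ T, ∀ w' : I → ℝ, (∀ j, w' j ^ 2 = w j ^ 2) →
          ∑ ε, Real.exp (radSum ε (fun j => w' j / s)) ≤
            2 ^ Fintype.card I * Real.exp 1 := by
        intro w hw w' hw'
        refine (sum_exp_radSum_le _).trans ?_
        gcongr
        have : ∑ j, (w' j / s) ^ 2 ≤ 1 := by
          simp_rw [div_pow, hw', ← Finset.sum_div]
          rw [div_le_one (by positivity)]
          exact h w hw
        linarith
      have h6 : ∑ ε, φ ε ≤ ∑ _w ∈ T, (2 ^ Fintype.card I * Real.exp 1 * 2) := by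
        rw [hφ, Finset.sum_comm]
        refine Finset.sum_le_sum fun w hw => ?_
        rw [Finset.sum_add_distrib]
        have := h5 w hw w (fun _ => rfl)
        have h7 := h5 w hw (fun j => - w j) (fun _ => by ring)
        simp only [neg_div] at h7
        linarith
      rw [signMean, inv_mul_le_iff₀ (by positivity)]
      refine h6.trans (le_of_eq ?_)
      simp; ring
    have hc : (0 : ℝ) < T.card := by exact_mod_cast hTne.card_pos
    have h0 : 0 < signMean φ := by
      unfold signMean
      exact mul_pos (by positivity) (Finset.sum_pos (fun ε _ => hpos ε) ⟨fun _ => true, by simp⟩)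
    refine (Real.log_le_log h0 h4).trans ?_
    rw [Real.log_mul (by positivity) (by norm_num), Real.log_mul (by positivity) (by positivity),
      Real.log_exp]
    linarith [Real.log_two_lt_d9]

/-- Polynomial covering numbers of a set of vectors with respect to the normalized Euclidean
distance, relative to the scale `B`. -/
def PolyCover {ι : Type*} (u : ι → I → ℝ) (B a v : ℝ) : Prop :=
  ∀ ε : ℝ, 0 < ε → ε ≤ 1 → ∃ T : Finset (I → ℝ), Real.log T.card ≤ v * Real.log (a / ε) ∧
    ∀ i, ∃ w ∈ T, ∑ j, (u i j - w j) ^ 2 ≤ (ε * √(Fintype.card I) * B) ^ 2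

/-- Bound for the Rademacher process of the squares at a single scale. -/
lemma RadBound.sq_of_polyCover {ι : Type*} [Nonempty ι] [Nonempty I] {u : ι → I → ℝ}
    {B a v m ρ : ℝ} (hB : 0 ≤ B) (hu : PolyCover u B a v) (hm : 0 < m)
    (hum : ∀ i j, |u i j| ≤ m) (hρ : 0 < ρ) (hρ1 : ρ ≤ 1) :
    RadBound (fun i j => u i j ^ 2) (m ^ 2 * √(Fintype.card I) * (v * Real.log (a / ρ) + 2)
      + Fintype.card I * (2 * m * ρ * B)) := by
  classical
  obtain ⟨T, hTc, hT⟩ := hu ρ hρ hρ1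
  choose w hwT hw using hT
  -- Clipping the net to [-m, m] does not move it away from the vectors `u i`, and on this interval
  -- squaring is Lipschitz with constant 2m.
  let cl : ℝ → ℝ := fun t => max (-m) (min t m)
  have hcl : ∀ t, |cl t| ≤ m := fun t => by
    rw [abs_le]; exact ⟨le_max_left _ _, max_le (by linarith) (min_le_right _ _)⟩
  have hcl2 : ∀ s t, |s| ≤ m → |s - cl t| ≤ |s - t| := by
    intro s t hs
    rw [abs_le] at hs
    simp only [cl]
    rcases le_total t m with h | h
    · rw [min_eq_left h]
      rcases le_total (-m) t with h' | h'
      · rw [max_eq_right h']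
      · rw [max_eq_left h', abs_of_nonneg (by linarith), abs_of_nonneg (by linarith)]; linarith
    · rw [min_eq_right h, max_eq_right (by linarith), abs_of_nonpos (by linarith),
        abs_of_nonpos (by linarith)]
      linarith
  have hn : 0 < √(Fintype.card I : ℝ) := Real.sqrt_pos.2 (by exact_mod_cast Fintype.card_pos)
  have hnn : √(Fintype.card I : ℝ) * √(Fintype.card I) = Fintype.card I :=
    Real.mul_self_sqrt (by positivity)
  have h1 : RadBound (fun i j => cl (w i j) ^ 2)
      (m ^ 2 * √(Fintype.card I) * (v * Real.log (a / ρ) + 2)) := by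
    have := RadBound.of_finset (u := fun i j => cl (w i j) ^ 2)
      (T.image fun w j => cl (w j) ^ 2)
      (fun i => Finset.mem_image.2 ⟨w i, hwT i, rfl⟩) (s := m ^ 2 * √(Fintype.card I))
      (by positivity) ?_
    · refine this.mono ?_
      gcongr
      refine le_trans ?_ hTc
      refine Real.log_le_log ?_ (by exact_mod_cast Finset.card_image_le)
      exact_mod_cast Finset.Nonempty.card_pos
        ⟨_, Finset.mem_image.2 ⟨w (Classical.arbitrary ι), hwT _, rfl⟩⟩
    · intro z hz
      obtain ⟨w, -, rfl⟩ := Finset.mem_image.1 hz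
      have : ∀ j, (cl (w j) ^ 2) ^ 2 ≤ (m ^ 2) ^ 2 := by
        intro j
        have := sq_le_sq' (by linarith [abs_nonneg (cl (w j)), hcl (w j)]) (hcl (w j))
        rw [sq_abs] at this
        gcongr
      refine (Finset.sum_le_sum fun j _ => this j).trans (le_of_eq ?_)
      rw [mul_pow, Real.sq_sqrt (by positivity)]
      simp; ring
  have h2 : RadBound (fun i j => u i j ^ 2 - cl (w i j) ^ 2)
      (Fintype.card I * (2 * m * ρ * B)) := by
    refine RadBound.of_sum_abs fun i => ?_
    have h3 : ∀ j, |u i j ^ 2 - cl (w i j) ^ 2| ≤ 2 * m * |u i j - w i j| := by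
      intro j
      rw [sq_sub_sq, abs_mul]
      have := hcl2 _ (w i j) (hum i j)
      have h4 : |u i j + cl (w i j)| ≤ 2 * m :=
        (abs_add_le _ _).trans (by linarith [hum i j, hcl (w i j)])
      gcongr
    refine (Finset.sum_le_sum fun j _ => h3 j).trans ?_
    rw [← Finset.mul_sum]
    have h5 := sum_abs_le_sqrt_card_mul (u := fun j => u i j - w i j)
      (s := ρ * √(Fintype.card I) * B) (by positivity) (hw i)
    calc 2 * m * ∑ j, |u i j - w i j|
        ≤ 2 * m * (√(Fintype.card I) * (ρ * √(Fintype.card I) * B)) := by gcongr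
      _ = (√(Fintype.card I) * √(Fintype.card I)) * (2 * m * ρ * B) := by ring
      _ = _ := by rw [hnn]
  simpa using h1.add h2

/-- The entropy factor at level `k`. -/
noncomputable def entropyFactor (a v : ℝ) (k : ℕ) : ℝ := v * (Real.log a + k) + 2

/-- A telescoping bound for the tail of the entropy series. -/
noncomputable def entropyTail (a v : ℝ) (k : ℕ) : ℝ :=
  2⁻¹ ^ k * (8 * v * k + (8 * v * (Real.log a + 1) + 8) + 8 * v)

lemma log_div_half_pow_le {a : ℝ} (ha : 0 < a) (k : ℕ) :
    Real.log (a / 2⁻¹ ^ k) ≤ Real.log a + k := by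
  rw [Real.log_div ha.ne' (by positivity), Real.log_pow, Real.log_inv]
  have : (k : ℝ) * Real.log 2 ≤ k * 1 := by
    gcongr; linarith [Real.log_two_lt_d9]
  linarith

/-- Chaining bound for the Rademacher process under polynomial covering numbers. -/
lemma RadBound.of_polyCover {ι : Type*} [Nonempty ι] [Nonempty I] {u : ι → I → ℝ}
    {B a v D : ℝ} (hB : 0 < B) (ha : 0 < a) (hv : 0 ≤ v) (hu : PolyCover u B a v) (hD : 0 ≤ D)
    (huD : ∀ i, ∑ j, u i j ^ 2 ≤ (√(Fintype.card I) * D) ^ 2) (k : ℕ) :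
    RadBound u (√(Fintype.card I) * (D * entropyFactor a v k +
      B * (2⁻¹ ^ k * entropyFactor a v k + entropyTail a v k + 2⁻¹ ^ k))) := by
  classical
  set n : ℝ := √(Fintype.card I) with hn_def
  have hn : 0 < n := Real.sqrt_pos.2 (by exact_mod_cast Fintype.card_pos)
  choose T hTc hT using fun k : ℕ => hu (2⁻¹ ^ k) (by positivity)
    (pow_le_one₀ (by norm_num) (by norm_num))
  choose w hwT hw using hT
  have hTc' : ∀ k, Real.log (T k).card ≤ v * (Real.log a + k) := fun k =>
    (hTc k).trans (by gcongr; exact log_div_half_pow_le ha k)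
  have hTpos : ∀ k, (0 : ℝ) < (T k).card := fun k => by
    exact_mod_cast Finset.Nonempty.card_pos ⟨_, hwT k (Classical.arbitrary ι)⟩
  have hneg : ∀ (x y : I → ℝ), ∑ j, (x j - y j) ^ 2 = ∑ j, (y j - x j) ^ 2 := fun x y =>
    Finset.sum_congr rfl fun j _ => by ring
  -- the first level
  have hfirst : RadBound (w k) (n * (D + 2⁻¹ ^ k * B) * entropyFactor a v k) := by
    have hm : ∀ i, ∑ j, w k i j ^ 2 ≤ (n * (D + 2⁻¹ ^ k * B)) ^ 2 := by
      intro i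
      have h1 := hw k i
      rw [hneg] at h1
      have := sum_add_sq_le (by positivity) (by positivity) h1 (huD i)
      simp only [sub_add_cancel] at this
      refine this.trans (le_of_eq ?_)
      ring
    -- The net may contain unused points of large norm; filtering leaves only points for which the
    -- required norm bound holds.
    have := RadBound.of_finset (u := w k)
      ((T k).filter fun z => ∑ j, z j ^ 2 ≤ (n * (D + 2⁻¹ ^ k * B)) ^ 2)
      (fun i => Finset.mem_filter.2 ⟨hwT k i, hm i⟩) (s := n * (D + 2⁻¹ ^ k * B))
      (by positivity) (fun z hz => (Finset.mem_filter.1 hz).2)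
    refine this.mono ?_
    unfold entropyFactor
    gcongr
    refine le_trans ?_ (hTc' k)
    refine Real.log_le_log ?_ (by exact_mod_cast Finset.card_filter_le _ _)
    exact_mod_cast Finset.Nonempty.card_pos
      ⟨_, Finset.mem_filter.2 ⟨hwT k (Classical.arbitrary ι), hm _⟩⟩
  -- one link of the chain
  have hlink : ∀ l : ℕ, RadBound (fun i j => w (l + 1) i j - w l i j)
      (n * B * (entropyTail a v l - entropyTail a v (l + 1))) := by
    intro l
    -- Two consecutive approximations of the same vector differ by at most 2⁻¹ ^ (l + 1) + 2⁻¹ ^ l ≤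
    -- 2 * 2⁻¹ ^ l in units of n * B.
    set s : ℝ := n * (2 * 2⁻¹ ^ l * B) with hs
    have hm : ∀ i, ∑ j, (w (l + 1) i j - w l i j) ^ 2 ≤ s ^ 2 := by
      intro i
      have h1 := hw (l + 1) i
      rw [hneg] at h1
      have := sum_add_sq_le (by positivity) (by positivity) h1 (hw l i)
      simp only [sub_add_sub_cancel] at this
      refine this.trans ?_
      gcongr
      rw [hs, pow_succ]
      have : 0 ≤ n * B * 2⁻¹ ^ l := by positivity
      linarith
    have := RadBound.of_finset (u := fun i j => w (l + 1) i j - w l i j)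
      (((T (l + 1) ×ˢ T l).image fun z j => z.1 j - z.2 j).filter fun z => ∑ j, z j ^ 2 ≤ s ^ 2)
      (fun i => Finset.mem_filter.2 ⟨Finset.mem_image.2 ⟨(w (l + 1) i, w l i),
        Finset.mem_product.2 ⟨hwT _ i, hwT _ i⟩, rfl⟩, hm i⟩) (s := s)
      (by positivity) (fun z hz => (Finset.mem_filter.1 hz).2)
    refine this.mono ?_
    have hcard : Real.log ((((T (l + 1) ×ˢ T l).image fun z j => z.1 j - z.2 j).filter
        fun z => ∑ j, z j ^ 2 ≤ s ^ 2).card : ℝ) ≤ 2 * v * (Real.log a + l + 1) := by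
      have h2 : Real.log ((T (l + 1)).card * (T l).card : ℝ) ≤ 2 * v * (Real.log a + l + 1) := by
        rw [Real.log_mul (hTpos _).ne' (hTpos _).ne']
        have h3 := hTc' (l + 1)
        have h4 := hTc' l
        push_cast at h3
        nlinarith
      refine le_trans (Real.log_le_log ?_ ?_) h2
      · exact_mod_cast Finset.Nonempty.card_pos
          ⟨_, Finset.mem_filter.2 ⟨Finset.mem_image.2
            ⟨(w (l + 1) (Classical.arbitrary ι), w l (Classical.arbitrary ι)),
            Finset.mem_product.2 ⟨hwT _ _, hwT _ _⟩, rfl⟩, hm _⟩⟩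
      · rw [← Nat.cast_mul, ← Finset.card_product]
        exact_mod_cast (Finset.card_filter_le _ _).trans Finset.card_image_le
    -- `entropyTail` is built so that its decrement is exactly the cost of one link; the sum along
    -- the chain then telescopes.
    have h5 : entropyTail a v l - entropyTail a v (l + 1)
        = 2 * 2⁻¹ ^ l * (2 * v * (Real.log a + l + 1) + 2) := by
      unfold entropyTail
      rw [pow_succ]; push_cast; ring
    rw [h5]
    calc s * (_ + 2) ≤ s * (2 * v * (Real.log a + l + 1) + 2) := by gcongr
      _ = _ := by rw [hs]; ring
  have hchain : ∀ m : ℕ, RadBound (w (k + m)) (n * (D + 2⁻¹ ^ k * B) * entropyFactor a v k +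
      n * B * (entropyTail a v k - entropyTail a v (k + m))) := by
    intro m
    induction m with
    | zero => simpa using hfirst
    | succ m ih =>
      have := ih.add (hlink (k + m))
      simp only [add_sub_cancel] at this
      refine this.mono (le_of_eq ?_)
      rw [add_assoc k m 1]; ring
  -- No lower bound on log a is assumed: the nets are nonempty, so the logarithms of their
  -- cardinalities are nonnegative, and these are at most v (log a + m).
  have htail : ∀ m, 0 ≤ entropyTail a v m + 2⁻¹ ^ m * (0 : ℝ) := by
    intro m
    have : 0 ≤ v * (Real.log a + m) := by
      refine le_trans ?_ (hTc' m)
      exact Real.log_nonneg (by exact_mod_cast (Nat.cast_pos.1 (hTpos m)))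
    unfold entropyTail
    rw [mul_zero, add_zero]
    refine mul_nonneg (by positivity) ?_
    nlinarith
  -- The chain is stopped at a level depending on the sample size, where the trivial ℓ¹ bound on the
  -- residual suffices. The telescoped bound does not depend on this level.
  obtain ⟨m, hm⟩ : ∃ m : ℕ, n * 2⁻¹ ^ (k + m) ≤ (2⁻¹ : ℝ) ^ k := by
    obtain ⟨m, hm⟩ := exists_pow_lt_of_lt_one (show (0 : ℝ) < 1 / n by positivity)
      (show (2⁻¹ : ℝ) < 1 by norm_num)
    refine ⟨m, ?_⟩
    rw [pow_add]
    rw [lt_div_iff₀ hn] at hm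
    have : (0 : ℝ) < 2⁻¹ ^ k := by positivity
    nlinarith
  have hres : RadBound (fun i j => u i j - w (k + m) i j) (n * (B * 2⁻¹ ^ k)) := by
    refine RadBound.of_sum_abs fun i => ?_
    refine (sum_abs_le_sqrt_card_mul (by positivity) (hw (k + m) i)).trans ?_
    rw [← hn_def]
    have : 0 ≤ n * B := by positivity
    nlinarith
  have hfin := (hchain m).add hres
  simp only [add_sub_cancel] at hfin
  refine hfin.mono ?_
  have := htail (k + m)
  have h6 : 0 ≤ n * B * entropyTail a v (k + m) := mul_nonneg (by positivity) (by linarith)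
  nlinarith

lemma tendsto_half_pow_mul_linear (α β : ℝ) :
    Tendsto (fun k : ℕ => (2⁻¹ : ℝ) ^ k * (α * k + β)) atTop (𝓝 0) := by
  have h1 := tendsto_self_mul_const_pow_of_lt_one (r := (2⁻¹ : ℝ)) (by norm_num) (by norm_num)
  have h2 := tendsto_pow_atTop_nhds_zero_of_lt_one (r := (2⁻¹ : ℝ)) (by norm_num) (by norm_num)
  have := (h1.const_mul α).add (h2.const_mul β)
  simp only [mul_zero, add_zero] at this
  refine this.congr fun k => ?_
  ring

/-- The part of the chaining bound proportional to the envelope can be made arbitrarily small by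
starting the chain at a fine enough level k, independently of the sample size. -/
lemma tendsto_chaining_remainder (a v : ℝ) :
    Tendsto (fun k : ℕ => (2⁻¹ : ℝ) ^ k * entropyFactor a v k + entropyTail a v k + 2⁻¹ ^ k)
      atTop (𝓝 0) := by
  have h1 := tendsto_half_pow_mul_linear (9 * v)
    (v * Real.log a + 2 + (8 * v * (Real.log a + 1) + 8) + 8 * v + 1)
  refine h1.congr fun k => ?_
  unfold entropyFactor entropyTail
  ring

end Rademacher

/-! ### Symmetrization -/

section Symmetrization

variable {I : Type*} [Fintype I] {𝒟 : Type*} [MeasurableSpace 𝒟]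

/-- Exchanging an observation with its independent copy wherever the sign is negative preserves
the joint law of the sample and the ghost sample. -/
lemma lintegral_exchange (P : Measure 𝒟) [IsProbabilityMeasure P] (ε : I → Bool)
    {Φ : (I → 𝒟) × (I → 𝒟) → ℝ≥0∞} (hΦ : Measurable Φ) :
    ∫⁻ z, Φ z ∂((Measure.pi fun _ : I => P).prod (Measure.pi fun _ : I => P)) =
    ∫⁻ z, Φ (fun j => if ε j then z.1 j else z.2 j, fun j => if ε j then z.2 j else z.1 j)
      ∂((Measure.pi fun _ : I => P).prod (Measure.pi fun _ : I => P)) := by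
  have he := measurePreserving_arrowProdEquivProdArrow 𝒟 𝒟 I (fun _ => P) (fun _ => P)
  have hs : MeasurePreserving (fun (a : I → 𝒟 × 𝒟) j => (if ε j then id else Prod.swap) (a j))
      (Measure.pi fun _ : I => P.prod P) (Measure.pi fun _ : I => P.prod P) := by
    refine measurePreserving_pi _ _ (f := fun j => if ε j then id else Prod.swap) fun j => ?_
    cases ε j
    · simpa using Measure.measurePreserving_swap
    · simpa using MeasurePreserving.id _
  have hT : Measurable fun z : (I → 𝒟) × (I → 𝒟) =>
      ((fun j => if ε j then z.1 j else z.2 j, fun j => if ε j then z.2 j else z.1 j) :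
        (I → 𝒟) × (I → 𝒟)) := by
    refine Measurable.prodMk (measurable_pi_lambda _ fun j => ?_)
      (measurable_pi_lambda _ fun j => ?_) <;> cases ε j <;> simp <;> fun_prop
  set e := MeasurableEquiv.arrowProdEquivProdArrow 𝒟 𝒟 I with he_def
  calc _ = ∫⁻ a, Φ (e a) ∂(Measure.pi fun _ : I => P.prod P) := (he.lintegral_comp hΦ).symm
    _ = ∫⁻ a, Φ (e fun j => (if ε j then id else Prod.swap) (a j))
        ∂(Measure.pi fun _ : I => P.prod P) :=
      (hs.lintegral_comp (hΦ.comp he.measurable)).symm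
    _ = ∫⁻ a, Φ (fun j => if ε j then (e a).1 j else (e a).2 j,
        fun j => if ε j then (e a).2 j else (e a).1 j) ∂(Measure.pi fun _ : I => P.prod P) := by
      refine lintegral_congr fun a => ?_
      congr 1
      refine Prod.ext ?_ ?_ <;> funext j <;>
        simp only [he_def, MeasurableEquiv.arrowProdEquivProdArrow, MeasurableEquiv.coe_mk,
          Equiv.arrowProdEquivProdArrow, Equiv.coe_fn_mk] <;> cases ε j <;> simp
    _ = _ := he.lintegral_comp (hΦ.comp hT)

variable [DecidableEq I]

/-- Symmetrization inequality. -/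
lemma lintegral_iSup_le_radSum {ι : Type*} [Countable ι] (P : Measure 𝒟) [IsProbabilityMeasure P]
    {h : ι → 𝒟 → ℝ} (hm : ∀ i, Measurable (h i)) (hint : ∀ i, Integrable (h i) P) :
    ∫⁻ x, ⨆ i, ‖∑ j, (h i (x j) - ∫ D, h i D ∂P)‖ₑ ∂(Measure.pi fun _ : I => P) ≤
    2 * ∫⁻ x, (2 ^ Fintype.card I)⁻¹ * ∑ ε, ⨆ i, ‖radSum ε (fun j => h i (x j))‖ₑ
      ∂(Measure.pi fun _ : I => P) := by
  set π := Measure.pi fun _ : I => P with hπ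
  have hev : ∀ i j, Integrable (fun x : I → 𝒟 => h i (x j)) π := fun i j =>
    (measurePreserving_eval (fun _ : I => P) j).integrable_comp_of_integrable (hint i)
  have hevi : ∀ i j, ∫ x, h i (x j) ∂π = ∫ D, h i D ∂P := fun i j =>
    integral_comp_eval (μ := fun _ : I => P) (hint i).aestronglyMeasurable
  set Φ : (I → 𝒟) × (I → 𝒟) → ℝ≥0∞ := fun z => ⨆ i, ‖∑ j, (h i (z.1 j) - h i (z.2 j))‖ₑ with hΦ
  have hΦm : Measurable Φ := by
    refine Measurable.iSup fun i => ?_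
    have := hm i
    fun_prop
  have hS : ∀ ε : I → Bool, Measurable fun x : I → 𝒟 =>
      ⨆ i, ‖radSum ε (fun j => h i (x j))‖ₑ := by
    intro ε
    refine Measurable.iSup fun i => ?_
    have := hm i
    unfold radSum
    fun_prop
  -- the ghost sample
  have h1 : ∫⁻ x, ⨆ i, ‖∑ j, (h i (x j) - ∫ D, h i D ∂P)‖ₑ ∂π ≤ ∫⁻ z, Φ z ∂(π.prod π) := by
    rw [lintegral_prod _ hΦm.aemeasurable]
    refine lintegral_mono fun x => iSup_le fun i => ?_
    have : ∑ j, (h i (x j) - ∫ D, h i D ∂P) = ∫ y, ∑ j, (h i (x j) - h i (y j)) ∂π := by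
      have hj : ∀ j ∈ Finset.univ, Integrable (fun y : I → 𝒟 => h i (x j) - h i (y j)) π :=
        fun j _ => (integrable_const _).sub (hev i j)
      rw [integral_finsetSum _ hj]
      refine Finset.sum_congr rfl fun j _ => ?_
      rw [integral_sub (integrable_const _) (hev i j), hevi]
      simp
    rw [this]
    refine (enorm_integral_le_lintegral_enorm _).trans (lintegral_mono fun y => ?_)
    exact le_iSup (fun i => ‖∑ j, (h i (x j) - h i (y j))‖ₑ) i
  -- random signs
  have h2 : ∀ ε : I → Bool, ∫⁻ z, Φ z ∂(π.prod π) ≤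
      2 * ∫⁻ x, ⨆ i, ‖radSum ε (fun j => h i (x j))‖ₑ ∂π := by
    intro ε
    rw [hπ, lintegral_exchange P ε hΦm, ← hπ]
    have h3 : ∀ z : (I → 𝒟) × (I → 𝒟),
        Φ (fun j => if ε j then z.1 j else z.2 j, fun j => if ε j then z.2 j else z.1 j) ≤
        (⨆ i, ‖radSum ε (fun j => h i (z.1 j))‖ₑ) + ⨆ i, ‖radSum ε (fun j => h i (z.2 j))‖ₑ := by
      intro z
      refine iSup_le fun i => ?_
      have h4 : ∑ j, (h i (if ε j then z.1 j else z.2 j) - h i (if ε j then z.2 j else z.1 j)) =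
          radSum ε (fun j => h i (z.1 j)) - radSum ε (fun j => h i (z.2 j)) := by
        rw [← radSum_sub]
        refine Finset.sum_congr rfl fun j _ => ?_
        cases ε j <;> simp [radSign]
      simp only [h4]
      refine enorm_sub_le.trans (add_le_add ?_ ?_)
      · exact le_iSup (fun i => ‖radSum ε (fun j => h i (z.1 j))‖ₑ) i
      · exact le_iSup (fun i => ‖radSum ε (fun j => h i (z.2 j))‖ₑ) i
    refine (lintegral_mono h3).trans (le_of_eq ?_)
    have hf : Measurable fun z : (I → 𝒟) × (I → 𝒟) => ⨆ i, ‖radSum ε (fun j => h i (z.1 j))‖ₑ :=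
      (hS ε).comp measurable_fst
    have hg : Measurable fun z : (I → 𝒟) × (I → 𝒟) => ⨆ i, ‖radSum ε (fun j => h i (z.2 j))‖ₑ :=
      (hS ε).comp measurable_snd
    rw [lintegral_add_left hf, lintegral_prod _ hf.aemeasurable, lintegral_prod _ hg.aemeasurable]
    simp [two_mul]
  refine h1.trans ?_
  rw [lintegral_const_mul _ (Finset.measurable_sum _ fun ε _ => hS ε),
    lintegral_finsetSum _ fun ε _ => hS ε]
  -- The left side does not involve the signs, so it equals its own average over all sign vectors.
  calc ∫⁻ z, Φ z ∂(π.prod π)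
      = (2 ^ Fintype.card I)⁻¹ * ∑ _ε : I → Bool, ∫⁻ z, Φ z ∂(π.prod π) := by
        simp only [Finset.sum_const, Finset.card_univ, Fintype.card_fun, Fintype.card_bool,
          nsmul_eq_mul, Nat.cast_pow, Nat.cast_ofNat]
        rw [← mul_assoc, ENNReal.inv_mul_cancel (by simp) (by simp), one_mul]
    _ ≤ (2 ^ Fintype.card I)⁻¹ *
        ∑ ε : I → Bool, 2 * ∫⁻ x, ⨆ i, ‖radSum ε (fun j => h i (x j))‖ₑ ∂π := by
        gcongr with ε
        exact h2 ε
    _ = _ := by rw [← Finset.mul_sum, mul_left_comm]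

/-- Symmetrization inequality combined with a bound for the Rademacher process. -/
lemma lintegral_iSup_le_of_radBound {ι : Type*} [Countable ι] [Nonempty ι] (P : Measure 𝒟)
    [IsProbabilityMeasure P]
    {h : ι → 𝒟 → ℝ} (hm : ∀ i, Measurable (h i)) (hint : ∀ i, Integrable (h i) P)
    {b : (I → 𝒟) → ℝ}
    (hb : ∀ᵐ x ∂(Measure.pi fun _ : I => P), RadBound (fun i j => h i (x j)) (b x)) :
    ∫⁻ x, ⨆ i, ‖∑ j, (h i (x j) - ∫ D, h i D ∂P)‖ₑ ∂(Measure.pi fun _ : I => P) ≤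
    2 * ∫⁻ x, ENNReal.ofReal (b x) ∂(Measure.pi fun _ : I => P) := by
  refine (lintegral_iSup_le_radSum P hm hint).trans ?_
  gcongr 2 * ?_
  refine lintegral_mono_ae ?_
  filter_upwards [hb] with x ⟨M, h1, h2⟩
  have h0 : ∀ ε, 0 ≤ M ε := fun ε => (abs_nonneg _).trans (h1 (Classical.arbitrary ι) ε)
  calc (2 ^ Fintype.card I)⁻¹ * ∑ ε, ⨆ i, ‖radSum ε (fun j => h i (x j))‖ₑ
      ≤ (2 ^ Fintype.card I)⁻¹ * ∑ ε, ENNReal.ofReal (M ε) := by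
        gcongr with ε
        refine iSup_le fun i => ?_
        rw [← ofReal_norm, Real.norm_eq_abs]
        exact ENNReal.ofReal_le_ofReal (h1 i ε)
    _ = ENNReal.ofReal (signMean M) := by
        unfold signMean
        rw [ENNReal.ofReal_mul (by positivity), ENNReal.ofReal_sum_of_nonneg fun ε _ => h0 ε,
          ENNReal.ofReal_inv_of_pos (by positivity), ENNReal.ofReal_pow (by norm_num)]
        simp
    _ ≤ _ := ENNReal.ofReal_le_ofReal h2

end Symmetrization

/-! ### A maximal inequality for empirical processes -/

section Maximal

variable {𝒟 : Type*}

/-- A scale dominating the empirical `L²` norm of the envelope. -/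
noncomputable def empScale {I : Type*} [Fintype I] (F : 𝒟 → ℝ) (x : I → 𝒟) : ℝ :=
  1 + (Fintype.card I : ℝ)⁻¹ * ∑ j, F (x j) ^ 2

lemma empScale_pos {I : Type*} [Fintype I] (F : 𝒟 → ℝ) (x : I → 𝒟) : 0 < empScale F x := by
  unfold empScale
  positivity

/-- With y the empirical mean of F², this is y ≤ (1 + y)². Replacing √y by 1 + y gives a scale that
is always positive and whose expectation needs only the second moment of F. -/
lemma sum_sq_le_empScale {I : Type*} [Fintype I] [Nonempty I] (F : 𝒟 → ℝ) (x : I → 𝒟) :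
    ∑ j, F (x j) ^ 2 ≤ (√(Fintype.card I) * empScale F x) ^ 2 := by
  have hn : (0 : ℝ) < Fintype.card I := by exact_mod_cast Fintype.card_pos
  set s := ∑ j, F (x j) ^ 2 with hs
  have hs0 : 0 ≤ s := by positivity
  rw [mul_pow, Real.sq_sqrt hn.le, empScale, ← hs]
  have h1 : s = Fintype.card I * ((Fintype.card I : ℝ)⁻¹ * s) := by field_simp
  have h2 : 0 ≤ (Fintype.card I : ℝ)⁻¹ * s := by positivity
  calc s = Fintype.card I * ((Fintype.card I : ℝ)⁻¹ * s) := h1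
    _ ≤ _ := by gcongr; nlinarith

variable [MeasurableSpace 𝒟]

lemma lintegral_sum_eval {I : Type*} [Fintype I] (P : Measure 𝒟) [IsProbabilityMeasure P]
    {φ : 𝒟 → ℝ≥0∞} (hφ : Measurable φ) :
    ∫⁻ x, ∑ j, φ (x j) ∂(Measure.pi fun _ : I => P) = Fintype.card I * ∫⁻ D, φ D ∂P := by
  have hj : ∀ j ∈ Finset.univ, Measurable fun x : I → 𝒟 => φ (x j) := fun j _ => by fun_prop
  rw [lintegral_finsetSum _ hj]
  have : ∀ j, ∫⁻ x, φ (x j) ∂(Measure.pi fun _ : I => P) = ∫⁻ D, φ D ∂P := fun j =>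
    (measurePreserving_eval (fun _ : I => P) j).lintegral_comp hφ
  simp [this]

lemma ae_pi_of_ae {I : Type*} [Fintype I] {P : Measure 𝒟} [IsProbabilityMeasure P]
    {p : 𝒟 → Prop} (h : ∀ᵐ D ∂P, p D) : ∀ᵐ x ∂(Measure.pi fun _ : I => P), ∀ j, p (x j) :=
  ae_all_iff.2 fun j => (measurePreserving_eval (fun _ : I => P) j).quasiMeasurePreserving.ae h

lemma lintegral_sq_le {P : Measure 𝒟} [IsProbabilityMeasure P] {F : 𝒟 → ℝ} {c c₁ : ℝ}
    (hc : 2 < c) (hF : Measurable F)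
    (h : eLpNorm F (ENNReal.ofReal c) P ≤ ENNReal.ofReal c₁) :
    ∫⁻ D, ENNReal.ofReal (F D ^ 2) ∂P ≤ ENNReal.ofReal (c₁ ^ 2) := by
  have h1 : eLpNorm F 2 P ≤ ENNReal.ofReal c₁ := by
    refine (eLpNorm_le_eLpNorm_of_exponent_le ?_ hF.aestronglyMeasurable).trans h
    rw [← ENNReal.ofReal_ofNat]
    exact ENNReal.ofReal_le_ofReal hc.le
  have h2 := eLpNorm_nnreal_pow_eq_lintegral (f := F) (μ := P) (p := 2) (by norm_num)
  simp only [NNReal.coe_ofNat, ENNReal.rpow_ofNat, ENNReal.coe_ofNat] at h2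
  have h3 : ∀ D, ENNReal.ofReal (F D ^ 2) = ‖F D‖ₑ ^ 2 := fun D => by
    rw [← ofReal_norm, ← ENNReal.ofReal_pow (norm_nonneg _), Real.norm_eq_abs, sq_abs]
  simp_rw [h3]
  rw [← h2]
  calc eLpNorm F 2 P ^ 2 ≤ ENNReal.ofReal c₁ ^ 2 := by gcongr
    _ ≤ ENNReal.ofReal |c₁| ^ 2 := by gcongr; exact le_abs_self _
    _ = _ := by rw [← ENNReal.ofReal_pow (abs_nonneg _), sq_abs]

/-- On {F > m} one has F² ≤ m^{-(c-2)} F^c. The strict inequality c > 2 makes the squared envelopes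
uniformly integrable, so one truncation level m serves all of them. -/
lemma exists_tail_sq_le {c c₁ η : ℝ} (hc : 2 < c) (hη : 0 < η) :
    ∃ m : ℝ, 0 < m ∧ ∀ (P : Measure 𝒟) (F : 𝒟 → ℝ), Measurable F →
      eLpNorm F (ENNReal.ofReal c) P ≤ ENNReal.ofReal c₁ →
      ∫⁻ D, ENNReal.ofReal (if m < F D then F D ^ 2 else 0) ∂P ≤ ENNReal.ofReal η := by
  have h1 : Tendsto (fun m : ℝ => m ^ (-(c - 2)) * |c₁| ^ c) atTop (𝓝 0) := by
    simpa using (tendsto_rpow_neg_atTop (by linarith : 0 < c - 2)).mul_const (|c₁| ^ c)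
  obtain ⟨m, hm, hm0⟩ := ((h1.eventually (gt_mem_nhds hη)).and (eventually_gt_atTop 0)).exists
  refine ⟨m, hm0, fun P F hF h => ?_⟩
  have h2 : ∫⁻ D, ‖F D‖ₑ ^ c ∂P ≤ ENNReal.ofReal (|c₁| ^ c) := by
    have h3 := eLpNorm_nnreal_pow_eq_lintegral (f := F) (μ := P) (p := c.toNNReal)
      (by simp; linarith)
    rw [Real.coe_toNNReal c (by linarith)] at h3
    rw [← h3, ← ENNReal.ofReal_rpow_of_nonneg (abs_nonneg _) (by linarith)]
    refine ENNReal.rpow_le_rpow (h.trans (ENNReal.ofReal_le_ofReal (le_abs_self _))) (by linarith)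
  calc ∫⁻ D, ENNReal.ofReal (if m < F D then F D ^ 2 else 0) ∂P
      ≤ ∫⁻ D, ENNReal.ofReal (m ^ (-(c - 2))) * ‖F D‖ₑ ^ c ∂P := by
        refine lintegral_mono fun D => ?_
        split_ifs with hD
        · have hF0 : 0 < F D := hm0.trans hD
          rw [← ofReal_norm, Real.norm_of_nonneg hF0.le,
            ENNReal.ofReal_rpow_of_nonneg hF0.le (by linarith),
            ← ENNReal.ofReal_mul (by positivity)]
          refine ENNReal.ofReal_le_ofReal ?_
          have h4 : F D ^ 2 = F D ^ (-(c - 2)) * F D ^ c := by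
            rw [← Real.rpow_add hF0, ← Real.rpow_natCast]; norm_num
          rw [h4]
          gcongr ?_ * _
          exact Real.rpow_le_rpow_of_nonpos hm0 hD.le (by linarith)
        · simp
    _ = ENNReal.ofReal (m ^ (-(c - 2))) * ∫⁻ D, ‖F D‖ₑ ^ c ∂P :=
        lintegral_const_mul _ (hF.enorm.pow_const _)
    _ ≤ ENNReal.ofReal (m ^ (-(c - 2))) * ENNReal.ofReal (|c₁| ^ c) := by gcongr
    _ = ENNReal.ofReal (m ^ (-(c - 2)) * |c₁| ^ c) := (ENNReal.ofReal_mul (by positivity)).symm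
    _ ≤ _ := ENNReal.ofReal_le_ofReal hm.le

/-- A countable class of functions with a `P`-integrable envelope and polynomial covering numbers
on the samples indexed by `I`. -/
structure EntropyClass (P : Measure 𝒟) (I : Type*) [Fintype I] {ι : Type*} (f : ι → 𝒟 → ℝ)
    (F : 𝒟 → ℝ) (c c₁ a v : ℝ) : Prop where
  measurable : ∀ i, Measurable (f i)
  measurable_envelope : Measurable F
  abs_le : ∀ᵐ D ∂P, ∀ i, |f i D| ≤ F D
  moment : eLpNorm F (ENNReal.ofReal c) P ≤ ENNReal.ofReal c₁
  cover : ∀ᵐ x ∂(Measure.pi fun _ : I => P), ∀ B : ℝ, 0 < B →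
    ∑ j, F (x j) ^ 2 ≤ (√(Fintype.card I) * B) ^ 2 → PolyCover (fun i j => f i (x j)) B a v

/-- Zeroing the same coordinates of a vector and of its net point cannot increase their distance.
This lets the class be truncated to {F ≤ m} at no cost in entropy. -/
lemma PolyCover.ite {ι I : Type*} [Fintype I] {u : ι → I → ℝ} {B a v : ℝ}
    (h : PolyCover u B a v) [Nonempty ι] (p : I → Prop) [DecidablePred p] :
    PolyCover (fun i j => if p j then u i j else 0) B a v := by
  classical
  intro ε hε hε1
  obtain ⟨T, hTc, hT⟩ := h ε hε hε1
  refine ⟨T.image fun w j => if p j then w j else 0, le_trans ?_ hTc, fun i => ?_⟩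
  · obtain ⟨w, hw, -⟩ := hT (Classical.arbitrary ι)
    refine Real.log_le_log ?_ (by exact_mod_cast Finset.card_image_le)
    exact_mod_cast Finset.Nonempty.card_pos ⟨_, Finset.mem_image_of_mem _ hw⟩
  · obtain ⟨w, hw, h1⟩ := hT i
    refine ⟨_, Finset.mem_image_of_mem _ hw, le_trans (Finset.sum_le_sum fun j _ => ?_) h1⟩
    by_cases hp : p j
    · simp [hp]
    · simp [hp, sq_nonneg]

namespace EntropyClass

variable {P : Measure 𝒟} [IsProbabilityMeasure P] {I : Type*} [Fintype I]
  {ι : Type*} {f : ι → 𝒟 → ℝ} {F : 𝒟 → ℝ} {c c₁ a v : ℝ}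

lemma memLp_envelope (h : EntropyClass P I f F c c₁ a v) (hc : 2 < c) : MemLp F 2 P := by
  refine MemLp.mono_exponent (q := ENNReal.ofReal c)
    ⟨h.measurable_envelope.aestronglyMeasurable, h.moment.trans_lt ENNReal.ofReal_lt_top⟩ ?_
  rw [← ENNReal.ofReal_ofNat]
  exact ENNReal.ofReal_le_ofReal hc.le

lemma memLp (h : EntropyClass P I f F c c₁ a v) (hc : 2 < c) (i : ι) : MemLp (f i) 2 P := by
  refine (h.memLp_envelope hc).mono (h.measurable i).aestronglyMeasurable ?_
  filter_upwards [h.abs_le] with D hD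
  rw [Real.norm_eq_abs, Real.norm_eq_abs]
  exact (hD i).trans (le_abs_self _)

lemma integrable_sq (h : EntropyClass P I f F c c₁ a v) (hc : 2 < c) (i : ι) :
    Integrable (fun D => f i D ^ 2) P := (h.memLp hc i).integrable_sq

end EntropyClass

lemma lintegral_empScale_le {P : Measure 𝒟} [IsProbabilityMeasure P] {I : Type*} [Fintype I]
    {F : 𝒟 → ℝ} {c c₁ : ℝ} (hc : 2 < c) (hF : Measurable F)
    (h : eLpNorm F (ENNReal.ofReal c) P ≤ ENNReal.ofReal c₁) :
    ∫⁻ x, ENNReal.ofReal (empScale F x) ∂(Measure.pi fun _ : I => P) ≤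
      ENNReal.ofReal (1 + c₁ ^ 2) := by
  have h1 : ∀ x : I → 𝒟, ENNReal.ofReal (empScale F x) =
      1 + ENNReal.ofReal (Fintype.card I : ℝ)⁻¹ * ∑ j, ENNReal.ofReal (F (x j) ^ 2) := by
    intro x
    rw [empScale, ENNReal.ofReal_add (by norm_num) (by positivity),
      ENNReal.ofReal_mul (by positivity), ENNReal.ofReal_sum_of_nonneg fun j _ => sq_nonneg _]
    simp
  have hm : Measurable fun D => ENNReal.ofReal (F D ^ 2) := by fun_prop
  simp_rw [h1]
  rw [lintegral_add_left measurable_const, lintegral_const_mul _ (by fun_prop),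
    lintegral_sum_eval P hm, ENNReal.ofReal_add (by norm_num) (by positivity)]
  simp only [lintegral_const, measure_univ, mul_one, ENNReal.ofReal_one]
  gcongr
  rw [← mul_assoc, ← ENNReal.ofReal_natCast, ← ENNReal.ofReal_mul (by positivity)]
  calc _ ≤ ENNReal.ofReal 1 * ∫⁻ D, ENNReal.ofReal (F D ^ 2) ∂P := by
        gcongr
        rcases eq_or_ne (Fintype.card I : ℝ) 0 with h0 | h0
        · simp [h0]
        · rw [inv_mul_cancel₀ h0]
    _ ≤ _ := by simpa using lintegral_sq_le hc hF h

/-- Uniform law of large numbers for the squares. -/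
lemma exists_lintegral_iSup_sq_le {c c₁ a v η : ℝ} (hc : 2 < c) (hη : 0 < η) :
    ∃ n₀ : ℕ, 0 < n₀ ∧ ∀ (P : Measure 𝒟) [IsProbabilityMeasure P] (I : Type) [Fintype I],
      n₀ ≤ Fintype.card I →
      ∀ (ι : Type) [Countable ι] [Nonempty ι] (f : ι → 𝒟 → ℝ) (F : 𝒟 → ℝ),
      EntropyClass P I f F c c₁ a v →
      ∫⁻ x, ⨆ i, ‖∑ j, (f i (x j) ^ 2 - ∫ D, f i D ^ 2 ∂P)‖ₑ ∂(Measure.pi fun _ : I => P) ≤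
        ENNReal.ofReal (η * Fintype.card I) := by
  classical
  -- Error budget per observation: η/2 for the truncated process, and η/8 each for the sample and
  -- the population contribution of the tail.
  obtain ⟨m, hm, htail⟩ := exists_tail_sq_le (𝒟 := 𝒟) (c₁ := c₁) hc (show 0 < η / 8 by positivity)
  set S : ℝ := 1 + c₁ ^ 2 with hS
  have hS0 : 0 < S := by positivity
  -- The net radius makes the discretization term, doubled by symmetrization, at most η/4. With ρ
  -- fixed, the entropy term is of order √n and falls below η n/4 once n ≥ n₀.
  set ρ : ℝ := min 1 (η / (16 * m * S)) with hρ
  have hρ0 : 0 < ρ := by positivity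
  have hρ2 : 4 * m * ρ * S ≤ η / 4 := by
    calc 4 * m * ρ * S ≤ 4 * m * (η / (16 * m * S)) * S := by
          gcongr; exact min_le_right _ _
      _ = η / 4 := by field_simp; norm_num
  set A : ℝ := |v * Real.log (a / ρ) + 2| with hA
  obtain ⟨n₀, hn₀⟩ := exists_nat_gt ((8 * m ^ 2 * A / η) ^ 2)
  refine ⟨n₀ + 1, by omega, fun P _ I _ hI ι _ _ f F hf => ?_⟩
  have hne : Nonempty I := Fintype.card_pos_iff.1 (by omega)
  set n : ℝ := (Fintype.card I : ℝ) with hn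
  have hnpos : 0 < n := by rw [hn]; exact_mod_cast Fintype.card_pos
  have hnA : 2 * (m ^ 2 * √n * A) ≤ η / 4 * n := by
    have h1 : 8 * m ^ 2 * A / η ≤ √n := by
      refine Real.le_sqrt_of_sq_le (hn₀.le.trans ?_)
      rw [hn]; exact_mod_cast (by omega : n₀ ≤ Fintype.card I)
    rw [div_le_iff₀ hη] at h1
    have h2 : √n * √n = n := Real.mul_self_sqrt hnpos.le
    have h3 : 0 < √n := Real.sqrt_pos.2 hnpos
    nlinarith
  set π := Measure.pi fun _ : I => P with hπ
  -- truncation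
  set g : ι → 𝒟 → ℝ := fun i D => if F D ≤ m then f i D else 0 with hg
  set H : 𝒟 → ℝ := fun D => if m < F D then F D ^ 2 else 0 with hH
  have hFm := hf.measurable_envelope
  have hHm : Measurable H := Measurable.ite (measurableSet_lt measurable_const hFm)
    (hFm.pow_const 2) measurable_const
  have hH0 : ∀ D, 0 ≤ H D := fun D => by simp only [hH]; split_ifs <;> positivity
  have hgm : ∀ i, Measurable (g i) := fun i =>
    Measurable.ite (measurableSet_le hFm measurable_const) (hf.measurable i) measurable_const
  have hgf : ∀ i D, g i D ^ 2 ≤ f i D ^ 2 := fun i D => by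
    simp only [hg]; split_ifs
    · exact le_rfl
    · simpa using sq_nonneg _
  have hgint : ∀ i, Integrable (fun D => g i D ^ 2) P := fun i =>
    (hf.integrable_sq hc i).mono' ((hgm i).pow_const 2).aestronglyMeasurable
      (ae_of_all _ fun D => by rw [Real.norm_of_nonneg (sq_nonneg _)]; exact hgf i D)
  have hHint : Integrable H P := by
    refine ((hf.memLp_envelope hc).integrable_sq).mono' hHm.aestronglyMeasurable
      (ae_of_all _ fun D => ?_)
    rw [Real.norm_of_nonneg (hH0 D)]
    simp only [hH]; split_ifs
    · exact le_rfl
    · positivity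
  have hHI : ∫ D, H D ∂P ≤ η / 8 := by
    rw [integral_eq_lintegral_of_nonneg_ae (ae_of_all _ hH0) hHm.aestronglyMeasurable]
    exact ENNReal.toReal_le_of_le_ofReal (by positivity) (htail P F hFm hf.moment)
  have hdiff : ∀ᵐ D ∂P, ∀ i, |f i D ^ 2 - g i D ^ 2| ≤ H D := by
    filter_upwards [hf.abs_le] with D hD i
    simp only [hg, hH]
    by_cases h : F D ≤ m
    · simp [h, not_lt.2 h]
    · simp only [h, not_le.1 h, if_true, if_false]
      have := sq_le_sq' (by linarith [abs_nonneg (f i D), hD i]) (hD i)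
      rw [sq_abs] at this
      rw [abs_of_nonneg (by nlinarith [sq_nonneg (f i D)])]
      linarith
  have hdiffI : ∀ i, |∫ D, f i D ^ 2 ∂P - ∫ D, g i D ^ 2 ∂P| ≤ η / 8 := by
    intro i
    rw [← integral_sub (hf.integrable_sq hc i) (hgint i)]
    refine (abs_integral_le_integral_abs).trans (le_trans (integral_mono_ae ?_ hHint ?_) hHI)
    · exact ((hf.integrable_sq hc i).sub (hgint i)).abs
    · filter_upwards [hdiff] with D hD using hD i
  -- the truncated process
  have htrunc : ∫⁻ x, ⨆ i, ‖∑ j, (g i (x j) ^ 2 - ∫ D, g i D ^ 2 ∂P)‖ₑ ∂π ≤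
      ENNReal.ofReal (η / 2 * n) := by
    have hb : ∀ᵐ x ∂π, RadBound (fun i j => g i (x j) ^ 2)
        (m ^ 2 * √n * A + n * (2 * m * ρ) * empScale F x) := by
      filter_upwards [hf.cover, ae_pi_of_ae hf.abs_le] with x hx hx'
      have h1 := (hx _ (empScale_pos F x) (sum_sq_le_empScale F x)).ite fun j => F (x j) ≤ m
      refine (RadBound.sq_of_polyCover (empScale_pos F x).le h1 hm ?_ hρ0
        (min_le_left _ _)).mono ?_
      · intro i j
        split_ifs with h
        · exact (hx' j i).trans h
        · simpa using hm.le
      · rw [← hn]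
        have : m ^ 2 * √n * (v * Real.log (a / ρ) + 2) ≤ m ^ 2 * √n * A := by
          gcongr; exact le_abs_self _
        nlinarith
    refine (lintegral_iSup_le_of_radBound P (fun i => (hgm i).pow_const 2) hgint hb).trans ?_
    have h2 : ∫⁻ x, ENNReal.ofReal (m ^ 2 * √n * A + n * (2 * m * ρ) * empScale F x) ∂π ≤
        ENNReal.ofReal (m ^ 2 * √n * A + n * (2 * m * ρ) * S) := by
      have h3 : ∀ x : I → 𝒟, ENNReal.ofReal (m ^ 2 * √n * A + n * (2 * m * ρ) * empScale F x) =
          ENNReal.ofReal (m ^ 2 * √n * A) + ENNReal.ofReal (n * (2 * m * ρ)) *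
            ENNReal.ofReal (empScale F x) := fun x => by
        have := (empScale_pos F x).le
        rw [ENNReal.ofReal_add (by positivity) (by positivity),
          ENNReal.ofReal_mul (p := n * (2 * m * ρ)) (by positivity)]
      simp_rw [h3]
      rw [lintegral_add_left measurable_const,
        lintegral_const_mul _ (by unfold empScale; fun_prop),
        ENNReal.ofReal_add (by positivity) (by positivity),
        ENNReal.ofReal_mul (p := n * (2 * m * ρ)) (by positivity)]
      simp only [lintegral_const, measure_univ, mul_one]
      gcongr
      exact lintegral_empScale_le hc hFm hf.moment
    calc 2 * ∫⁻ x, ENNReal.ofReal (m ^ 2 * √n * A + n * (2 * m * ρ) * empScale F x) ∂π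
        ≤ 2 * ENNReal.ofReal (m ^ 2 * √n * A + n * (2 * m * ρ) * S) := by gcongr
      _ = ENNReal.ofReal (2 * (m ^ 2 * √n * A + n * (2 * m * ρ) * S)) := by
          rw [ENNReal.ofReal_mul (p := 2) (by norm_num)]; simp
      _ ≤ _ := ENNReal.ofReal_le_ofReal (by nlinarith)
  -- the remainder
  have hpt : ∀ᵐ x ∂π, ⨆ i, ‖∑ j, (f i (x j) ^ 2 - ∫ D, f i D ^ 2 ∂P)‖ₑ ≤
      (⨆ i, ‖∑ j, (g i (x j) ^ 2 - ∫ D, g i D ^ 2 ∂P)‖ₑ) +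
        (∑ j, ENNReal.ofReal (H (x j)) + ENNReal.ofReal (n * (η / 8))) := by
    filter_upwards [ae_pi_of_ae hdiff] with x hx
    refine iSup_le fun i => ?_
    have h4 : ∑ j, (f i (x j) ^ 2 - ∫ D, f i D ^ 2 ∂P) =
        ∑ j, (g i (x j) ^ 2 - ∫ D, g i D ^ 2 ∂P) + (∑ j, (f i (x j) ^ 2 - g i (x j) ^ 2)
          - n * (∫ D, f i D ^ 2 ∂P - ∫ D, g i D ^ 2 ∂P)) := by
      simp only [Finset.sum_sub_distrib, Finset.sum_const, Finset.card_univ, nsmul_eq_mul, ← hn]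
      ring
    rw [h4]
    refine (enorm_add_le _ _).trans (add_le_add
      (le_iSup (fun i => ‖∑ j, (g i (x j) ^ 2 - ∫ D, g i D ^ 2 ∂P)‖ₑ) i) ?_)
    rw [← ENNReal.ofReal_sum_of_nonneg fun j _ => hH0 _, ← ENNReal.ofReal_add
      (Finset.sum_nonneg fun j _ => hH0 _) (by positivity), ← ofReal_norm, Real.norm_eq_abs]
    refine ENNReal.ofReal_le_ofReal ((abs_sub _ _).trans (add_le_add ?_ ?_))
    · exact (Finset.abs_sum_le_sum_abs _ _).trans (Finset.sum_le_sum fun j _ => hx j i)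
    · rw [abs_mul, abs_of_pos hnpos]
      gcongr
      exact hdiffI i
  refine (lintegral_mono_ae hpt).trans ?_
  have hGm : Measurable fun x : I → 𝒟 => ⨆ i, ‖∑ j, (g i (x j) ^ 2 - ∫ D, g i D ^ 2 ∂P)‖ₑ := by
    refine Measurable.iSup fun i => ?_
    have := hgm i
    fun_prop
  rw [lintegral_add_left hGm, lintegral_add_right _ measurable_const,
    lintegral_sum_eval P (φ := fun D => ENNReal.ofReal (H D)) (by fun_prop)]
  simp only [lintegral_const, measure_univ, mul_one]
  have h5 : (Fintype.card I : ℝ≥0∞) * ∫⁻ D, ENNReal.ofReal (H D) ∂P ≤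
      ENNReal.ofReal (n * (η / 8)) := by
    rw [ENNReal.ofReal_mul hnpos.le, hn, ENNReal.ofReal_natCast]
    gcongr
    exact htail P F hFm hf.moment
  calc _ ≤ ENNReal.ofReal (η / 2 * n) + (ENNReal.ofReal (n * (η / 8)) +
        ENNReal.ofReal (n * (η / 8))) := by gcongr
    _ = ENNReal.ofReal (η / 2 * n + (n * (η / 8) + n * (η / 8))) := by
        rw [ENNReal.ofReal_add (by positivity) (by positivity),
          ENNReal.ofReal_add (by positivity) (by positivity)]
    _ ≤ _ := ENNReal.ofReal_le_ofReal (by nlinarith)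

end Maximal

/-! ### Maximal inequality for classes of small L² diameter -/

section Equicontinuity

variable {𝒟 : Type*} [MeasurableSpace 𝒟]

/-- Maximal inequality: over a class with small `L²(P)` diameter, the empirical process is
uniformly small in mean, with constants depending only on the envelope and entropy bounds. -/
lemma exists_lintegral_iSup_le {c c₁ a v η : ℝ} (hc : 2 < c) (ha : 0 < a) (hv : 0 ≤ v)
    (hη : 0 < η) :
    ∃ σ : ℝ, 0 < σ ∧ ∃ n₀ : ℕ, 0 < n₀ ∧
      ∀ (P : Measure 𝒟) [IsProbabilityMeasure P] (I : Type) [Fintype I], n₀ ≤ Fintype.card I →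
      ∀ (ι : Type) [Countable ι] [Nonempty ι] (f : ι → 𝒟 → ℝ) (F : 𝒟 → ℝ),
      EntropyClass P I f F c c₁ a v → (∀ i, ∫ D, f i D ^ 2 ∂P ≤ σ) →
      ∫⁻ x, ⨆ i, ‖∑ j, (f i (x j) - ∫ D, f i D ∂P)‖ₑ ∂(Measure.pi fun _ : I => P) ≤
        ENNReal.ofReal (η * √(Fintype.card I)) := by
  classical
  set S : ℝ := 1 + c₁ ^ 2 with hS
  have hS0 : 0 < S := by positivity
  -- Order of choices: the level k makes the envelope part of the chaining bound at most η/8 in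
  -- mean. Then κ is small relative to the entropy factor at this level, so that the diameter part
  -- is 3Aκ = η/8, and σ = κ². The law of large numbers is used with tolerance κ² as well.
  obtain ⟨k, hk⟩ := ((tendsto_chaining_remainder a v).eventually
    (gt_mem_nhds (show 0 < η / (8 * S) by positivity))).exists
  set A : ℝ := |entropyFactor a v k| + 1 with hA
  have hA0 : 0 < A := by positivity
  set κ : ℝ := η / (24 * A) with hκ
  have hκ0 : 0 < κ := by positivity
  have hAκ : A * κ = η / 24 := by rw [hκ]; field_simp
  obtain ⟨n₀, hn₀, hlln⟩ := exists_lintegral_iSup_sq_le (𝒟 := 𝒟) (c₁ := c₁) (a := a) (v := v) hc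
    (show 0 < κ ^ 2 by positivity)
  refine ⟨κ ^ 2, by positivity, n₀, hn₀, fun P _ I _ hI ι _ _ f F hf hσ => ?_⟩
  have hne : Nonempty I := Fintype.card_pos_iff.1 (by omega)
  specialize hlln P I hI ι f F hf
  set n : ℝ := (Fintype.card I : ℝ) with hn
  have hnpos : 0 < n := by rw [hn]; exact_mod_cast Fintype.card_pos
  have hsn : 0 < √n := Real.sqrt_pos.2 hnpos
  set π := Measure.pi fun _ : I => P with hπ
  set Z : (I → 𝒟) → ℝ≥0∞ := fun x => ⨆ i, ‖∑ j, (f i (x j) ^ 2 - ∫ D, f i D ^ 2 ∂P)‖ₑ with hZ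
  have hZm : Measurable Z := by
    refine Measurable.iSup fun i => ?_
    have := hf.measurable i
    fun_prop
  have hZfin : ∀ᵐ x ∂π, Z x < ∞ := ae_lt_top hZm (hlln.trans_lt ENNReal.ofReal_lt_top).ne
  set b : (I → 𝒟) → ℝ := fun x =>
    √n * A * (2 * κ) + √n * A / (n * κ) * (Z x).toReal +
      √n * (η / (8 * S)) * empScale F x with hb_def
  have hb : ∀ᵐ x ∂π, RadBound (fun i j => f i (x j)) (b x) := by
    filter_upwards [hf.cover, hZfin] with x hx hZx
    set z := (Z x).toReal with hz
    have hz0 : 0 ≤ z := ENNReal.toReal_nonneg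
    have hB := empScale_pos F x
    have hsq : ∀ i, ∑ j, f i (x j) ^ 2 ≤ n * (κ ^ 2 + z / n) := by
      intro i
      have h1 : |∑ j, (f i (x j) ^ 2 - ∫ D, f i D ^ 2 ∂P)| ≤ z := by
        have h2 : ‖∑ j, (f i (x j) ^ 2 - ∫ D, f i D ^ 2 ∂P)‖ₑ ≤ Z x :=
          le_iSup (fun i => ‖∑ j, (f i (x j) ^ 2 - ∫ D, f i D ^ 2 ∂P)‖ₑ) i
        have h3 := ENNReal.toReal_mono hZx.ne h2
        simpa using h3
      simp only [Finset.sum_sub_distrib, Finset.sum_const, Finset.card_univ, nsmul_eq_mul,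
        ← hn] at h1
      have h2 := (abs_le.1 h1).2
      have h3 := hσ i
      have h4 : n * (κ ^ 2 + z / n) = n * κ ^ 2 + z := by field_simp
      rw [h4]
      nlinarith
    -- An upper bound for √(κ² + z/n) that is affine in z; its expectation follows directly from
    -- that of Z, with no square root of a random variable.
    set D : ℝ := κ + (κ ^ 2 + z / n) / κ with hD
    have hD0 : 0 ≤ D := by positivity
    have hDsq : κ ^ 2 + z / n ≤ D ^ 2 := by
      set y := κ ^ 2 + z / n with hy
      have hy0 : 0 ≤ y := by positivity
      have : D ^ 2 = κ ^ 2 + 2 * y + (y / κ) ^ 2 := by rw [hD]; field_simp; ring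
      nlinarith [sq_nonneg κ, sq_nonneg (y / κ)]
    have h5 := RadBound.of_polyCover hB ha hv (hx _ hB (sum_sq_le_empScale F x)) hD0
      (fun i => (hsq i).trans (by
        rw [mul_pow, Real.sq_sqrt (by positivity), ← hn]
        gcongr)) k
    refine h5.mono ?_
    rw [← hn]
    have h6 : b x = √n * (D * A + empScale F x * (η / (8 * S))) := by
      simp only [hb_def, hD, ← hz]; field_simp; ring
    rw [h6]
    gcongr
    rw [hA]
    linarith [le_abs_self (entropyFactor a v k)]
  refine (lintegral_iSup_le_of_radBound P hf.measurable
    (fun i => (hf.memLp hc i).integrable (by norm_num)) hb).trans ?_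
  have h7 : ∫⁻ x, ENNReal.ofReal (b x) ∂π ≤ ENNReal.ofReal (η / 2 * √n) := by
    have h8 : ∀ x, ENNReal.ofReal (b x) ≤ ENNReal.ofReal (√n * A * (2 * κ)) +
        (ENNReal.ofReal (√n * A / (n * κ)) * Z x +
        ENNReal.ofReal (√n * (η / (8 * S))) * ENNReal.ofReal (empScale F x)) := by
      intro x
      have := (empScale_pos F x).le
      have hz0 : 0 ≤ (Z x).toReal := ENNReal.toReal_nonneg
      simp only [hb_def]
      rw [add_assoc, ENNReal.ofReal_add (by positivity) (by positivity),
        ENNReal.ofReal_add (by positivity) (by positivity),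
        ENNReal.ofReal_mul (p := √n * A / (n * κ)) (by positivity),
        ENNReal.ofReal_mul (p := √n * (η / (8 * S))) (by positivity)]
      gcongr
      exact ENNReal.ofReal_toReal_le
    refine (lintegral_mono h8).trans ?_
    rw [lintegral_add_left measurable_const, lintegral_add_left (hZm.const_mul _),
      lintegral_const_mul _ hZm, lintegral_const_mul']
    swap; · exact ENNReal.ofReal_ne_top
    simp only [lintegral_const, measure_univ, mul_one]
    calc _ ≤ ENNReal.ofReal (√n * A * (2 * κ)) +
        (ENNReal.ofReal (√n * A / (n * κ)) * ENNReal.ofReal (κ ^ 2 * n) +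
        ENNReal.ofReal (√n * (η / (8 * S))) * ENNReal.ofReal S) := by
          gcongr
          exact lintegral_empScale_le hc hf.measurable_envelope hf.moment
      _ = ENNReal.ofReal (√n * A * (2 * κ) +
        (√n * A / (n * κ) * (κ ^ 2 * n) + √n * (η / (8 * S)) * S)) := by
          rw [← ENNReal.ofReal_mul (by positivity), ← ENNReal.ofReal_mul (by positivity),
            ← ENNReal.ofReal_add (by positivity) (by positivity),
            ← ENNReal.ofReal_add (by positivity) (by positivity)]
      _ ≤ _ := by
          refine ENNReal.ofReal_le_ofReal ?_
          have h9 : √n * A * (2 * κ) +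
              (√n * A / (n * κ) * (κ ^ 2 * n) + √n * (η / (8 * S)) * S)
              = √n * (3 * (A * κ) + η / 8) := by field_simp; ring
          rw [h9, hAκ]
          nlinarith
  calc 2 * ∫⁻ x, ENNReal.ofReal (b x) ∂π ≤ 2 * ENNReal.ofReal (η / 2 * √n) := by gcongr
    _ = ENNReal.ofReal (2 * (η / 2 * √n)) := by
        rw [ENNReal.ofReal_mul (p := 2) (by norm_num)]; simp
    _ ≤ _ := ENNReal.ofReal_le_ofReal (by linarith)

/-- Maximal inequality in probability. -/
lemma exists_measure_exists_lt_le {c c₁ a v η p : ℝ} (hc : 2 < c) (ha : 0 < a) (hv : 0 ≤ v)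
    (hη : 0 < η) (hp : 0 < p) :
    ∃ σ : ℝ, 0 < σ ∧ ∃ n₀ : ℕ, 0 < n₀ ∧
      ∀ (P : Measure 𝒟) [IsProbabilityMeasure P] (I : Type) [Fintype I], n₀ ≤ Fintype.card I →
      ∀ (ι : Type) [Countable ι] [Nonempty ι] (f : ι → 𝒟 → ℝ) (F : 𝒟 → ℝ),
      EntropyClass P I f F c c₁ a v → (∀ i, ∫ D, f i D ^ 2 ∂P ≤ σ) →
      (Measure.pi fun _ : I => P) {x | ∃ i, η * √(Fintype.card I) <
        |∑ j, (f i (x j) - ∫ D, f i D ∂P)|} ≤ ENNReal.ofReal p := by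
  obtain ⟨σ, hσ0, n₀, hn₀, h⟩ := exists_lintegral_iSup_le (𝒟 := 𝒟) (c₁ := c₁) hc ha hv
    (show 0 < p * η by positivity)
  refine ⟨σ, hσ0, n₀, hn₀, fun P _ I _ hI ι _ _ f F hf hσ => ?_⟩
  have hne : Nonempty I := Fintype.card_pos_iff.1 (by omega)
  have hn : 0 < √(Fintype.card I : ℝ) := Real.sqrt_pos.2 (by exact_mod_cast Fintype.card_pos)
  specialize h P I hI ι f F hf hσ
  set Z : (I → 𝒟) → ℝ≥0∞ := fun x => ⨆ i, ‖∑ j, (f i (x j) - ∫ D, f i D ∂P)‖ₑ with hZ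
  have hZm : Measurable Z := by
    refine Measurable.iSup fun i => ?_
    have := hf.measurable i
    fun_prop
  have h1 : {x : I → 𝒟 | ∃ i, η * √(Fintype.card I) < |∑ j, (f i (x j) - ∫ D, f i D ∂P)|} ⊆
      {x | ENNReal.ofReal (η * √(Fintype.card I)) ≤ Z x} := by
    rintro x ⟨i, hi⟩
    refine le_trans ?_ (le_iSup (fun i => ‖∑ j, (f i (x j) - ∫ D, f i D ∂P)‖ₑ) i)
    rw [← ofReal_norm, Real.norm_eq_abs]
    exact ENNReal.ofReal_le_ofReal hi.le
  refine (measure_mono h1).trans ?_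
  refine (meas_ge_le_lintegral_div hZm.aemeasurable (by simp; positivity)
    ENNReal.ofReal_ne_top).trans ?_
  refine ENNReal.div_le_of_le_mul (h.trans (le_of_eq ?_))
  rw [← ENNReal.ofReal_mul hp.le, mul_assoc]

end Equicontinuity

/-! ### The class of moment differences -/

section Differences

lemma discreteL2Norm_uniform {𝒟 W : Type*} [NormedAddCommGroup W] {I : Type*} [Fintype I]
    (e : Fin (Fintype.card I) ≃ I) (x : I → 𝒟) (φ : 𝒟 → W) :
    Model.discreteL2Norm (fun _ => (Fintype.card I : ℝ)⁻¹) (fun i => x (e i)) φ =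
      √((Fintype.card I : ℝ)⁻¹ * ∑ j, ‖φ (x j)‖ ^ 2) := by
  rw [Model.discreteL2Norm, ← Finset.mul_sum, e.sum_comp (fun j => ‖φ (x j)‖ ^ 2)]

variable {𝒟 V : Type*} [MeasurableSpace 𝒟] {d L : ℕ} (M : Model 𝒟 V d L)

/-- The difference `g_l(·, t, ξ(t)) - g_l(·, s, ξ₀(s))`. -/
def momentDiff (ξ : EuclideanSpace ℝ (Fin d) → V) (t s : EuclideanSpace ℝ (Fin d)) (l : Fin L)
    (D : 𝒟) : ℝ :=
  M.g D t (ξ t) l - M.g D s (M.ξ₀ s) l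

/-- Absorbs the halving of the radius into new constants. The absolute values make the right side
nonnegative whatever the signs of v and log a. -/
lemma mul_log_div_le {a v ε : ℝ} (ha : 0 < a) (hε : 0 < ε) (hε1 : ε ≤ 1) :
    v * Real.log (a / (ε / 2)) ≤ |v| * Real.log (2 * Real.exp |Real.log a| / ε) := by
  have h1 : Real.log (2 * Real.exp |Real.log a| / ε) =
      Real.log 2 + |Real.log a| - Real.log ε := by
    rw [Real.log_div (by positivity) hε.ne', Real.log_mul (by norm_num) (by positivity),
      Real.log_exp]
  have h2 : Real.log (a / (ε / 2)) = Real.log a - (Real.log ε - Real.log 2) := by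
    rw [Real.log_div ha.ne' (by positivity), Real.log_div hε.ne' (by norm_num)]
  have h3 : Real.log ε ≤ 0 := Real.log_nonpos hε.le hε1
  have h4 : 0 < Real.log 2 := Real.log_pos (by norm_num)
  rw [h1, h2]
  refine (le_abs_self _).trans ?_
  rw [abs_mul]
  gcongr
  refine abs_le.2 ⟨?_, ?_⟩ <;> linarith [le_abs_self (Real.log a), neg_abs_le (Real.log a)]

lemma norm_le_sum_abs (v : EuclideanSpace ℝ (Fin L)) : ‖v‖ ≤ ∑ l, |v l| := by
  rw [EuclideanSpace.norm_eq]
  refine Real.sqrt_le_iff.2 ⟨Finset.sum_nonneg fun _ _ => abs_nonneg _, ?_⟩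
  simp only [Real.norm_eq_abs]
  exact Finset.sum_sq_le_sq_sum_of_nonneg fun _ _ => abs_nonneg _

variable {M}

/-- The entropy condition is applied to the empirical measure of the sample `x`. Radius ε/2 is used
so that covers of two classes combine to a cover of their differences at radius ε. -/
lemma exists_cover_of_uniformEntropyBound {ξ : EuclideanSpace ℝ (Fin d) → V} {F : 𝒟 → ℝ}
    {a v : ℝ} (h : M.UniformEntropyBound ξ F a v) (ha : 0 < a) {I : Type*} [Fintype I]
    [Nonempty I] {x : I → 𝒟} {B : ℝ} (hB : 0 < B) (l : Fin L)
    (hx : ∀ j, ∀ θ ∈ M.Θ, |M.g (x j) θ (ξ θ) l| ≤ F (x j))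
    (hFB : ∑ j, F (x j) ^ 2 ≤ (√(Fintype.card I) * B) ^ 2) {ε : ℝ} (hε : 0 < ε) (hε1 : ε ≤ 1) :
    ∃ T : Finset (I → ℝ),
      Real.log T.card ≤ |v| * Real.log (2 * Real.exp |Real.log a| / ε) ∧
      ∀ θ ∈ M.Θ, ∃ w ∈ T,
        ∑ j, (M.g (x j) θ (ξ θ) l - w j) ^ 2 ≤ (ε / 2 * √(Fintype.card I) * B) ^ 2 := by
  classical
  have hn : (0 : ℝ) < Fintype.card I := by exact_mod_cast Fintype.card_pos
  have hlog0 : 0 ≤ |v| * Real.log (2 * Real.exp |Real.log a| / ε) := by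
    refine mul_nonneg (abs_nonneg _) (Real.log_nonneg ?_)
    rw [le_div_iff₀ hε]
    nlinarith [Real.one_le_exp (abs_nonneg (Real.log a))]
  set e := (Fintype.equivFin I).symm with he
  set N := Model.discreteL2Norm (fun _ => (Fintype.card I : ℝ)⁻¹) (fun i => x (e i)) F with hN
  have hN' : N = √((Fintype.card I : ℝ)⁻¹ * ∑ j, F (x j) ^ 2) := by
    rw [hN, discreteL2Norm_uniform]; simp
  have hNB : N ≤ B := by
    rw [hN']
    refine Real.sqrt_le_iff.2 ⟨hB.le, ?_⟩
    rw [inv_mul_le_iff₀ hn]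
    rwa [mul_pow, Real.sq_sqrt hn.le] at hFB
  -- When the envelope has empirical norm zero the entropy condition is silent, but then every
  -- member of the class vanishes on the sample and {0} is a cover.
  rcases (show 0 ≤ N by rw [hN']; positivity).eq_or_lt with h0 | h0
  · refine ⟨{0}, by simpa using hlog0, fun θ hθ => ⟨0, by simp, ?_⟩⟩
    have h1 : ∑ j, F (x j) ^ 2 = 0 := by
      rw [hN', eq_comm, Real.sqrt_eq_zero (by positivity)] at h0
      rcases mul_eq_zero.1 h0 with h2 | h2
      · exact absurd h2 (by positivity)
      · exact h2
    have h2 : ∀ j, (M.g (x j) θ (ξ θ) l - (0 : I → ℝ) j) ^ 2 = 0 := by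
      intro j
      have h3 := (Finset.sum_eq_zero_iff_of_nonneg fun j _ => sq_nonneg (F (x j))).1 h1 j
        (Finset.mem_univ j)
      have h4 := hx j θ hθ
      rw [pow_eq_zero_iff two_ne_zero] at h3
      rw [h3, abs_nonpos_iff] at h4
      simp [h4]
    simp_rw [h2]
    simpa using sq_nonneg _
  · obtain ⟨T, hTc, hT⟩ := h (Fintype.card I) (fun _ => (Fintype.card I : ℝ)⁻¹)
      (fun i => x (e i)) (fun _ => by positivity) (by simp) h0 (ε / 2) (by positivity)
      (by linarith)
    rw [← hN] at hT
    refine ⟨T.image fun f j => f (x j) l, ?_, fun θ hθ => ?_⟩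
    · rcases T.eq_empty_or_nonempty with rfl | hTne
      · simpa using hlog0
      · refine le_trans (Real.log_le_log ?_ (by exact_mod_cast Finset.card_image_le))
          (hTc.trans (mul_log_div_le ha hε hε1))
        exact_mod_cast (hTne.image _).card_pos
    · obtain ⟨f, hf, h1⟩ := hT θ hθ
      refine ⟨_, Finset.mem_image_of_mem _ hf, ?_⟩
      rw [discreteL2Norm_uniform] at h1
      have h2 : (Fintype.card I : ℝ)⁻¹ * ∑ j, ‖M.g (x j) θ (ξ θ) - f (x j)‖ ^ 2 ≤
          (ε / 2 * B) ^ 2 := by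
        refine Real.sqrt_le_left (by positivity) |>.1 (h1.trans ?_)
        gcongr
      rw [inv_mul_le_iff₀ hn] at h2
      calc ∑ j, (M.g (x j) θ (ξ θ) l - f (x j) l) ^ 2
          ≤ ∑ j, ‖M.g (x j) θ (ξ θ) - f (x j)‖ ^ 2 := by
            refine Finset.sum_le_sum fun j _ => ?_
            have := PiLp.norm_apply_le (M.g (x j) θ (ξ θ) - f (x j)) l
            rw [PiLp.sub_apply, Real.norm_eq_abs] at this
            rw [← sq_abs]
            gcongr
        _ ≤ Fintype.card I * (ε / 2 * B) ^ 2 := h2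
        _ = _ := by rw [mul_pow, mul_pow, mul_pow, Real.sq_sqrt hn.le]; ring

/-- Differences of two classes with polynomial uniform covering numbers have polynomial covering
numbers. -/
lemma entropyClass_momentDiff [IsProbabilityMeasure M.P] {ξ : EuclideanSpace ℝ (Fin d) → V}
    {F F₀ : 𝒟 → ℝ} {c c₁ a v : ℝ} (hc : 2 < c) (ha : 0 < a)
    (hm : ∀ θ ∈ M.Θ, Measurable fun D => M.g D θ (ξ θ))
    (hm₀ : ∀ θ ∈ M.Θ, Measurable fun D => M.g D θ (M.ξ₀ θ))
    (hF : Measurable F) (hF₀ : Measurable F₀)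
    (hb : ∀ᵐ D ∂M.P, ∀ θ ∈ M.Θ, ∀ l, |M.g D θ (ξ θ) l| ≤ F D)
    (hb₀ : ∀ᵐ D ∂M.P, ∀ θ ∈ M.Θ, ∀ l, |M.g D θ (M.ξ₀ θ) l| ≤ F₀ D)
    (hc₁ : eLpNorm F (ENNReal.ofReal c) M.P ≤ ENNReal.ofReal c₁)
    (hc₁₀ : eLpNorm F₀ (ENNReal.ofReal c) M.P ≤ ENNReal.ofReal c₁)
    (he : M.UniformEntropyBound ξ F a v) (he₀ : M.UniformEntropyBound M.ξ₀ F₀ a v)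
    {ι : Type*} [Nonempty ι] {t s : ι → EuclideanSpace ℝ (Fin d)} (ht : ∀ i, t i ∈ M.Θ)
    (hs : ∀ i, s i ∈ M.Θ) (l : Fin L) (I : Type*) [Fintype I] [Nonempty I] :
    EntropyClass M.P I (fun i => momentDiff M ξ (t i) (s i) l) (fun D => |F D| + |F₀ D|)
      c (2 * |c₁|) (2 * Real.exp |Real.log a|) (2 * |v|) where
  measurable i := by
    have h1 := hm _ (ht i)
    have h2 := hm₀ _ (hs i)
    unfold momentDiff
    fun_prop
  measurable_envelope := by fun_prop
  abs_le := by
    filter_upwards [hb, hb₀] with D h1 h2 i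
    refine (abs_sub _ _).trans (add_le_add ((h1 _ (ht i) l).trans (le_abs_self _))
      ((h2 _ (hs i) l).trans (le_abs_self _)))
  moment := by
    have h1 : (1 : ℝ≥0∞) ≤ ENNReal.ofReal c := by
      rw [← ENNReal.ofReal_one]; exact ENNReal.ofReal_le_ofReal (by linarith)
    have h2 : eLpNorm (fun D => |F D| + |F₀ D|) (ENNReal.ofReal c) M.P ≤
        eLpNorm (fun D => |F D|) (ENNReal.ofReal c) M.P +
        eLpNorm (fun D => |F₀ D|) (ENNReal.ofReal c) M.P :=
      eLpNorm_add_le (by fun_prop) (by fun_prop) h1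
    have h3 : ∀ φ : 𝒟 → ℝ, eLpNorm (fun D => |φ D|) (ENNReal.ofReal c) M.P =
        eLpNorm φ (ENNReal.ofReal c) M.P := fun φ => eLpNorm_norm φ
    rw [h3, h3] at h2
    refine h2.trans ((add_le_add hc₁ hc₁₀).trans ?_)
    rw [two_mul, ENNReal.ofReal_add (abs_nonneg _) (abs_nonneg _)]
    gcongr <;> exact le_abs_self _
  cover := by
    classical
    filter_upwards [ae_pi_of_ae (I := I) hb, ae_pi_of_ae (I := I) hb₀] with x hx hx₀ B hB hFB
      ε hε hε1
    have h1 : ∑ j, F (x j) ^ 2 ≤ (√(Fintype.card I) * B) ^ 2 := by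
      refine le_trans (Finset.sum_le_sum fun j _ => ?_) hFB
      rw [← sq_abs]
      gcongr
      exact le_add_of_nonneg_right (abs_nonneg _)
    have h2 : ∑ j, F₀ (x j) ^ 2 ≤ (√(Fintype.card I) * B) ^ 2 := by
      refine le_trans (Finset.sum_le_sum fun j _ => ?_) hFB
      rw [← sq_abs]
      gcongr
      exact le_add_of_nonneg_left (abs_nonneg _)
    obtain ⟨T, hTc, hT⟩ := exists_cover_of_uniformEntropyBound he ha hB l
      (fun j θ hθ => hx j θ hθ l) h1 hε hε1
    obtain ⟨T₀, hTc₀, hT₀⟩ := exists_cover_of_uniformEntropyBound he₀ ha hB l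
      (fun j θ hθ => hx₀ j θ hθ l) h2 hε hε1
    have hne : T.Nonempty := by
      obtain ⟨w, hw, -⟩ := hT _ (ht (Classical.arbitrary ι)); exact ⟨w, hw⟩
    have hne₀ : T₀.Nonempty := by
      obtain ⟨w, hw, -⟩ := hT₀ _ (hs (Classical.arbitrary ι)); exact ⟨w, hw⟩
    refine ⟨(T ×ˢ T₀).image fun z j => z.1 j - z.2 j, ?_, fun i => ?_⟩
    · refine (Real.log_le_log (y := (T.card * T₀.card : ℝ)) ?_ ?_).trans ?_
      · exact_mod_cast ((hne.product hne₀).image _).card_pos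
      · rw [← Nat.cast_mul, ← Finset.card_product]
        exact_mod_cast Finset.card_image_le
      · rw [Real.log_mul (by exact_mod_cast hne.card_pos.ne')
          (by exact_mod_cast hne₀.card_pos.ne')]
        linarith
    · obtain ⟨w, hw, h3⟩ := hT _ (ht i)
      obtain ⟨w₀, hw₀, h4⟩ := hT₀ _ (hs i)
      refine ⟨fun j => w j - w₀ j, Finset.mem_image.2 ⟨(w, w₀), Finset.mem_product.2 ⟨hw, hw₀⟩,
        rfl⟩, ?_⟩
      have h5 : ∀ j, momentDiff M ξ (t i) (s i) l (x j) - (w j - w₀ j) =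
          (M.g (x j) (t i) (ξ (t i)) l - w j) + (w₀ j - M.g (x j) (s i) (M.ξ₀ (s i)) l) := by
        intro j; unfold momentDiff; ring
      simp_rw [h5]
      have h6 : ∑ j, (w₀ j - M.g (x j) (s i) (M.ξ₀ (s i)) l) ^ 2 ≤
          (ε / 2 * √(Fintype.card I) * B) ^ 2 := by
        refine le_trans (le_of_eq (Finset.sum_congr rfl fun j _ => ?_)) h4
        ring
      refine (sum_add_sq_le (by positivity) (by positivity) h3 h6).trans (le_of_eq ?_)
      ring

/-- Uniform smallness of the empirical process over pairs of indices with a small `L²(P)`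
difference, uniformly over the nuisance realization sets. -/
lemma exists_measure_momentDiff_le [IsProbabilityMeasure M.P] (h_reg : M.Regularity)
    (htrue : ∀ N, M.ξ₀ ∈ M.ΞN N) {η p : ℝ} (hη : 0 < η) (hp : 0 < p) :
    ∃ σ : ℝ, 0 < σ ∧ ∃ n₀ : ℕ, 0 < n₀ ∧ ∀ N, ∀ ξ ∈ M.ΞN N, ∀ (I : Type) [Fintype I],
      n₀ ≤ Fintype.card I → ∀ T T₀ : Set (EuclideanSpace ℝ (Fin d)), T.Countable → T₀.Countable →
      T ⊆ M.Θ → T₀ ⊆ M.Θ →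
      (Measure.pi fun _ : I => M.P) {x | ∃ l, ∃ t ∈ T, ∃ s ∈ T₀,
        ∫ D, momentDiff M ξ t s l D ^ 2 ∂M.P ≤ σ ∧ η * √(Fintype.card I) <
        |∑ j, (momentDiff M ξ t s l (x j) - ∫ D, momentDiff M ξ t s l D ∂M.P)|} ≤
      ENNReal.ofReal p := by
  obtain ⟨c, c₁, a, v, hc, ha, henv⟩ := h_reg.envelope_entropy
  -- The probability is shared among the L coordinates by a union bound; L + 1 also covers L = 0.
  obtain ⟨σ, hσ, n₀, hn₀, h⟩ := exists_measure_exists_lt_le (𝒟 := 𝒟) (c₁ := 2 * |c₁|)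
    (a := 2 * Real.exp |Real.log a|) (v := 2 * |v|) hc (by positivity) (by positivity) hη
    (show 0 < p / (L + 1) by positivity)
  refine ⟨σ, hσ, n₀, hn₀, fun N ξ hξ I _ hI T T₀ hT hT₀ hTΘ hT₀Θ => ?_⟩
  have hne : Nonempty I := Fintype.card_pos_iff.1 (by omega)
  obtain ⟨F, hF, hb, hc₁, he⟩ := henv N ξ hξ
  obtain ⟨F₀, hF₀, hb₀, hc₁₀, he₀⟩ := henv N M.ξ₀ (htrue N)
  have key : ∀ l, (Measure.pi fun _ : I => M.P) {x | ∃ t ∈ T, ∃ s ∈ T₀,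
        ∫ D, momentDiff M ξ t s l D ^ 2 ∂M.P ≤ σ ∧ η * √(Fintype.card I) <
        |∑ j, (momentDiff M ξ t s l (x j) - ∫ D, momentDiff M ξ t s l D ∂M.P)|} ≤
      ENNReal.ofReal (p / (L + 1)) := by
    intro l
    set A : Set (EuclideanSpace ℝ (Fin d) × EuclideanSpace ℝ (Fin d)) :=
      {q | (q.1 ∈ T ∧ q.2 ∈ T₀) ∧ ∫ D, momentDiff M ξ q.1 q.2 l D ^ 2 ∂M.P ≤ σ} with hA
    have hAc : A.Countable := (hT.prod hT₀).mono fun q hq => hq.1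
    have : Countable A := hAc.to_subtype
    rcases A.eq_empty_or_nonempty with h0 | h0
    · refine (measure_mono (t := ∅) ?_).trans (by simp)
      rintro x ⟨t, ht, s, hs, h1, -⟩
      exact Set.notMem_empty (t, s) (h0 ▸ (⟨⟨ht, hs⟩, h1⟩ : (t, s) ∈ A))
    · have : Nonempty A := h0.to_subtype
      have hcl := entropyClass_momentDiff hc ha (h_reg.measurable N ξ hξ)
        (h_reg.measurable N _ (htrue N)) hF hF₀ hb hb₀ hc₁ hc₁₀ he he₀
        (t := fun q : A => q.1.1) (s := fun q : A => q.1.2) (fun q => hTΘ q.2.1.1)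
        (fun q => hT₀Θ q.2.1.2) l I
      refine le_trans (measure_mono ?_) (h M.P I hI A _ _ hcl fun q => q.2.2)
      rintro x ⟨t, ht, s, hs, h1, h2⟩
      exact ⟨⟨(t, s), ⟨ht, hs⟩, h1⟩, h2⟩
  rw [Set.ofPred_exists]
  refine (measure_iUnion_le _).trans ?_
  rw [tsum_fintype]
  refine (Finset.sum_le_sum fun l _ => key l).trans ?_
  simp only [Finset.sum_const, Finset.card_univ, Fintype.card_fin, nsmul_eq_mul]
  rw [← ENNReal.ofReal_natCast, ← ENNReal.ofReal_mul (by positivity)]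
  refine ENNReal.ofReal_le_ofReal ?_
  rw [mul_div_assoc', div_le_iff₀ (by positivity)]
  nlinarith

end Differences

/-! ### From countable separating sets to all of Θ -/

section Extension

variable {𝒟 V : Type*} [MeasurableSpace 𝒟] {d L : ℕ} {M : Model 𝒟 V d L}

/-- Passing from a separating set of pairs of indices to all of `Θ`. -/
lemma abs_sum_momentDiff_le_of_separable [IsProbabilityMeasure M.P] (h_reg : M.Regularity)
    (htrue : ∀ N, M.ξ₀ ∈ M.ΞN N) {N : ℕ} {ξ : EuclideanSpace ℝ (Fin d) → V} (hξ : ξ ∈ M.ΞN N)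
    {T T₀ : Set (EuclideanSpace ℝ (Fin d))} (hT : M.PointwiseSeparable T ξ)
    (hT₀ : M.PointwiseSeparable T₀ M.ξ₀) (hTΘ : T ⊆ M.Θ) (hT₀Θ : T₀ ⊆ M.Θ)
    {σ b : ℝ} {I : Type*} [Fintype I] {x : I → 𝒟} {l : Fin L}
    (hx : ∀ t ∈ T, ∀ s ∈ T₀, ∫ D, momentDiff M ξ t s l D ^ 2 ∂M.P ≤ σ →
      |∑ j, (momentDiff M ξ t s l (x j) - ∫ D, momentDiff M ξ t s l D ∂M.P)| ≤ b)
    {θ : EuclideanSpace ℝ (Fin d)} (hθ : θ ∈ M.Θ)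
    (hσ : ∫ D, momentDiff M ξ θ θ l D ^ 2 ∂M.P < σ) :
    |∑ j, (momentDiff M ξ θ θ l (x j) - ∫ D, momentDiff M ξ θ θ l D ∂M.P)| ≤ b := by
  obtain ⟨c, c₁, a, v, hc, ha, henv⟩ := h_reg.envelope_entropy
  obtain ⟨F, hF, hb, hc₁, -⟩ := henv N ξ hξ
  obtain ⟨F₀, hF₀, hb₀, hc₁₀, -⟩ := henv N M.ξ₀ (htrue N)
  -- The classes at ξ and at ξ₀ are approximated along unrelated sequences of indices; this is why
  -- `momentDiff` carries two of them.
  obtain ⟨t, htT, ht⟩ := hT θ hθ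
  obtain ⟨s, hsT, hs⟩ := hT₀ θ hθ
  set G : 𝒟 → ℝ := fun D => |F D| + |F₀ D| with hG
  have hp : (2 : ℝ≥0∞) ≤ ENNReal.ofReal c := by
    rw [← ENNReal.ofReal_ofNat]; exact ENNReal.ofReal_le_ofReal hc.le
  have hFL : MemLp F 2 M.P := MemLp.mono_exponent
    ⟨hF.aestronglyMeasurable, hc₁.trans_lt ENNReal.ofReal_lt_top⟩ hp
  have hFL₀ : MemLp F₀ 2 M.P := MemLp.mono_exponent
    ⟨hF₀.aestronglyMeasurable, hc₁₀.trans_lt ENNReal.ofReal_lt_top⟩ hp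
  have hGL : MemLp G 2 M.P := hFL.abs.add hFL₀.abs
  have hlim : ∀ D, Tendsto (fun m => momentDiff M ξ (t m) (s m) l D) atTop
      (𝓝 (momentDiff M ξ θ θ l D)) := by
    intro D
    have hcont : Continuous fun y : EuclideanSpace ℝ (Fin L) => y l := by fun_prop
    exact ((hcont.tendsto _).comp (ht D)).sub ((hcont.tendsto _).comp (hs D))
  have hmeas : ∀ m, Measurable (momentDiff M ξ (t m) (s m) l) := fun m => by
    have h1 := h_reg.measurable N ξ hξ _ (hTΘ (htT m))
    have h2 := h_reg.measurable N _ (htrue N) _ (hT₀Θ (hsT m))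
    unfold momentDiff
    fun_prop
  have hbd : ∀ m, ∀ᵐ D ∂M.P, |momentDiff M ξ (t m) (s m) l D| ≤ G D := fun m => by
    filter_upwards [hb, hb₀] with D h1 h2
    exact (abs_sub _ _).trans (add_le_add ((h1 _ (hTΘ (htT m)) l).trans (le_abs_self _))
      ((h2 _ (hT₀Θ (hsT m)) l).trans (le_abs_self _)))
  have hI : Tendsto (fun m => ∫ D, momentDiff M ξ (t m) (s m) l D ∂M.P) atTop
      (𝓝 (∫ D, momentDiff M ξ θ θ l D ∂M.P)) :=
    tendsto_integral_of_dominated_convergence G (fun m => (hmeas m).aestronglyMeasurable)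
      (hGL.integrable (by norm_num)) (fun m => hbd m) (ae_of_all _ hlim)
  have hI2 : Tendsto (fun m => ∫ D, momentDiff M ξ (t m) (s m) l D ^ 2 ∂M.P) atTop
      (𝓝 (∫ D, momentDiff M ξ θ θ l D ^ 2 ∂M.P)) := by
    refine tendsto_integral_of_dominated_convergence (fun D => G D ^ 2)
      (fun m => ((hmeas m).pow_const 2).aestronglyMeasurable)
      hGL.integrable_sq (fun m => ?_) (ae_of_all _ fun D => (hlim D).pow 2)
    filter_upwards [hbd m] with D hD
    rw [Real.norm_of_nonneg (sq_nonneg _), ← sq_abs]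
    gcongr
  have hS : Tendsto (fun m => |∑ j, (momentDiff M ξ (t m) (s m) l (x j) -
      ∫ D, momentDiff M ξ (t m) (s m) l D ∂M.P)|) atTop
      (𝓝 |∑ j, (momentDiff M ξ θ θ l (x j) - ∫ D, momentDiff M ξ θ θ l D ∂M.P)|) :=
    (tendsto_finsetSum _ fun j _ => (hlim (x j)).sub hI).abs
  -- The mean squares of the approximating differences converge to a value strictly below σ, so
  -- eventually the pairs satisfy the condition in `hx`.
  refine le_of_tendsto hS ?_
  filter_upwards [hI2.eventually (gt_mem_nhds hσ)] with m hm
  exact hx _ (htT m) _ (hsT m) hm.le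

lemma integral_momentDiff_sq_le [IsProbabilityMeasure M.P] (h_reg : M.Regularity)
    (htrue : ∀ N, M.ξ₀ ∈ M.ΞN N) {N : ℕ} {ξ : EuclideanSpace ℝ (Fin d) → V} (hξ : ξ ∈ M.ΞN N)
    {θ : EuclideanSpace ℝ (Fin d)} (hθ : θ ∈ M.Θ) {r : ℝ}
    (hr : eLpNorm (fun D => M.g D θ (ξ θ) - M.g D θ (M.ξ₀ θ)) 2 M.P ≤ ENNReal.ofReal r)
    (l : Fin L) : ∫ D, momentDiff M ξ θ θ l D ^ 2 ∂M.P ≤ r ^ 2 := by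
  have h1 := h_reg.measurable N ξ hξ _ hθ
  have h2 := h_reg.measurable N _ (htrue N) _ hθ
  have hm : Measurable (momentDiff M ξ θ θ l) := by unfold momentDiff; fun_prop
  have h3 : eLpNorm (momentDiff M ξ θ θ l) 2 M.P ≤ ENNReal.ofReal |r| := by
    refine (eLpNorm_mono fun D => ?_).trans (hr.trans (ENNReal.ofReal_le_ofReal (le_abs_self r)))
    simpa [momentDiff] using PiLp.norm_apply_le (M.g D θ (ξ θ) - M.g D θ (M.ξ₀ θ)) l
  have h4 := eLpNorm_nnreal_pow_eq_lintegral (f := momentDiff M ξ θ θ l) (μ := M.P) (p := 2)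
    (by norm_num)
  simp only [NNReal.coe_ofNat, ENNReal.rpow_ofNat, ENNReal.coe_ofNat] at h4
  rw [integral_eq_lintegral_of_nonneg_ae (ae_of_all _ fun D => sq_nonneg _)
    (hm.pow_const 2).aestronglyMeasurable]
  have h5 : ∀ D, ENNReal.ofReal (momentDiff M ξ θ θ l D ^ 2) =
      ‖momentDiff M ξ θ θ l D‖ₑ ^ 2 := fun D => by
    rw [← ofReal_norm, ← ENNReal.ofReal_pow (norm_nonneg _), Real.norm_eq_abs, sq_abs]
  simp_rw [h5]
  rw [← h4]
  refine ENNReal.toReal_le_of_le_ofReal (by positivity) ?_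
  calc eLpNorm (momentDiff M ξ θ θ l) 2 M.P ^ 2 ≤ ENNReal.ofReal |r| ^ 2 := by gcongr
    _ = _ := by rw [← ENNReal.ofReal_pow (abs_nonneg _), sq_abs]

/-- The centred difference of the summed moments at `ξ` and at the true nuisance parameter. -/
noncomputable def centredDiff (M : Model 𝒟 V d L) {I : Type*} (s : Finset I) (x : I → 𝒟)
    (ξ : EuclideanSpace ℝ (Fin d) → V) (θ : EuclideanSpace ℝ (Fin d)) :
    EuclideanSpace ℝ (Fin L) :=
  ∑ j ∈ s, ((M.g (x j) θ (ξ θ) - M.g (x j) θ (M.ξ₀ θ)) -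
    (M.mean θ (ξ θ) - M.mean θ (M.ξ₀ θ)))

lemma integrable_moment [IsProbabilityMeasure M.P] (h_reg : M.Regularity) {N : ℕ}
    {ξ : EuclideanSpace ℝ (Fin d) → V} (hξ : ξ ∈ M.ΞN N)
    {θ : EuclideanSpace ℝ (Fin d)} (hθ : θ ∈ M.Θ) :
    Integrable (fun D => M.g D θ (ξ θ)) M.P := by
  obtain ⟨c, c₁, a, v, hc, ha, henv⟩ := h_reg.envelope_entropy
  obtain ⟨F, hF, hb, hc₁, -⟩ := henv N ξ hξ
  have hFL : Integrable F M.P := by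
    refine (MemLp.mono_exponent (p := 1)
      ⟨hF.aestronglyMeasurable, hc₁.trans_lt ENNReal.ofReal_lt_top⟩ ?_).integrable le_rfl
    rw [← ENNReal.ofReal_one]; exact ENNReal.ofReal_le_ofReal (by linarith)
  refine (hFL.const_mul (L : ℝ)).mono' (h_reg.measurable N ξ hξ θ hθ).aestronglyMeasurable ?_
  filter_upwards [hb] with D hD
  refine (norm_le_sum_abs _).trans ((Finset.sum_le_sum fun l _ => hD θ hθ l).trans ?_)
  simp

/-- Passing through the ℓ¹ norm costs a factor L, which is later absorbed in the choice of η. -/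
lemma norm_centredDiff_le [IsProbabilityMeasure M.P] (h_reg : M.Regularity)
    (htrue : ∀ N, M.ξ₀ ∈ M.ΞN N) {N : ℕ} {ξ : EuclideanSpace ℝ (Fin d) → V} (hξ : ξ ∈ M.ΞN N)
    {I : Type*} (s : Finset I) {x : I → 𝒟} {θ : EuclideanSpace ℝ (Fin d)} (hθ : θ ∈ M.Θ) {b : ℝ}
    (h : ∀ l, |∑ j : s, (momentDiff M ξ θ θ l (x j) - ∫ D, momentDiff M ξ θ θ l D ∂M.P)| ≤ b) :
    ‖centredDiff M s x ξ θ‖ ≤ L * b := by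
  have h1 := integrable_moment h_reg hξ hθ
  have h2 := integrable_moment h_reg (htrue N) hθ
  have h3 : ∀ l, (M.mean θ (ξ θ) - M.mean θ (M.ξ₀ θ)) l =
      ∫ D, momentDiff M ξ θ θ l D ∂M.P := by
    intro l
    rw [Model.mean, Model.mean, ← integral_sub h1 h2]
    exact ((EuclideanSpace.proj (𝕜 := ℝ) l).integral_comp_comm (h1.sub h2)).symm
  refine (norm_le_sum_abs _).trans ((Finset.sum_le_sum fun l _ => ?_).trans
    (le_of_eq (by simp : ∑ _l : Fin L, b = L * b)))
  refine le_trans (le_of_eq ?_) (h l)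
  rw [Finset.univ_eq_attach, Finset.sum_attach s fun j =>
    (momentDiff M ξ θ θ l (x j) - ∫ D, momentDiff M ξ θ θ l D ∂M.P)]
  congr 1
  rw [centredDiff, WithLp.ofLp_sum, Finset.sum_apply]
  refine Finset.sum_congr rfl fun j _ => ?_
  rw [PiLp.sub_apply, h3]
  rfl

end Extension

/-! ### Stochastic equicontinuity -/

section Equicontinuity

variable {𝒟 V : Type*} [MeasurableSpace 𝒟] {d L K : ℕ} {M : Model 𝒟 V d L}
  {Ω : Type*} [MeasurableSpace Ω] {μ : Measure Ω} {X : ℕ → Ω → 𝒟}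

lemma map_subsample_eq_pi (hX_meas : ∀ i, Measurable (X i)) (hX_indep : iIndepFun X μ)
    (hX_law : ∀ i, μ.map (X i) = M.P) [IsProbabilityMeasure μ] {N : ℕ} (s : Finset (Fin N)) :
    μ.map (fun ω (i : s) => X i ω) = Measure.pi fun _ : s => M.P := by
  have h := hX_indep.precomp (g := fun i : s => ((i : Fin N) : ℕ))
    (fun a b hab => Subtype.ext (Fin.ext hab))
  rw [(iIndepFun_iff_map_fun_eq_pi_map fun i => (hX_meas _).aemeasurable).1 h]
  simp [hX_law]

lemma measurable_subsample (hX_meas : ∀ i, Measurable (X i)) {N : ℕ} (s : Finset (Fin N)) :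
    Measurable fun ω (i : s) => X i ω :=
  measurable_pi_lambda _ fun _ => hX_meas _

lemma exists_eventually_sq_lt {r : ℕ → ℝ} (hr : Tendsto r atTop (𝓝 0)) {σ : ℝ} (hσ : 0 < σ) :
    ∀ᶠ N in atTop, r N ^ 2 < σ := by
  have h := hr.pow 2
  rw [zero_pow two_ne_zero] at h
  exact h.eventually (gt_mem_nhds hσ)

/-- Stochastic equicontinuity for a fixed nuisance parameter, uniformly over the nuisance
realization sets. -/
lemma exists_measure_centredDiff_le [IsProbabilityMeasure M.P] [IsProbabilityMeasure μ]
    (hX_meas : ∀ i, Measurable (X i))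
    (hX_indep : iIndepFun X μ) (hX_law : ∀ i, μ.map (X i) = M.P) (h_reg : M.Regularity)
    (htrue : ∀ N, M.ξ₀ ∈ M.ΞN N) {η p : ℝ} (hη : 0 < η) (hp : 0 < p) :
    ∃ N₀ : ℕ, ∀ N ≥ N₀, ∀ ξ ∈ M.ΞN N,
      μ {ω | ¬ ∀ θ ∈ M.Θ, ‖centredDiff M Finset.univ (fun i : Fin N => X i ω) ξ θ‖ ≤
        L * (η * √N)} ≤ ENNReal.ofReal p := by
  obtain ⟨σ, hσ, n₀, hn₀, h⟩ := exists_measure_momentDiff_le h_reg htrue hη hp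
  obtain ⟨r, hr, -, hrM⟩ := h_reg.mean_square_rate
  obtain ⟨N₁, hN₁⟩ := eventually_atTop.1 (exists_eventually_sq_lt hr hσ)
  refine ⟨max n₀ N₁, fun N hN ξ hξ => ?_⟩
  obtain ⟨T, hTc, hTΘ, hT⟩ := h_reg.separable N ξ hξ
  obtain ⟨T₀, hT₀c, hT₀Θ, hT₀⟩ := h_reg.separable N _ (htrue N)
  set s : Finset (Fin N) := Finset.univ with hs
  have hcard : Fintype.card s = N := by simp [hs]
  have h1 := h N ξ hξ s (by rw [hcard]; exact (le_max_left _ _).trans hN) T T₀ hTc hT₀c hTΘ hT₀Θ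
  rw [← map_subsample_eq_pi hX_meas hX_indep hX_law s, hcard] at h1
  -- `Measure.le_map_apply` holds for arbitrary sets, so outer probabilities transfer from the law
  -- of the sample without any measurability of the bad set.
  refine le_trans (measure_mono fun ω hω => ?_) ((Measure.le_map_apply
    (measurable_subsample hX_meas s).aemeasurable _).trans h1)
  by_contra hcon
  refine hω fun θ hθ => norm_centredDiff_le h_reg htrue hξ s hθ fun l => ?_
  refine abs_sum_momentDiff_le_of_separable h_reg htrue hξ hT hT₀ hTΘ hT₀Θ (σ := σ)
    (fun t ht u hu htu => ?_) hθ ((integral_momentDiff_sq_le h_reg htrue hξ hθ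
      (hrM N ξ hξ θ hθ) l).trans_lt (hN₁ N ((le_max_right _ _).trans hN)))
  by_contra hlt
  exact hcon ⟨l, t, ht, u, hu, htu, not_le.1 hlt⟩

/-- A bound for the measure of a set in a product space through its large sections. -/
lemma prod_measure_le_add {α β : Type*} [MeasurableSpace α] [MeasurableSpace β] (ν : Measure α)
    (ρ : Measure β) [IsProbabilityMeasure ν] [IsProbabilityMeasure ρ] {A : Set (α × β)}
    (hA : MeasurableSet A) (p : ℝ≥0∞) :
    (ν.prod ρ) A ≤ p + ν {y | p < ρ (Prod.mk y ⁻¹' A)} := by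
  have hm : MeasurableSet {y | p < ρ (Prod.mk y ⁻¹' A)} :=
    measurableSet_lt measurable_const (measurable_measure_prodMk_left hA)
  rw [Measure.prod_apply hA]
  calc ∫⁻ y, ρ (Prod.mk y ⁻¹' A) ∂ν
      ≤ ∫⁻ y, p + {y | p < ρ (Prod.mk y ⁻¹' A)}.indicator 1 y ∂ν := by
        refine lintegral_mono fun y => ?_
        by_cases hy : p < ρ (Prod.mk y ⁻¹' A)
        · rw [Set.indicator_of_mem (by exact hy)]
          exact prob_le_one.trans le_add_self
        · exact (not_lt.1 hy).trans le_self_add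
    _ = _ := by
        rw [lintegral_add_left measurable_const, lintegral_indicator_one hm]
        simp

/-- The pairs of training and test samples on which the empirical process at the estimated
nuisance parameter is large. -/
def foldBadSet (M : Model 𝒟 V d L)
    (est : (N : ℕ) → (S : Finset (Fin N)) → (S → 𝒟) → EuclideanSpace ℝ (Fin d) → V)
    (T T₀ : Set (EuclideanSpace ℝ (Fin d))) (σ b : ℝ) {N : ℕ} (S I : Finset (Fin N)) :
    Set ((S → 𝒟) × (I → 𝒟)) :=
  {q | ∃ l, ∃ t ∈ T, ∃ s ∈ T₀, ∫ D, momentDiff M (est N S q.1) t s l D ^ 2 ∂M.P ≤ σ ∧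
    b < |∑ j, (momentDiff M (est N S q.1) t s l (q.2 j) -
      ∫ D, momentDiff M (est N S q.1) t s l D ∂M.P)|}

/-- Countability of the index sets and joint measurability of the estimated moments give
measurability, without which independence and Fubini could not be applied to the training and test
samples. -/
lemma measurableSet_foldBadSet [IsProbabilityMeasure M.P]
    {est : (N : ℕ) → (S : Finset (Fin N)) → (S → 𝒟) → EuclideanSpace ℝ (Fin d) → V}
    (h_est : MeasurableEstimator M est) (h_reg : M.Regularity) (htrue : ∀ N, M.ξ₀ ∈ M.ΞN N)
    {T T₀ : Set (EuclideanSpace ℝ (Fin d))} (hTc : T.Countable) (hT₀c : T₀.Countable)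
    (hTΘ : T ⊆ M.Θ) (hT₀Θ : T₀ ⊆ M.Θ) (σ b : ℝ) {N : ℕ} (S I : Finset (Fin N)) :
    MeasurableSet (foldBadSet M est T T₀ σ b S I) := by
  have hset : foldBadSet M est T T₀ σ b S I = ⋃ l, ⋃ t ∈ T, ⋃ s ∈ T₀,
      {q | ∫ D, momentDiff M (est N S q.1) t s l D ^ 2 ∂M.P ≤ σ ∧
        b < |∑ j, (momentDiff M (est N S q.1) t s l (q.2 j) -
          ∫ D, momentDiff M (est N S q.1) t s l D ∂M.P)|} := by
    ext q; simp only [foldBadSet, Set.mem_ofPred_eq, Set.mem_iUnion, exists_prop]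
  rw [hset]
  refine MeasurableSet.iUnion fun l => MeasurableSet.biUnion hTc fun t ht =>
    MeasurableSet.biUnion hT₀c fun s hs => ?_
  have hjoint : Measurable fun q : (S → 𝒟) × 𝒟 => momentDiff M (est N S q.1) t s l q.2 := by
    have h1 := h_est.measurable N S t (hTΘ ht)
    have h2 := h_reg.measurable N _ (htrue N) s (hT₀Θ hs)
    unfold momentDiff
    fun_prop
  have hI : Measurable fun y : S → 𝒟 => ∫ D, momentDiff M (est N S y) t s l D ∂M.P :=
    (StronglyMeasurable.integral_prod_right (f := fun (y : S → 𝒟) D =>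
      momentDiff M (est N S y) t s l D) hjoint.stronglyMeasurable).measurable
  have hI2 : Measurable fun y : S → 𝒟 => ∫ D, momentDiff M (est N S y) t s l D ^ 2 ∂M.P :=
    (StronglyMeasurable.integral_prod_right (f := fun (y : S → 𝒟) D =>
      momentDiff M (est N S y) t s l D ^ 2) (hjoint.pow_const 2).stronglyMeasurable).measurable
  have hsum : Measurable fun q : (S → 𝒟) × (I → 𝒟) =>
      ∑ j, (momentDiff M (est N S q.1) t s l (q.2 j) -
        ∫ D, momentDiff M (est N S q.1) t s l D ∂M.P) := by
    refine Finset.measurable_sum _ fun j _ => Measurable.sub ?_ (hI.comp measurable_fst)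
    exact hjoint.comp (f := fun q : (S → 𝒟) × (I → 𝒟) => (q.1, q.2 j)) (by fun_prop)
  exact (measurableSet_le (hI2.comp measurable_fst) measurable_const).inter
    (measurableSet_lt measurable_const hsum.abs)

/-- The indices in fold `k`. -/
def inFold {N K : ℕ} (J : Fin N → Fin K) (k : Fin K) : Finset (Fin N) :=
  Finset.univ.filter fun i => J i = k

lemma disjoint_outOfFold_inFold {N K : ℕ} (J : Fin N → Fin K) (k : Fin K) :
    Disjoint (outOfFold J k) (inFold J k) :=
  (Finset.disjoint_filter_filter_not _ _ _).symm

/-- Conditionally on the partition and the training sample, the test sample is rarely bad. -/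
lemma measure_foldBadSet_le [IsProbabilityMeasure M.P] [IsProbabilityMeasure μ]
    (hX_meas : ∀ i, Measurable (X i))
    (hX_indep : iIndepFun X μ) (hX_law : ∀ i, μ.map (X i) = M.P)
    {J : (N : ℕ) → Ω → Fin N → Fin K} (hJ : RandomFolds μ X J)
    {N : ℕ} (k : Fin K) {A : ∀ j : Fin N → Fin K, Set ((outOfFold j k → 𝒟) × (inFold j k → 𝒟))}
    (hA : ∀ j, MeasurableSet (A j)) {p : ℝ≥0∞} {G : Set Ω}
    (hG : ∀ ω, p < (Measure.pi fun _ : inFold (J N ω) k => M.P)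
      (Prod.mk (fun i : outOfFold (J N ω) k => X i ω) ⁻¹' A (J N ω)) → ω ∈ G) :
    μ {ω | ((fun i : outOfFold (J N ω) k => X i ω), (fun i : inFold (J N ω) k => X i ω)) ∈
      A (J N ω)} ≤ p + μ G := by
  classical
  have hJm := hJ.measurable N
  -- The training samples for which an independent test sample is bad with probability above p; by
  -- `hG` they occur only inside G.
  set B : ∀ j : Fin N → Fin K, Set (outOfFold j k → 𝒟) := fun j =>
    {y | p < (Measure.pi fun _ : inFold j k => M.P) (Prod.mk y ⁻¹' A j)} with hB
  have hBm : ∀ j, MeasurableSet (B j) := fun j =>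
    measurableSet_lt measurable_const (measurable_measure_prodMk_left (hA j))
  set Y : ∀ j : Fin N → Fin K, Ω → (outOfFold j k → 𝒟) := fun j ω i => X i ω with hY
  set Z : ∀ j : Fin N → Fin K, Ω → (inFold j k → 𝒟) := fun j ω i => X i ω with hZ
  have hYm : ∀ j, Measurable (Y j) := fun j => measurable_subsample hX_meas _
  have hZm : ∀ j, Measurable (Z j) := fun j => measurable_subsample hX_meas _
  have hXN : iIndepFun (fun (i : Fin N) => X i) μ := hX_indep.precomp Fin.val_injective
  have hJset : ∀ j, MeasurableSet (J N ⁻¹' {j}) := fun j => hJm (measurableSet_singleton j)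
  have hlaw : ∀ j, μ {ω | (Y j ω, Z j ω) ∈ A j} ≤ p + μ {ω | Y j ω ∈ B j} := by
    intro j
    have h1 : IndepFun (Y j) (Z j) μ := hXN.indepFun_finset _ _ (disjoint_outOfFold_inFold j k)
      (fun i => hX_meas i)
    have h2 := (indepFun_iff_map_prod_eq_prod_map_map (hYm j).aemeasurable
      (hZm j).aemeasurable).1 h1
    have h3 : μ {ω | (Y j ω, Z j ω) ∈ A j} = ((μ.map (Y j)).prod (μ.map (Z j))) (A j) := by
      rw [← h2, Measure.map_apply ((hYm j).prodMk (hZm j)) (hA j)]; rfl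
    have : IsProbabilityMeasure (μ.map (Y j)) :=
      Measure.isProbabilityMeasure_map (hYm j).aemeasurable
    have hZlaw : μ.map (Z j) = Measure.pi fun _ : inFold j k => M.P :=
      map_subsample_eq_pi hX_meas hX_indep hX_law _
    rw [h3, hZlaw]
    refine (prod_measure_le_add _ _ (hA j) p).trans (add_le_add le_rfl (le_of_eq ?_))
    rw [Measure.map_apply (hYm j) (hBm j)]; rfl
  have hind : ∀ j, IndepFun (J N) (fun ω => (Y j ω, Z j ω)) μ := fun j =>
    (hJ.indep N).comp (φ := id)
      (ψ := fun x : Fin N → 𝒟 => ((fun i : outOfFold j k => x i), (fun i : inFold j k => x i)))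
      measurable_id (by fun_prop)
  have hind' : ∀ j, IndepFun (J N) (Y j) μ := fun j =>
    (hind j).comp (φ := id) measurable_id measurable_fst
  have hj : ∀ j, μ (J N ⁻¹' {j} ∩ {ω | (Y j ω, Z j ω) ∈ A j}) ≤
      μ (J N ⁻¹' {j}) * p + μ (J N ⁻¹' {j} ∩ Y j ⁻¹' B j) := by
    intro j
    have h1 : μ (J N ⁻¹' {j} ∩ {ω | (Y j ω, Z j ω) ∈ A j}) =
        μ (J N ⁻¹' {j}) * μ {ω | (Y j ω, Z j ω) ∈ A j} :=
      (hind j).measure_inter_preimage_eq_mul _ _ (measurableSet_singleton j) (hA j)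
    rw [h1, (hind' j).measure_inter_preimage_eq_mul _ _ (measurableSet_singleton j) (hBm j),
      ← mul_add]
    gcongr
    exact hlaw j
  have hdisj : Pairwise (Function.onFun Disjoint fun j => J N ⁻¹' {j}) := fun i j hij =>
    Disjoint.preimage _ (by simpa using hij)
  calc _ ≤ μ (⋃ j, J N ⁻¹' {j} ∩ {ω | (Y j ω, Z j ω) ∈ A j}) := by
        refine measure_mono fun ω hω => Set.mem_iUnion.2 ⟨J N ω, rfl, hω⟩
    _ ≤ ∑ j, μ (J N ⁻¹' {j} ∩ {ω | (Y j ω, Z j ω) ∈ A j}) := by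
        rw [← tsum_fintype (L := .unconditional _)]
        exact measure_iUnion_le _
    _ ≤ ∑ j, (μ (J N ⁻¹' {j}) * p + μ (J N ⁻¹' {j} ∩ Y j ⁻¹' B j)) :=
        Finset.sum_le_sum fun j _ => hj j
    -- Additivity is used on these measurable pieces first; the union is then compared with G, which
    -- need not be measurable.
    _ = μ (⋃ j, J N ⁻¹' {j}) * p + μ (⋃ j, J N ⁻¹' {j} ∩ Y j ⁻¹' B j) := by
        rw [Finset.sum_add_distrib, ← Finset.sum_mul, measure_iUnion hdisj hJset,
          measure_iUnion (fun i j hij => (hdisj hij).mono Set.inter_subset_left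
            Set.inter_subset_left) (fun j => (hJset j).inter (hYm j (hBm j))),
          tsum_fintype, tsum_fintype]
    _ ≤ 1 * p + μ G := by
        gcongr
        · exact prob_le_one
        · refine Set.iUnion_subset fun j => ?_
          rintro ω ⟨rfl, hω⟩
          exact hG ω hω
    _ = _ := by rw [one_mul]

/-- Stochastic equicontinuity at the cross-fitted estimates. -/
lemma exists_measure_centredDiff_fold_le [IsProbabilityMeasure M.P] [IsProbabilityMeasure μ]
    (hX_meas : ∀ i, Measurable (X i))
    (hX_indep : iIndepFun X μ) (hX_law : ∀ i, μ.map (X i) = M.P) (h_reg : M.Regularity)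
    (htrue : ∀ N, M.ξ₀ ∈ M.ΞN N)
    {J : (N : ℕ) → Ω → Fin N → Fin K} (hJ : RandomFolds μ X J)
    {est : (N : ℕ) → (S : Finset (Fin N)) → (S → 𝒟) → EuclideanSpace ℝ (Fin d) → V}
    (h_est : MeasurableEstimator M est)
    {φ : ℕ → ℝ} (hφ : Tendsto φ atTop (𝓝 0))
    (hφM : ∀ N k, μ {ω | foldEstimate est (J N ω) (fun i => X i ω) k ∉ M.ΞN N} ≤
      ENNReal.ofReal (φ N))
    {η p : ℝ} (hη : 0 < η) (hp : 0 < p) :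
    ∃ N₀ : ℕ, ∀ N ≥ N₀, ∀ k,
      μ {ω | ¬ (foldEstimate est (J N ω) (fun i => X i ω) k ∈ M.ΞN N ∧ ∀ θ ∈ M.Θ,
        ‖centredDiff M (inFold (J N ω) k) (fun i : Fin N => X i ω)
          (foldEstimate est (J N ω) (fun i => X i ω) k) θ‖ ≤ L * (η * √N))} ≤
        ENNReal.ofReal p := by
  -- One third for the bad test samples; the event that the estimate leaves `M.ΞN N` is counted
  -- twice, once in conditioning and once in the final union.
  obtain ⟨σ, hσ, n₀, hn₀, h⟩ := exists_measure_momentDiff_le h_reg htrue hη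
    (show 0 < p / 3 by positivity)
  obtain ⟨r, hr, -, hrM⟩ := h_reg.mean_square_rate
  obtain ⟨N₁, hN₁⟩ := eventually_atTop.1 ((exists_eventually_sq_lt hr hσ).and
    (hφ.eventually (gt_mem_nhds (show 0 < p / 3 by positivity))))
  have hK : 0 < K := by have := hJ.two_le; omega
  -- N ≥ n₀ K guarantees at least n₀ observations in every fold.
  refine ⟨max (n₀ * K) N₁, fun N hN k => ?_⟩
  have hNK : n₀ ≤ N / K := (Nat.le_div_iff_mul_le hK).2 ((le_max_left _ _).trans hN)
  obtain ⟨hrN, hφN⟩ := hN₁ N ((le_max_right _ _).trans hN)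
  obtain ⟨T, hTc, hTΘ, hT⟩ := h_est.separable N
  obtain ⟨T₀, hT₀c, hT₀Θ, hT₀⟩ := h_reg.separable N _ (htrue N)
  set G : Set Ω := {ω | foldEstimate est (J N ω) (fun i => X i ω) k ∉ M.ΞN N} with hG
  set A : ∀ j : Fin N → Fin K, Set ((outOfFold j k → 𝒟) × (inFold j k → 𝒟)) := fun j =>
    foldBadSet M est T T₀ σ (η * √(Fintype.card (inFold j k))) (outOfFold j k) (inFold j k)
    with hA
  have hbad := measure_foldBadSet_le hX_meas hX_indep hX_law hJ k (A := A)
    (fun j => measurableSet_foldBadSet h_est h_reg htrue hTc hT₀c hTΘ hT₀Θ _ _ _ _)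
    (p := ENNReal.ofReal (p / 3)) (G := G) (fun ω hω hmem => by
      refine absurd (h N _ hmem (inFold (J N ω) k) ?_ T T₀ hTc hT₀c hTΘ hT₀Θ) (not_le.2 hω)
      rw [Fintype.card_coe]
      exact hNK.trans (hJ.le_card N ω k))
  have hsub : {ω | ¬ (foldEstimate est (J N ω) (fun i => X i ω) k ∈ M.ΞN N ∧ ∀ θ ∈ M.Θ,
      ‖centredDiff M (inFold (J N ω) k) (fun i : Fin N => X i ω)
        (foldEstimate est (J N ω) (fun i => X i ω) k) θ‖ ≤ L * (η * √N))} ⊆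
      {ω | ((fun i : outOfFold (J N ω) k => X i ω), (fun i : inFold (J N ω) k => X i ω)) ∈
        A (J N ω)} ∪ G := by
    intro ω hω
    by_contra hcon
    rw [Set.mem_union, not_or] at hcon
    obtain ⟨hcon1, hcon2⟩ := hcon
    have hmem : foldEstimate est (J N ω) (fun i => X i ω) k ∈ M.ΞN N := not_not.1 hcon2
    refine hω ⟨hmem, fun θ hθ => norm_centredDiff_le h_reg htrue hmem _ hθ fun l => ?_⟩
    refine le_trans (abs_sum_momentDiff_le_of_separable h_reg htrue hmem (hT _ _ hmem) hT₀ hTΘ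
      hT₀Θ (σ := σ) (b := η * √(Fintype.card (inFold (J N ω) k))) (fun t ht u hu htu => ?_) hθ
      ((integral_momentDiff_sq_le h_reg htrue hmem hθ (hrM N _ hmem θ hθ) l).trans_lt hrN)) ?_
    · by_contra hlt
      exact hcon1 ⟨l, t, ht, u, hu, htu, not_le.1 hlt⟩
    · gcongr
      rw [Fintype.card_coe]
      exact (Finset.card_le_univ _).trans_eq (Fintype.card_fin N)
  refine (measure_mono hsub).trans ((measure_union_le _ _).trans ?_)
  have hGp : μ G ≤ ENNReal.ofReal (p / 3) :=
    (hφM N k).trans (ENNReal.ofReal_le_ofReal hφN.le)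
  calc _ ≤ (ENNReal.ofReal (p / 3) + ENNReal.ofReal (p / 3)) + ENNReal.ofReal (p / 3) :=
        add_le_add (hbad.trans (add_le_add le_rfl hGp)) hGp
    _ = ENNReal.ofReal p := by
        rw [← ENNReal.ofReal_add (by positivity) (by positivity),
          ← ENNReal.ofReal_add (by positivity) (by positivity)]
        congr 1; ring

end Equicontinuity

/-! ### Bias bound and stochastic boundedness of the limit process -/

section Bias

/-- The mean value inequality, applied first to the derivative, which vanishes at 0, and then to the
function, over intervals of length at most 1. Differentiability stops short of r = 1, which is
reached by continuity. -/
lemma norm_sub_le_of_second_deriv {E : Type*} [NormedAddCommGroup E] [NormedSpace ℝ E]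
    {f : ℝ → E} {s : ℝ} (hcont : ContinuousOn f (Set.Icc 0 1))
    (hd : DifferentiableOn ℝ f (Set.Ico 0 1)) (h0 : derivWithin f (Set.Ico 0 1) 0 = 0)
    (hd2 : DifferentiableOn ℝ (derivWithin f (Set.Ico 0 1)) (Set.Ico 0 1))
    (hs : ∀ r ∈ Set.Ico (0 : ℝ) 1,
      ‖derivWithin (derivWithin f (Set.Ico 0 1)) (Set.Ico 0 1) r‖ ≤ s) :
    ‖f 1 - f 0‖ ≤ s := by
  have h0mem : (0 : ℝ) ∈ Set.Ico (0 : ℝ) 1 := by simp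
  have hs0 : 0 ≤ s := (norm_nonneg _).trans (hs 0 h0mem)
  have hconv : Convex ℝ (Set.Ico (0 : ℝ) 1) := convex_Ico 0 1
  have habs : ∀ r ∈ Set.Ico (0 : ℝ) 1, ‖r - 0‖ ≤ 1 := fun r hr => by
    rw [sub_zero, Real.norm_of_nonneg hr.1]; exact hr.2.le
  have h1 : ∀ r ∈ Set.Ico (0 : ℝ) 1, ‖derivWithin f (Set.Ico 0 1) r‖ ≤ s := by
    intro r hr
    have := hconv.norm_image_sub_le_of_norm_derivWithin_le hd2 hs h0mem hr
    rw [h0, sub_zero] at this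
    exact this.trans (mul_le_of_le_one_right hs0 (habs r hr))
  have h2 : ∀ r ∈ Set.Ico (0 : ℝ) 1, ‖f r - f 0‖ ≤ s := fun r hr =>
    (hconv.norm_image_sub_le_of_norm_derivWithin_le hd h1 h0mem hr).trans
      (mul_le_of_le_one_right hs0 (habs r hr))
  have h3 : Tendsto (fun r => ‖f r - f 0‖) (𝓝[Set.Ico 0 1] 1) (𝓝 ‖f 1 - f 0‖) :=
    (((hcont 1 (by simp)).mono Set.Ico_subset_Icc_self).sub_const (f 0)).norm
  have : (𝓝[Set.Ico (0 : ℝ) 1] 1).NeBot := by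
    rw [← mem_closure_iff_nhdsWithin_neBot, closure_Ico (by norm_num)]
    simp
  exact le_of_tendsto h3 (eventually_nhdsWithin_of_forall h2)

variable {𝒟 V : Type*} [MeasurableSpace 𝒟] {d L : ℕ} {M : Model 𝒟 V d L}
  {Ω : Type*} [MeasurableSpace Ω] {μ : Measure Ω}

lemma exists_bias_le [SeminormedAddCommGroup V] [NormedSpace ℝ V] {K : ℕ}
    {ξhat : (N : ℕ) → Fin K → Ω → EuclideanSpace ℝ (Fin d) → V} (h : M.Orthogonality μ ξhat) :
    ∃ s : ℕ → ℝ, Tendsto (fun N : ℕ => √N * s N) atTop (𝓝 0) ∧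
      ∀ N, ∀ ξ ∈ M.ΞN N, ∀ θ ∈ M.Θ, ‖M.mean θ (ξ θ) - M.mean θ (M.ξ₀ θ)‖ ≤ s N := by
  obtain ⟨s, hs, hsM⟩ := h.second_order
  refine ⟨s, ?_, fun N ξ hξ θ hθ => ?_⟩
  · refine hs.tendsto_div_nhds_zero.congr fun N => ?_
    rw [Real.rpow_neg (by positivity), ← Real.sqrt_eq_rpow, div_inv_eq_mul, mul_comm]
  · obtain ⟨hd, h0⟩ := h.neyman N ξ hξ θ hθ
    obtain ⟨hd2, hs2⟩ := hsM N ξ hξ θ hθ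
    have := norm_sub_le_of_second_deriv (h.continuous N ξ hξ θ hθ) hd h0 hd2 hs2
    simpa [Model.pathMean] using this

/-- Markov's inequality for the outer expectation. -/
lemma measure_le_of_outerExpectation_lt [IsProbabilityMeasure μ] {f : Ω → ℝ} (h0 : ∀ ω, 0 ≤ f ω)
    (h1 : ∀ ω, f ω ≤ 1) {p : ℝ} (hf : outerExpectation μ f < p) {A : Set Ω}
    (hA : ∀ ω ∈ A, 1 ≤ f ω) : μ A ≤ ENNReal.ofReal p := by
  have hne : Set.Nonempty {r : ℝ | ∃ u : Ω → ℝ, Integrable u μ ∧ (∀ ω, f ω ≤ u ω) ∧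
      r = ∫ ω, u ω ∂μ} := ⟨_, fun _ => 1, integrable_const _, h1, rfl⟩
  obtain ⟨r, ⟨u, hu, hfu, rfl⟩, hr⟩ := exists_lt_of_csInf_lt hne hf
  have h2 := mul_meas_ge_le_integral_of_nonneg
    (ae_of_all _ fun ω => (h0 ω).trans (hfu ω)) hu 1
  rw [one_mul] at h2
  calc μ A ≤ μ {ω | 1 ≤ u ω} := measure_mono fun ω hω => (hA ω hω).trans (hfu ω)
    _ = ENNReal.ofReal (μ.real {ω | 1 ≤ u ω}) := (ofReal_measureReal (measure_ne_top _ _)).symm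
    _ ≤ _ := ENNReal.ofReal_le_ofReal (h2.trans hr.le)

/-- The bounded continuous function `x ↦ min (1, max (0, ‖x‖ - R))`. -/
noncomputable def normRamp (E : Type*) [SeminormedAddCommGroup E] (R : ℝ) :
    BoundedContinuousFunction E ℝ :=
  BoundedContinuousFunction.ofNormedAddCommGroup (fun x => min 1 (max 0 (‖x‖ - R)))
    (by fun_prop) 1 (fun x => by
      rw [Real.norm_of_nonneg (le_min zero_le_one (le_max_left _ _))]
      exact min_le_left _ _)

lemma normRamp_apply {E : Type*} [SeminormedAddCommGroup E] (R : ℝ) (x : E) :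
    normRamp E R x = min 1 (max 0 (‖x‖ - R)) := rfl

/-- At each fixed point the ramp vanishes once R exceeds the norm, and it is bounded by 1; dominated
convergence applies. -/
lemma tendsto_integral_normRamp {E : Type*} [SeminormedAddCommGroup E] {Ω' : Type*}
    [MeasurableSpace Ω'] (μ' : Measure Ω') [IsProbabilityMeasure μ'] {Δ : Ω' → E}
    (hΔ : @Measurable _ _ _ (borel _) Δ) :
    Tendsto (fun R : ℕ => ∫ ω, normRamp E R (Δ ω) ∂μ') atTop (𝓝 0) := by
  have h1 : ∀ x : E, Tendsto (fun R : ℕ => normRamp E R x) atTop (𝓝 0) := by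
    intro x
    obtain ⟨R₀, hR₀⟩ := exists_nat_ge ‖x‖
    refine tendsto_const_nhds.congr' ?_
    filter_upwards [eventually_ge_atTop R₀] with R hR
    have : ‖x‖ ≤ R := hR₀.trans (by exact_mod_cast hR)
    rw [normRamp_apply, max_eq_left (by linarith), min_eq_right zero_le_one]
  have h2 := tendsto_integral_of_dominated_convergence (μ := μ')
    (F := fun (R : ℕ) ω => normRamp E R (Δ ω)) (f := fun _ => (0 : ℝ)) (fun _ => 1) (fun R => ?_)
    (integrable_const _) (fun R => ae_of_all _ fun ω => ?_) (ae_of_all _ fun ω => h1 _)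
  · simpa using h2
  · borelize E
    exact ((normRamp E R).continuous.measurable.comp hΔ).aestronglyMeasurable
  · rw [normRamp_apply, Real.norm_of_nonneg (le_min zero_le_one (le_max_left _ _))]
    exact min_le_left _ _

/-- The Donsker property implies that the supremum of the empirical process is stochastically
bounded. -/
lemma exists_measure_empiricalDeviation_le [IsProbabilityMeasure μ] {X : ℕ → Ω → 𝒟}
    {Ω' : Type*} [MeasurableSpace Ω'] {μ' : Measure Ω'} [IsProbabilityMeasure μ']
    {Θ' : Set (EuclideanSpace ℝ (Fin d))}
    {Δ : Ω' → lp (fun _ : Θ' => EuclideanSpace ℝ (Fin L)) ∞}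
    (h : M.Donsker μ X μ' Θ' Δ) {p : ℝ} (hp : 0 < p) :
    ∃ R : ℝ, 0 < R ∧ ∃ N₀ : ℕ, ∀ N ≥ N₀, μ {ω | ¬ ∀ θ ∈ M.Θ,
      ‖(√N)⁻¹ • ∑ i : Fin N, (M.g (X i ω) θ (M.ξ₀ θ) - M.mean θ (M.ξ₀ θ))‖ ≤ R} ≤
      ENNReal.ofReal p := by
  obtain ⟨-, hΘ, -, hΔ, -, -, -, -, G, hG, hlim⟩ := h
  -- The ramp equals 1 where the norm is at least R + 1. Its outer expectation along the empirical
  -- processes converges to a limit below p, and Markov's inequality gives the tail bound.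
  obtain ⟨R, hR⟩ := ((tendsto_integral_normRamp μ' hΔ).eventually (gt_mem_nhds hp)).exists
  obtain ⟨N₀, hN₀⟩ := eventually_atTop.1 ((hlim (normRamp _ R)).eventually (gt_mem_nhds hR))
  refine ⟨R + 1, by positivity, max N₀ 1, fun N hN => ?_⟩
  have h1 : μ {ω | ¬ ‖G N ω‖ ≤ R + 1} ≤ ENNReal.ofReal p := by
    refine measure_le_of_outerExpectation_lt (f := fun ω => normRamp _ R (G N ω))
      (fun ω => le_min zero_le_one (le_max_left _ _)) (fun ω => min_le_left _ _)
      (hN₀ N ((le_max_left _ _).trans hN)) fun ω hω => ?_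
    rw [Set.mem_ofPred_eq, not_le] at hω
    rw [normRamp_apply]
    exact le_min le_rfl (le_max_of_le_right (by linarith))
  refine (measure_mono_ae ?_).trans h1
  filter_upwards [hG N ((le_max_right _ _).trans hN)] with ω hω hbad hle
  refine hbad fun θ hθ => ?_
  rw [← hω ⟨θ, hΘ hθ⟩]
  exact (lp.norm_apply_le_norm (by simp) _ _).trans hle

end Bias

/-! ### The sample criterion -/

section PosNorm

variable {L : ℕ}

lemma posNorm_eq_zero {x : EuclideanSpace ℝ (Fin L)} (h : ∀ l, x l ≤ 0) : posNorm x = 0 := by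
  rw [posNorm, norm_eq_zero]
  ext l
  simpa using h l

/-- The positive part is 1-Lipschitz in each coordinate. -/
lemma posNorm_le_add (x y : EuclideanSpace ℝ (Fin L)) : posNorm x ≤ posNorm y + ‖x - y‖ := by
  refine (norm_le_norm_add_norm_sub' _ (WithLp.toLp 2 fun l => max (y l) 0)).trans
    (add_le_add le_rfl ?_)
  rw [EuclideanSpace.norm_eq, EuclideanSpace.norm_eq]
  refine Real.sqrt_le_sqrt (Finset.sum_le_sum fun l _ => ?_)
  have : ‖max (x l) 0 - max (y l) 0‖ ≤ ‖x l - y l‖ := by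
    simpa using abs_max_sub_max_le_abs (x l) (y l) 0
  gcongr
  simpa using this

end PosNorm

section Criterion

variable {𝒟 V : Type*} [MeasurableSpace 𝒟] {d L : ℕ} {M : Model 𝒟 V d L}

/-- The averaged sample moment `(1/N) ∑ᵢ g(xᵢ, θ, ξᵢ(θ))`. -/
noncomputable def sampleMoment (M : Model 𝒟 V d L) {N : ℕ} (x : Fin N → 𝒟)
    (ξ : Fin N → EuclideanSpace ℝ (Fin d) → V) (θ : EuclideanSpace ℝ (Fin d)) :
    EuclideanSpace ℝ (Fin L) :=
  (N : ℝ)⁻¹ • ∑ i, M.g (x i) θ (ξ i θ)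

/-- The empirical process at the true nuisance parameter. -/
noncomputable def empiricalDeviation (M : Model 𝒟 V d L) {N : ℕ} (x : Fin N → 𝒟)
    (θ : EuclideanSpace ℝ (Fin d)) : EuclideanSpace ℝ (Fin L) :=
  (√N)⁻¹ • ∑ i : Fin N, (M.g (x i) θ (M.ξ₀ θ) - M.mean θ (M.ξ₀ θ))

/-- Linearization of the sample moment around the population moment at the true parameter. -/
lemma norm_sampleMoment_sub_mean_le {N : ℕ} (hN : 0 < N) {x : Fin N → 𝒟}
    {ξ : Fin N → EuclideanSpace ℝ (Fin d) → V} {θ : EuclideanSpace ℝ (Fin d)} {s W : ℝ}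
    (h1 : ‖∑ i, ((M.g (x i) θ (ξ i θ) - M.g (x i) θ (M.ξ₀ θ)) -
      (M.mean θ (ξ i θ) - M.mean θ (M.ξ₀ θ)))‖ ≤ √N / 2)
    (h2 : ∀ i, ‖M.mean θ (ξ i θ) - M.mean θ (M.ξ₀ θ)‖ ≤ s) (hs : √N * s ≤ 1 / 2)
    (hW : ‖empiricalDeviation M x θ‖ ≤ W) :
    ‖sampleMoment M x ξ θ - M.mean θ (M.ξ₀ θ)‖ ≤ (W + 1) / √N := by
  have hNr : (0 : ℝ) < N := by exact_mod_cast hN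
  have hsN : 0 < √(N : ℝ) := Real.sqrt_pos.2 hNr
  have hsq : √(N : ℝ) * √N = N := Real.mul_self_sqrt hNr.le
  -- Centred difference, bias and empirical process: the three sums are at most √N/2, N s ≤ √N/2 and
  -- √N W.
  have h3 : sampleMoment M x ξ θ - M.mean θ (M.ξ₀ θ) = (N : ℝ)⁻¹ •
      (∑ i, ((M.g (x i) θ (ξ i θ) - M.g (x i) θ (M.ξ₀ θ)) -
        (M.mean θ (ξ i θ) - M.mean θ (M.ξ₀ θ))) +
      ∑ i, (M.mean θ (ξ i θ) - M.mean θ (M.ξ₀ θ)) +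
      ∑ i, (M.g (x i) θ (M.ξ₀ θ) - M.mean θ (M.ξ₀ θ))) := by
    rw [← Finset.sum_add_distrib, ← Finset.sum_add_distrib]
    have : ∀ i, (M.g (x i) θ (ξ i θ) - M.g (x i) θ (M.ξ₀ θ) -
        (M.mean θ (ξ i θ) - M.mean θ (M.ξ₀ θ)) + (M.mean θ (ξ i θ) - M.mean θ (M.ξ₀ θ)) +
        (M.g (x i) θ (M.ξ₀ θ) - M.mean θ (M.ξ₀ θ))) =
        M.g (x i) θ (ξ i θ) - M.mean θ (M.ξ₀ θ) := fun i => by abel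
    simp_rw [this]
    rw [Finset.sum_sub_distrib, smul_sub, Finset.sum_const, Finset.card_univ, Fintype.card_fin,
      ← Nat.cast_smul_eq_nsmul ℝ, smul_smul, inv_mul_cancel₀ hNr.ne', one_smul]
    rfl
  have h4 : ‖∑ i, (M.mean θ (ξ i θ) - M.mean θ (M.ξ₀ θ))‖ ≤ N * s := by
    refine (norm_sum_le _ _).trans ((Finset.sum_le_sum fun i _ => h2 i).trans (le_of_eq ?_))
    simp
  have h5 : ‖∑ i, (M.g (x i) θ (M.ξ₀ θ) - M.mean θ (M.ξ₀ θ))‖ ≤ √N * W := by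
    rw [empiricalDeviation, norm_smul, norm_inv, Real.norm_of_nonneg hsN.le,
      inv_mul_le_iff₀ hsN] at hW
    exact hW
  rw [h3, norm_smul, norm_inv, Real.norm_of_nonneg hNr.le, inv_mul_le_iff₀ hNr]
  have h6 : (N : ℝ) * ((W + 1) / √N) = √N * (W + 1) := by
    calc (N : ℝ) * ((W + 1) / √N) = (√N * √N) * ((W + 1) / √N) := by rw [hsq]
      _ = √N * (W + 1) := by field_simp
  rw [h6]
  refine (norm_add₃_le).trans ?_
  have h7 : (N : ℝ) * s = √N * (√N * s) := by rw [← mul_assoc, hsq]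
  nlinarith

lemma Q_nonneg {N : ℕ} (x : Fin N → 𝒟) (ξ : Fin N → EuclideanSpace ℝ (Fin d) → V)
    (θ : EuclideanSpace ℝ (Fin d)) : 0 ≤ M.Q x ξ θ := sq_nonneg _

/-- The criterion vanishes on a contraction of the identified set whose moments are below the
sampling error. -/
lemma Q_eq_zero_of_mem_contraction {N : ℕ} {x : Fin N → 𝒟}
    {ξ : Fin N → EuclideanSpace ℝ (Fin d) → V} {θ : EuclideanSpace ℝ (Fin d)} {C δ e b : ℝ}
    (hC : ∀ ε : ℝ, 0 ≤ ε → ∀ θ ∈ M.contraction ε, ∀ l,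
      M.mean θ (M.ξ₀ θ) l ≤ -C * min ε δ)
    (he : 0 ≤ e) (heδ : e ≤ δ) (hb : b ≤ C * e) (hθ : θ ∈ M.contraction e)
    (h : ‖sampleMoment M x ξ θ - M.mean θ (M.ξ₀ θ)‖ ≤ b) : M.Q x ξ θ = 0 := by
  have h1 : posNorm (sampleMoment M x ξ θ) = 0 := by
    refine posNorm_eq_zero fun l => ?_
    have h2 := hC e he θ hθ l
    rw [min_eq_left heδ] at h2
    have h3 := (PiLp.norm_apply_le (sampleMoment M x ξ θ - M.mean θ (M.ξ₀ θ)) l).trans h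
    rw [PiLp.sub_apply, Real.norm_eq_abs] at h3
    linarith [(abs_le.1 h3).2]
  unfold Model.Q
  unfold sampleMoment at h1
  rw [h1]; norm_num

/-- A contour point has a sample moment with positive part at most √R/√N, hence a population moment
with positive part at most (√R + b)/√N. As this is below δ, the minimum in the partial
identification condition is its linear branch, which bounds the distance. -/
lemma infEDist_le_of_mem_contourSet (h_nonempty : M.identifiedSet.Nonempty) {N : ℕ} (hN : 0 < N)
    {x : Fin N → 𝒟} {ξ : Fin N → EuclideanSpace ℝ (Fin d) → V} {θ : EuclideanSpace ℝ (Fin d)}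
    {C δ c R b : ℝ} (hC0 : 0 < C)
    (hC : ∀ θ ∈ M.Θ, min (C * Metric.infDist θ M.identifiedSet) δ ≤
      posNorm (M.mean θ (M.ξ₀ θ)))
    (hcR : c ≤ R) (hθ : θ ∈ M.contourSet x ξ c)
    (h : ‖sampleMoment M x ξ θ - M.mean θ (M.ξ₀ θ)‖ ≤ b / √N) (hδ : (√R + b) / √N < δ) :
    Metric.infEDist θ M.identifiedSet ≤ ENNReal.ofReal ((√R + b) / C * (√N)⁻¹) := by
  have hNr : (0 : ℝ) < N := by exact_mod_cast hN
  have hsN : 0 < √(N : ℝ) := Real.sqrt_pos.2 hNr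
  have h1 : posNorm (sampleMoment M x ξ θ) ≤ √R / √N := by
    have h2 : (N : ℝ) * posNorm (sampleMoment M x ξ θ) ^ 2 ≤ R := hθ.2.trans hcR
    rw [le_div_iff₀ hsN]
    refine Real.le_sqrt_of_sq_le ?_
    rw [mul_pow, Real.sq_sqrt hNr.le]
    linarith
  have h3 : posNorm (M.mean θ (M.ξ₀ θ)) ≤ (√R + b) / √N := by
    refine (posNorm_le_add _ (sampleMoment M x ξ θ)).trans ?_
    rw [norm_sub_rev, add_div]
    exact add_le_add h1 h
  have h4 := (hC θ hθ.1).trans h3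
  have h5 : C * Metric.infDist θ M.identifiedSet ≤ (√R + b) / √N := by
    rcases min_le_iff.1 h4 with h6 | h6
    · exact h6
    · exact absurd h6 (not_le.2 hδ)
  rw [← ENNReal.ofReal_toReal (Metric.infEDist_ne_top h_nonempty)]
  refine ENNReal.ofReal_le_ofReal ?_
  change Metric.infDist θ M.identifiedSet ≤ _
  have h7 : (√R + b) / C * (√N)⁻¹ = (√R + b) / √N / C := by field_simp
  rw [h7, le_div_iff₀ hC0]
  linarith

end Criterion

/-! ### Degeneracy and rate of convergence from the expansion -/

section Main

variable {𝒟 V : Type*} [MeasurableSpace 𝒟] {d L : ℕ} {M : Model 𝒟 V d L}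
  {Ω : Type*} [MeasurableSpace Ω] {μ : Measure Ω} {X : ℕ → Ω → 𝒟}

lemma tendsto_const_div_sqrt (a : ℝ) : Tendsto (fun N : ℕ => a / √(N : ℝ)) atTop (𝓝 0) :=
  tendsto_const_nhds.div_atTop (Real.tendsto_sqrt_atTop.comp tendsto_natCast_atTop_atTop)

/-- The supremum over `Θ` of the empirical process at the true nuisance parameter. -/
noncomputable def empiricalSup (M : Model 𝒟 V d L) {N : ℕ} (x : Fin N → 𝒟) : ℝ :=
  ⨆ θ : M.Θ, ‖empiricalDeviation M x θ‖

lemma empiricalSup_nonneg {N : ℕ} (x : Fin N → 𝒟) : 0 ≤ empiricalSup M x :=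
  Real.iSup_nonneg fun _ => norm_nonneg _

/-- A bound R is required because the real supremum of an unbounded family takes the default value
0. -/
lemma le_empiricalSup {N : ℕ} {x : Fin N → 𝒟} {R : ℝ}
    (h : ∀ θ ∈ M.Θ, ‖empiricalDeviation M x θ‖ ≤ R) {θ : EuclideanSpace ℝ (Fin d)}
    (hθ : θ ∈ M.Θ) : ‖empiricalDeviation M x θ‖ ≤ empiricalSup M x :=
  le_ciSup (f := fun θ : M.Θ => ‖empiricalDeviation M x θ‖)
    ⟨R, by rintro _ ⟨θ, rfl⟩; exact h θ θ.2⟩ ⟨θ, hθ⟩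

lemma empiricalSup_le (hne : M.Θ.Nonempty) {N : ℕ} {x : Fin N → 𝒟} {R : ℝ}
    (h : ∀ θ ∈ M.Θ, ‖empiricalDeviation M x θ‖ ≤ R) : empiricalSup M x ≤ R :=
  have : Nonempty M.Θ := hne.to_subtype
  ciSup_le fun θ => h θ θ.2

/-- Degeneracy of the sample criterion. -/
lemma degenerate_of_equicontinuous [IsProbabilityMeasure μ]
    (h_nonempty : M.identifiedSet.Nonempty) (h_contr : M.ContractionCondition)
    (hdonsker : ∀ p : ℝ, 0 < p → ∃ R : ℝ, 0 < R ∧ ∃ N₀ : ℕ, ∀ N ≥ N₀,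
      μ {ω | ¬ ∀ θ ∈ M.Θ, ‖empiricalDeviation M (fun i : Fin N => X i ω) θ‖ ≤ R} ≤
        ENNReal.ofReal p)
    {s : ℕ → ℝ} (hs : Tendsto (fun N : ℕ => √N * s N) atTop (𝓝 0))
    (hbias : ∀ N, ∀ ξ ∈ M.ΞN N, ∀ θ ∈ M.Θ, ‖M.mean θ (ξ θ) - M.mean θ (M.ξ₀ θ)‖ ≤ s N)
    (hequi : ∀ p : ℝ, 0 < p → ∃ N₀ : ℕ, ∀ N ≥ N₀, ∀ ξ ∈ M.ΞN N,
      μ {ω | ¬ ∀ θ ∈ M.Θ, ‖centredDiff M Finset.univ (fun i : Fin N => X i ω) ξ θ‖ ≤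
        √N / 2} ≤ ENNReal.ofReal p) :
    M.Degenerate μ X := by
  classical
  obtain ⟨C, κ, δ, hC0, hκ0, hδ0, hC, hκ⟩ := h_contr
  have hΘ : M.identifiedSet ⊆ M.Θ := fun θ hθ => hθ.1
  -- The depth at which the slack C e of the population moments equals the sampling error. It
  -- involves the data only through the process at ξ₀, hence not ξ.
  set e : (N : ℕ) → (Fin N → 𝒟) → ℝ := fun N x => (empiricalSup M x + 1) / (C * √N) with he
  have he0 : ∀ N x, 0 ≤ e N x := fun N x => by
    have := empiricalSup_nonneg (M := M) x
    simp only [he]; positivity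
  -- Contractions are controlled only up to depth δ; falling back on Θ_I itself makes the Hausdorff
  -- bound hold for every sample.
  refine ⟨fun N x => if e N x ≤ δ then M.contraction (e N x) else M.identifiedSet,
    fun N x => κ * e N x, fun N x => ?_, fun p hp => ?_, fun N x => ?_, fun p hp => ?_⟩
  · beta_reduce
    split_ifs
    · exact fun θ hθ => hΘ hθ.1
    · exact hΘ
  · obtain ⟨R, hR0, N₁, hN₁⟩ := hdonsker (p / 2) (by positivity)
    obtain ⟨N₂, hN₂⟩ := hequi (p / 2) (by positivity)
    obtain ⟨N₃, hN₃⟩ := eventually_atTop.1 ((hs.eventually (gt_mem_nhds (show (0:ℝ) < 1 / 2 by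
      norm_num))).and ((tendsto_const_div_sqrt ((R + 1) / C)).eventually (gt_mem_nhds hδ0)))
    refine ⟨max (max N₁ N₂) (max N₃ 1), fun N hN ξ hξ => ?_⟩
    have hN1 : N₁ ≤ N := by omega
    have hN2 : N₂ ≤ N := by omega
    have hN3 : N₃ ≤ N := by omega
    have hN0 : 0 < N := by omega
    have hsN : 0 < √(N : ℝ) := Real.sqrt_pos.2 (by exact_mod_cast hN0)
    obtain ⟨hs2, hδN⟩ := hN₃ N hN3
    have hsub : {ω | ¬ ∀ θ ∈ if e N (fun i => X i ω) ≤ δ then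
          M.contraction (e N fun i => X i ω) else M.identifiedSet,
        M.Q (fun i : Fin N => X i ω) (fun _ => ξ) θ
          - ⨅ θ' : M.Θ, M.Q (fun i : Fin N => X i ω) (fun _ => ξ) θ' = 0} ⊆
        {ω | ¬ ∀ θ ∈ M.Θ, ‖empiricalDeviation M (fun i : Fin N => X i ω) θ‖ ≤ R} ∪
        {ω | ¬ ∀ θ ∈ M.Θ, ‖centredDiff M Finset.univ (fun i : Fin N => X i ω) ξ θ‖ ≤
          √N / 2} := by
      intro ω hω
      by_contra hcon
      rw [Set.mem_union, not_or] at hcon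
      have hA := not_not.1 hcon.1
      have hB := not_not.1 hcon.2
      refine hω ?_
      have heδ : e N (fun i => X i ω) ≤ δ := by
        refine le_trans ?_ hδN.le
        simp only [he]
        rw [div_div]
        gcongr
        exact empiricalSup_le (h_nonempty.mono hΘ) hA
      rw [if_pos heδ]
      intro θ hθ
      have hθΘ := hΘ hθ.1
      have hQ : M.Q (fun i : Fin N => X i ω) (fun _ => ξ) θ = 0 := by
        refine Q_eq_zero_of_mem_contraction hC (he0 _ _) heδ (b := (empiricalSup M
          (fun i : Fin N => X i ω) + 1) / √N) (le_of_eq ?_) hθ ?_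
        · simp only [he]; field_simp
        · exact norm_sampleMoment_sub_mean_le hN0 (hB θ hθΘ) (fun _ => hbias N ξ hξ θ hθΘ) hs2.le
            (le_empiricalSup hA hθΘ)
      have hinf : ⨅ θ' : M.Θ, M.Q (fun i : Fin N => X i ω) (fun _ => ξ) θ' = 0 := by
        have : Nonempty M.Θ := ⟨⟨θ, hθΘ⟩⟩
        refine le_antisymm ?_ (le_ciInf fun θ' => Q_nonneg _ _ _)
        rw [← hQ]
        exact ciInf_le (f := fun θ' : M.Θ => M.Q (fun i : Fin N => X i ω) (fun _ => ξ) θ')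
          ⟨0, by rintro _ ⟨θ', rfl⟩; exact Q_nonneg _ _ _⟩ ⟨θ, hθΘ⟩
      rw [hQ, hinf, sub_zero]
    refine (measure_mono hsub).trans ((measure_union_le _ _).trans
      ((add_le_add (hN₁ N hN1) (hN₂ N hN2 ξ hξ)).trans (le_of_eq ?_)))
    rw [← ENNReal.ofReal_add (by positivity) (by positivity), add_halves]
  · beta_reduce
    split_ifs with h
    · exact hκ _ (he0 N x) h
    · rw [Metric.hausdorffEDist_self]; exact bot_le
  · obtain ⟨R, hR0, N₁, hN₁⟩ := hdonsker p hp
    refine ⟨κ * ((R + 1) / C), N₁, by positivity, fun N hN => ?_⟩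
    refine le_trans (measure_mono fun ω hω => ?_) (hN₁ N hN)
    rw [Set.mem_ofPred_eq]
    intro hA
    refine absurd hω (not_lt.2 (ENNReal.ofReal_le_ofReal ?_))
    simp only [he]
    rw [← div_div, mul_assoc, ← div_eq_mul_inv]
    gcongr
    exact empiricalSup_le (h_nonempty.mono hΘ) hA

/-- The sum over the folds of the centred differences at the fold estimates. -/
lemma norm_sum_centredDiff_le {K N : ℕ} {x : Fin N → 𝒟} (J : Fin N → Fin K)
    (ξ : Fin K → EuclideanSpace ℝ (Fin d) → V) (θ : EuclideanSpace ℝ (Fin d)) {b : ℝ}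
    (h : ∀ k, ‖centredDiff M (inFold J k) x (ξ k) θ‖ ≤ b) :
    ‖∑ i, ((M.g (x i) θ (ξ (J i) θ) - M.g (x i) θ (M.ξ₀ θ)) -
      (M.mean θ (ξ (J i) θ) - M.mean θ (M.ξ₀ θ)))‖ ≤ K * b := by
  rw [← Finset.sum_fiberwise Finset.univ J]
  have : ∀ k, ∑ i with J i = k, ((M.g (x i) θ (ξ (J i) θ) - M.g (x i) θ (M.ξ₀ θ)) -
      (M.mean θ (ξ (J i) θ) - M.mean θ (M.ξ₀ θ))) = centredDiff M (inFold J k) x (ξ k) θ := by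
    intro k
    refine Finset.sum_congr rfl fun i hi => ?_
    rw [(Finset.mem_filter.1 hi).2]
  simp_rw [this]
  refine (norm_sum_le _ _).trans ((Finset.sum_le_sum fun k _ => h k).trans (le_of_eq ?_))
  simp

/-- Rate of convergence of the contour sets. -/
lemma isBigOP_hausdorffEDist_contourSet [IsProbabilityMeasure μ]
    (h_nonempty : M.identifiedSet.Nonempty) (h_partial : M.PartialIdentification)
    (h_contr : M.ContractionCondition) {K : ℕ}
    (hdonsker : ∀ p : ℝ, 0 < p → ∃ R : ℝ, 0 < R ∧ ∃ N₀ : ℕ, ∀ N ≥ N₀,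
      μ {ω | ¬ ∀ θ ∈ M.Θ, ‖empiricalDeviation M (fun i : Fin N => X i ω) θ‖ ≤ R} ≤
        ENNReal.ofReal p)
    {s : ℕ → ℝ} (hs : Tendsto (fun N : ℕ => √N * s N) atTop (𝓝 0))
    (hbias : ∀ N, ∀ ξ ∈ M.ΞN N, ∀ θ ∈ M.Θ, ‖M.mean θ (ξ θ) - M.mean θ (M.ξ₀ θ)‖ ≤ s N)
    {J : (N : ℕ) → Ω → Fin N → Fin K}
    {ξhat : (N : ℕ) → Ω → Fin K → EuclideanSpace ℝ (Fin d) → V}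
    (hequi : ∀ p : ℝ, 0 < p → ∃ N₀ : ℕ, ∀ N ≥ N₀, ∀ k,
      μ {ω | ¬ (ξhat N ω k ∈ M.ΞN N ∧ ∀ θ ∈ M.Θ,
        ‖centredDiff M (inFold (J N ω) k) (fun i : Fin N => X i ω) (ξhat N ω k) θ‖ ≤
          √N / (2 * (K + 1)))} ≤ ENNReal.ofReal p)
    {c : ℕ → Ω → ℝ} (hc0 : WithProbToOne μ fun N ω => 0 ≤ c N ω)
    (hc : IsBigOP μ (fun N ω => ENNReal.ofReal (c N ω)) fun _ => 1) :
    IsBigOP μ (fun N ω => Metric.hausdorffEDist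
      (M.contourSet (fun i : Fin N => X i ω) (fun i => ξhat N ω (J N ω i)) (c N ω))
      M.identifiedSet) fun N => (√N)⁻¹ := by
  intro p hp
  obtain ⟨C', δ', hC'0, hδ'0, hC'⟩ := h_partial
  obtain ⟨C, κ, δ, hC0, hκ0, hδ0, hC, hκ⟩ := h_contr
  obtain ⟨R, hR0, N₁, hN₁⟩ := hdonsker (p / 4) (by positivity)
  -- Four exceptional events share p equally, and this share is split again over the K folds.
  obtain ⟨N₂, hN₂⟩ := hequi (p / 4 / (K + 1)) (by positivity)
  obtain ⟨Rc, N₃, hRc0, hN₃⟩ := hc (p / 4) (by positivity)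
  obtain ⟨N₄, hN₄⟩ := eventually_atTop.1 (((hs.eventually (gt_mem_nhds (show (0:ℝ) < 1 / 2 by
      norm_num))).and ((tendsto_const_div_sqrt ((R + 1) / C)).eventually (gt_mem_nhds hδ0))).and
      (((tendsto_const_div_sqrt (√Rc + (R + 1))).eventually (gt_mem_nhds hδ'0)).and
      (hc0.eventually (ge_mem_nhds (show (0 : ℝ≥0∞) < ENNReal.ofReal (p / 4) by simp [hp])))))
  -- The first summand bounds the excess of the contour set over Θ_I, the second that of Θ_I over
  -- the contour set.
  refine ⟨(√Rc + (R + 1)) / C' + κ * ((R + 1) / C), max (max N₁ N₂) (max N₃ (max N₄ 1)),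
    by positivity, fun N hN => ?_⟩
  have hN1 : N₁ ≤ N := by omega
  have hN2 : N₂ ≤ N := by omega
  have hN3 : N₃ ≤ N := by omega
  have hN0 : 0 < N := by omega
  obtain ⟨⟨hs2, hδN⟩, hδ'N, hc0N⟩ := hN₄ N (by omega)
  have hsN : 0 < √(N : ℝ) := Real.sqrt_pos.2 (by exact_mod_cast hN0)
  set E₁ : Set Ω := {ω | ¬ ∀ θ ∈ M.Θ, ‖empiricalDeviation M (fun i : Fin N => X i ω) θ‖ ≤ R}
  set E₂ : Fin K → Set Ω := fun k => {ω | ¬ (ξhat N ω k ∈ M.ΞN N ∧ ∀ θ ∈ M.Θ,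
        ‖centredDiff M (inFold (J N ω) k) (fun i : Fin N => X i ω) (ξhat N ω k) θ‖ ≤
          √N / (2 * (K + 1)))} with hE₂
  set E₃ : Set Ω := {ω | ENNReal.ofReal (Rc * 1) < ENNReal.ofReal (c N ω)}
  set E₄ : Set Ω := {ω | ¬ 0 ≤ c N ω}
  have hsub : {ω | ENNReal.ofReal (((√Rc + (R + 1)) / C' + κ * ((R + 1) / C)) * (√N)⁻¹) <
      Metric.hausdorffEDist
      (M.contourSet (fun i : Fin N => X i ω) (fun i => ξhat N ω (J N ω i)) (c N ω))
      M.identifiedSet} ⊆ (E₁ ∪ ⋃ k, E₂ k) ∪ (E₃ ∪ E₄) := by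
    intro ω hω
    by_contra hcon
    simp only [Set.mem_union, Set.mem_iUnion, not_or, not_exists] at hcon
    obtain ⟨⟨h1, h2⟩, h3, h4⟩ := hcon
    have h1 := not_not.1 h1
    have h2 := fun k => not_not.1 (h2 k)
    have h3 : c N ω ≤ Rc := by
      have : ENNReal.ofReal (c N ω) ≤ ENNReal.ofReal (Rc * 1) := not_lt.1 h3
      rwa [mul_one, ENNReal.ofReal_le_ofReal_iff hRc0.le] at this
    have h4 := not_not.1 h4
    have hclose : ∀ θ ∈ M.Θ, ‖sampleMoment M (fun i : Fin N => X i ω)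
        (fun i => ξhat N ω (J N ω i)) θ - M.mean θ (M.ξ₀ θ)‖ ≤ (R + 1) / √N := by
      intro θ hθ
      refine norm_sampleMoment_sub_mean_le hN0 ?_ (fun i => hbias N _ (h2 _).1 θ hθ) hs2.le
        (h1 θ hθ)
      refine (norm_sum_centredDiff_le (J N ω) (ξhat N ω) θ fun k => (h2 k).2 θ hθ).trans ?_
      rw [mul_div_assoc', div_le_div_iff₀ (by positivity) (by norm_num)]
      nlinarith
    refine absurd hω (not_lt.2 (Metric.hausdorffEDist_le_of_infEDist (fun θ hθ => ?_)
      fun θ hθ => ?_))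
    · refine (infEDist_le_of_mem_contourSet h_nonempty hN0 hC'0 hC' h3 hθ (hclose θ hθ.1)
        hδ'N).trans (ENNReal.ofReal_le_ofReal ?_)
      gcongr
      exact le_add_of_nonneg_right (by positivity)
    -- The criterion vanishes on the contraction at this depth, so c ≥ 0 puts the contraction inside
    -- the contour set; Θ_I is within κ times the depth of it.
    · have he : 0 ≤ (R + 1) / C / √N := by positivity
      have hsubset : M.contraction ((R + 1) / C / √N) ⊆
          M.contourSet (fun i : Fin N => X i ω) (fun i => ξhat N ω (J N ω i)) (c N ω) := by
        intro ϑ hϑ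
        refine ⟨hϑ.1.1, ?_⟩
        rw [Q_eq_zero_of_mem_contraction hC he hδN.le (b := (R + 1) / √N)
          (le_of_eq (by field_simp)) hϑ (hclose ϑ hϑ.1.1), mul_zero]
        exact h4
      refine (Metric.infEDist_anti hsubset).trans
        ((Metric.infEDist_le_hausdorffEDist_of_mem hθ).trans ?_)
      rw [Metric.hausdorffEDist_comm]
      refine (hκ _ he hδN.le).trans (ENNReal.ofReal_le_ofReal ?_)
      rw [add_mul, mul_assoc κ, ← div_eq_mul_inv ((R + 1) / C)]
      exact le_add_of_nonneg_left (by positivity)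
  have hE₂p : μ (⋃ k, E₂ k) ≤ ENNReal.ofReal (p / 4) := by
    refine (measure_iUnion_le _).trans ?_
    rw [tsum_fintype]
    refine (Finset.sum_le_sum fun k _ => hN₂ N hN2 k).trans ?_
    simp only [Finset.sum_const, Finset.card_univ, Fintype.card_fin, nsmul_eq_mul]
    rw [← ENNReal.ofReal_natCast, ← ENNReal.ofReal_mul (by positivity)]
    refine ENNReal.ofReal_le_ofReal ?_
    rw [mul_div_assoc', div_le_iff₀ (by positivity)]
    nlinarith
  calc _ ≤ μ ((E₁ ∪ ⋃ k, E₂ k) ∪ (E₃ ∪ E₄)) := measure_mono hsub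
    _ ≤ (μ E₁ + μ (⋃ k, E₂ k)) + (μ E₃ + μ E₄) :=
      (measure_union_le _ _).trans (add_le_add (measure_union_le _ _) (measure_union_le _ _))
    _ ≤ (ENNReal.ofReal (p / 4) + ENNReal.ofReal (p / 4)) +
        (ENNReal.ofReal (p / 4) + ENNReal.ofReal (p / 4)) :=
      add_le_add (add_le_add (hN₁ N hN1) hE₂p) (add_le_add (hN₃ N hN3) hc0N)
    _ = ENNReal.ofReal p := by
      rw [← ENNReal.ofReal_add (by positivity) (by positivity),
        ← ENNReal.ofReal_add (by positivity) (by positivity)]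
      congr 1; ring

end Main

end MomentInequality

/-! ### Assembly of the two conclusions -/

theorem mainTheorem2
    {𝒟 V : Type*} [MeasurableSpace 𝒟] [SeminormedAddCommGroup V] [NormedSpace ℝ V]
    {d L K : ℕ} (M : MomentInequality.Model 𝒟 V d L) [IsProbabilityMeasure M.P]
    {Ω : Type*} [MeasurableSpace Ω] (μ : Measure Ω) [IsProbabilityMeasure μ]
    -- the i.i.d. sample
    (X : ℕ → Ω → 𝒟) (hX_meas : ∀ i, Measurable (X i)) (hX_indep : iIndepFun X μ)
    (hX_law : ∀ i, μ.map (X i) = M.P)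
    -- cross-fitting
    (J : (N : ℕ) → Ω → Fin N → Fin K) (hJ : MomentInequality.RandomFolds μ X J)
    (est : (N : ℕ) → (S : Finset (Fin N)) → (S → 𝒟) → EuclideanSpace ℝ (Fin d) → V)
    (h_est : MomentInequality.MeasurableEstimator M est)
    -- the conditions on the model
    (h_nonempty : M.identifiedSet.Nonempty)
    (h_partial : M.PartialIdentification)
    (h_orth : M.Orthogonality μ (fun N k ω =>
      MomentInequality.foldEstimate est (J N ω) (fun i => X i ω) k))
    (h_reg : M.Regularity)
    {Ω' : Type*} [MeasurableSpace Ω'] (μ' : Measure Ω') [IsProbabilityMeasure μ']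
    (Θ' : Set (EuclideanSpace ℝ (Fin d)))
    (Δ : Ω' → lp (fun _ : Θ' => EuclideanSpace ℝ (Fin L)) ∞)
    (h_donsker : M.Donsker μ X μ' Θ' Δ)
    (h_contr : M.ContractionCondition) :
    M.Degenerate μ X ∧
    ∀ c : ℕ → Ω → ℝ,
      MomentInequality.WithProbToOne μ (fun N ω =>
        max (⨅ θ : M.Θ, M.Q (fun i : Fin N => X i ω)
            (fun i => MomentInequality.foldEstimate est (J N ω) (fun i => X i ω) (J N ω i)) θ)
          (Real.log N / Real.sqrt N) ≤ c N ω) →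
      MomentInequality.IsBigOP μ (fun N ω => ENNReal.ofReal (c N ω)) (fun _ => 1) →
      MomentInequality.IsBigOP μ (fun N ω =>
        Metric.hausdorffEDist
          (M.contourSet (fun i : Fin N => X i ω)
            (fun i => MomentInequality.foldEstimate est (J N ω) (fun i => X i ω) (J N ω i))
            (c N ω))
          M.identifiedSet) (fun N => (Real.sqrt N)⁻¹) := by
  have htrue : ∀ N, M.ξ₀ ∈ M.ΞN N := h_orth.true_mem
  obtain ⟨s, hs, hbias⟩ := MomentInequality.exists_bias_le h_orth
  have hdonsker : ∀ p : ℝ, 0 < p → ∃ R : ℝ, 0 < R ∧ ∃ N₀ : ℕ, ∀ N ≥ N₀, μ {ω | ¬ ∀ θ ∈ M.Θ,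
      ‖MomentInequality.empiricalDeviation M (fun i : Fin N => X i ω) θ‖ ≤ R} ≤
        ENNReal.ofReal p :=
    fun p hp => MomentInequality.exists_measure_empiricalDeviation_le h_donsker hp
  refine ⟨MomentInequality.degenerate_of_equicontinuous h_nonempty h_contr hdonsker hs hbias
    fun p hp => ?_, fun c hc hcO => ?_⟩
  -- This η turns the bound L η √N into at most √N/2; below, the additional factor K + 1 leaves room
  -- for summing over the folds.
  · obtain ⟨N₀, hN₀⟩ := MomentInequality.exists_measure_centredDiff_le hX_meas hX_indep hX_law
      h_reg htrue (show (0 : ℝ) < 1 / (2 * (L + 1)) by positivity) hp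
    refine ⟨N₀, fun N hN ξ hξ => (measure_mono fun ω hω => ?_).trans (hN₀ N hN ξ hξ)⟩
    rw [Set.mem_ofPred_eq]
    refine fun h => hω fun θ hθ => ?_
    refine (h θ hθ).trans ?_
    rw [one_div_mul_eq_div, mul_div_assoc', div_le_div_iff₀ (by positivity) (by norm_num)]
    nlinarith [Real.sqrt_nonneg N]
  · obtain ⟨φ, hφ, hφM⟩ := h_orth.estimate_mem
    refine MomentInequality.isBigOP_hausdorffEDist_contourSet h_nonempty h_partial h_contr
      hdonsker hs hbias
      (ξhat := fun N ω k => MomentInequality.foldEstimate est (J N ω) (fun i => X i ω) k)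
      (fun p hp => ?_) ?_ hcO
    · obtain ⟨N₀, hN₀⟩ := MomentInequality.exists_measure_centredDiff_fold_le hX_meas hX_indep
        hX_law h_reg htrue hJ h_est hφ hφM
        (show (0 : ℝ) < 1 / (2 * (L + 1) * (K + 1)) by positivity) hp
      refine ⟨N₀, fun N hN k => (measure_mono fun ω hω => ?_).trans (hN₀ N hN k)⟩
      rw [Set.mem_ofPred_eq]
      refine fun h => hω ⟨h.1, fun θ hθ => ?_⟩
      refine (h.2 θ hθ).trans ?_
      rw [one_div_mul_eq_div, mul_div_assoc', div_le_div_iff₀ (by positivity) (by positivity)]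
      have : 0 ≤ √(N : ℝ) * (K + 1) := by positivity
      nlinarith
    -- The lower bound on the level enters through log N/√N ≥ 0.
    · refine tendsto_of_tendsto_of_tendsto_of_le_of_le tendsto_const_nhds hc (fun _ => bot_le)
        fun N => measure_mono fun ω hω => ?_
      rw [Set.mem_ofPred_eq]
      exact fun h => hω ((div_nonneg (Real.log_natCast_nonneg N) (Real.sqrt_nonneg _)).trans
        ((le_max_right _ _).trans h))
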